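/- Conventions. Cardinals are identified with initial ordinals; "regular" means infinite and regular. For a regular cardinal $\theta$, $H(\theta)$ is the set of all sets hereditarily of cardinality $<\theta$. A *weak $\kappa$-model* is a (not necessarily transitive) set $M$ of size $\kappa$ with $\kappa+1\subseteq M$ and $\langle M,\in\rangle\models\mathsf{ZFC}^-$ ($\mathsf{ZFC}$ without the power set axiom, with the collection scheme). $M$ is *closed under ${<}\alpha$-sequences* if every function from an ordinal $\beta<\alpha$ to $M$ is an element of $M$. An elementary embedding $j\colon M\to N$ with $N$ transitive is *$\kappa$-powerset preserving* if it has critical point $\kappa$ and $M$ and $N$ have the same subsets of $\kappa$. A *filter on $\kappa$* is a family $F\subseteq\mathcal P(\kappa)$ such that every intersection of finitely many elements of $F$ has size $\kappa$ (it need not be closed upwards or under intersections). It is *$M$-normal* if for every $A\in\mathcal P(\kappa)\cap M$ either $A\in F$ or $\kappa\setminus A\in F$, and for every sequence $\langle X_\gamma\mid\gamma<\kappa\rangle\in M$ of elements of $F$ the diagonal intersection $\{\beta<\kappa\mid \forall\gamma<\beta\ \beta\in X_\gamma\}$ is in $F$. An $M$-normal filter $F$ is *good* if $F\cap A\in M$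 for every $A\in M$ of size at most $\kappa$ in $M$, and the ultrapower of $M$ by $F$ (formed with functions $f\in M$ with domain $\kappa$) is well-founded. For regular cardinals $\alpha\le\kappa$, a regular cardinal $\theta$ and a set $A$, let $\mathrm{E}(\theta,A)$ be the statement: there is a weak $\kappa$-model $M\prec H(\theta)$, closed under ${<}\alpha$-sequences, with $A\in M$, for which there exists a $\kappa$-powerset preserving elementary embedding $j\colon M\to N$. Let $\mathrm{F}(\theta,A)$ be the same statement with "for which there exists a good $M$-normal filter on $\kappa$" in place of the embedding. "For arbitrarily large regular $\theta$" means: for every cardinal $\mu$ there is such a regular $\theta\ge\mu$. The cardinal $\kappa$ is *$\alpha$-Ramsey* if for arbitrarily large regular $\theta$, $\mathrm E(\theta,A)$ holds for every $A\subseteq\kappa$. **Theorem.** Let $\alpha\le\kappa$ be regular cardinals. The following are equivalent. - (a) $\kappa$ is $\alpha$-Ramsey. - (b) For arbitrarily large regular $\theta$, $\mathrm F(\theta,A)$ holds for every $A\subseteq\kappa$. - (c) For arbitrarily large regular $\theta$, $\mathrm E(\theta,A)$ holds for every $A\in H(\theta)$. - (c') For arbitrarily large regular $\theta$, $\mathrm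 F(\theta,A)$ holds for every $A\in H(\theta)$. - (d) For arbitrarily large regular $\theta$, $\mathrm E(\theta,\emptyset)$ holds. - (d') For arbitrarily large regular $\theta$, $\mathrm F(\theta,\emptyset)$ holds. If $\alpha>\omega$, the following are also equivalent to the above. - (e) For some regular $\theta\ge(2^\kappa)^+$, $\mathrm E(\theta,A)$ holds for every $A\in H(\theta)$. - (e') For some regular $\theta\ge(2^\kappa)^+$, $\mathrm F(\theta,A)$ holds for every $A\in H(\theta)$. Moreover, in (e) and in (e') "for some" may be replaced by "for every". -/

import Mathlib

universe u

namespace RamseyLike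

open FirstOrder

/-- The relation symbols of the language of set theory: one binary symbol. -/
inductive SetRel : ℕ → Type
  | mem : SetRel 2

/-- The first-order language of set theory. -/
def LSet : FirstOrder.Language.{0, 0} := ⟨fun _ => Empty, SetRel⟩

/-- Every set or class of sets is a structure for the language of set theory, through the true
membership relation. -/
instance memStructure (S : Set ZFSet.{u}) : LSet.Structure S where
  funMap f := Empty.elim f
  RelMap | .mem => fun x => ((x 0 : S) : ZFSet.{u}) ∈ ((x 1 : S) : ZFSet.{u})

/-- The cardinal `c` as a von Neumann ordinal. -/
noncomputable def cardSet (c : Cardinal.{u}) : ZFSet.{u} := c.ord.toZFSet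

/-- `H(θ)`: the sets that are hereditarily of cardinality less than `θ`. -/
def H (θ : Cardinal.{u}) : Set ZFSet.{u} := {x | ZFSet.Hereditarily (fun y => y.card < θ) x}

/-- `M ≺ S`: `M ⊆ S` and the inclusion of `⟨M, ∈⟩` into `⟨S, ∈⟩` is elementary. -/
def IsElementarySubmodel (M S : Set ZFSet.{u}) : Prop :=
  ∃ e : M ↪ₑ[LSet] S, ∀ x : M, (e x : ZFSet.{u}) = x

/-- `⟨M, ∈⟩` satisfies `p = (a, b)` (Kuratowski pair). -/
def IsPairIn (M : Set ZFSet.{u}) (p a b : M) : Prop :=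
  ∀ w : M, w.1 ∈ p.1 ↔ (∀ v : M, v.1 ∈ w.1 ↔ v = a) ∨ (∀ v : M, v.1 ∈ w.1 ↔ v = a ∨ v = b)

/-- `⟨M, ∈⟩` satisfies that `(a, b)` is an element of `r`. -/
def PairMemIn (M : Set ZFSet.{u}) (r a b : M) : Prop :=
  ∃ p : M, p.1 ∈ r.1 ∧ IsPairIn M p a b

/-- `⟨M, ∈⟩` is a model of `ZFC⁻`: `ZFC` without the power set axiom, with the collection scheme, and
with choice in the form that every set can be well-ordered. `M` need not be transitive, so that all
quantifiers are bounded by `M`. In the schemes `φ` runs over the first-order formulas and `v` lists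
the parameters. -/
structure ModelsZFCMinus (M : Set ZFSet.{u}) : Prop where
  extensionality : ∀ x y : M, (∀ z : M, z.1 ∈ x.1 ↔ z.1 ∈ y.1) → x = y
  foundation : ∀ x : M, (∃ y : M, y.1 ∈ x.1) →
    ∃ y : M, y.1 ∈ x.1 ∧ ∀ z : M, z.1 ∈ y.1 → z.1 ∉ x.1
  pairing : ∀ x y : M, ∃ z : M, ∀ w : M, w.1 ∈ z.1 ↔ w = x ∨ w = y
  union : ∀ x : M, ∃ z : M, ∀ w : M, w.1 ∈ z.1 ↔ ∃ y : M, y.1 ∈ x.1 ∧ w.1 ∈ y.1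
  infinity : ∃ x : M, (∃ e : M, e.1 ∈ x.1 ∧ ∀ z : M, z.1 ∉ e.1) ∧
    ∀ y : M, y.1 ∈ x.1 → ∃ s : M, s.1 ∈ x.1 ∧ ∀ z : M, z.1 ∈ s.1 ↔ z.1 ∈ y.1 ∨ z = y
  separation : ∀ (φ : LSet.Formula (ℕ ⊕ Fin 1)) (v : ℕ → M) (a : M),
    ∃ b : M, ∀ x : M, x.1 ∈ b.1 ↔ x.1 ∈ a.1 ∧ φ.Realize (Sum.elim v ![x])
  collection : ∀ (φ : LSet.Formula (ℕ ⊕ Fin 2)) (v : ℕ → M) (a : M),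
    (∀ x : M, x.1 ∈ a.1 → ∃ y : M, φ.Realize (Sum.elim v ![x, y])) →
    ∃ b : M, ∀ x : M, x.1 ∈ a.1 → ∃ y : M, y.1 ∈ b.1 ∧ φ.Realize (Sum.elim v ![x, y])
  wellOrdering : ∀ x : M, ∃ r : M,
    (∀ a : M, a.1 ∈ x.1 → ¬ PairMemIn M r a a) ∧
    (∀ a b c : M, a.1 ∈ x.1 → b.1 ∈ x.1 → c.1 ∈ x.1 →
      PairMemIn M r a b → PairMemIn M r b c → PairMemIn M r a c) ∧
    (∀ a b : M, a.1 ∈ x.1 → b.1 ∈ x.1 → PairMemIn M r a b ∨ a = b ∨ PairMemIn M r b a) ∧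
    (∀ y : M, (∀ a : M, a.1 ∈ y.1 → a.1 ∈ x.1) → (∃ a : M, a.1 ∈ y.1) →
      ∃ m : M, m.1 ∈ y.1 ∧ ∀ a : M, a.1 ∈ y.1 → a = m ∨ PairMemIn M r m a)

/-- `M` is a weak `κ`-model (not necessarily transitive). -/
structure IsWeakModel (κ : Cardinal.{u}) (M : ZFSet.{u}) : Prop where
  card_eq : M.card = κ
  succ_subset : insert (cardSet κ) (cardSet κ) ⊆ M
  models : ModelsZFCMinus (M : Set ZFSet.{u})

/-- `M` is closed under `<α`-sequences: every function from an ordinal below `α` into `M` is an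
element of `M`. -/
def ClosedUnderSeq (α : Cardinal.{u}) (M : ZFSet.{u}) : Prop :=
  ∀ β < α.ord, ∀ s : ZFSet.{u}, ZFSet.IsFunc β.toZFSet M s → s ∈ M

/-- There are a transitive set `N` and an elementary embedding `j : M → N` with critical point `κ`
such that `M` and `N` have the same subsets of `κ`. -/
def HasPowersetPreservingEmbedding (κ : Cardinal.{u}) (M : ZFSet.{u}) : Prop :=
  ∃ N : ZFSet.{u}, N.IsTransitive ∧
    ∃ j : (M : Set ZFSet.{u}) ↪ₑ[LSet] (N : Set ZFSet.{u}),
      (∀ x : (M : Set ZFSet.{u}), x.1 ∈ cardSet κ → (j x).1 = x.1) ∧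
      (∀ x : (M : Set ZFSet.{u}), x.1 = cardSet κ → (j x).1 ≠ x.1) ∧
      ∀ A : ZFSet.{u}, A ⊆ cardSet κ → (A ∈ M ↔ A ∈ N)

/-- `F` is a filter on `κ`: a family of subsets of `κ` all whose finite intersections (taken inside
`κ`) have size `κ`. It need not be closed under supersets or intersections. -/
def IsFilterOn (κ : Cardinal.{u}) (F : ZFSet.{u}) : Prop :=
  F ⊆ (cardSet κ).powerset ∧
    ∀ (n : ℕ) (A : Fin n → ZFSet.{u}), (∀ i, A i ∈ F) →
      (ZFSet.sep (fun β => ∀ i, β ∈ A i) (cardSet κ)).card = κ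

/-- The diagonal intersection `{β < κ | ∀ γ < β, β ∈ X γ}` of a `κ`-sequence `X`. -/
noncomputable def diagInter (κ : Cardinal.{u}) (X : ZFSet.{u}) : ZFSet.{u} :=
  ZFSet.sep (fun β => ∀ γ ∈ β, ∀ Y, ZFSet.pair γ Y ∈ X → β ∈ Y) (cardSet κ)

/-- `F` is an `M`-normal filter on `κ`: it measures every subset of `κ` in `M`, and it contains the
diagonal intersection of every `κ`-sequence of its elements that is an element of `M`. -/
structure IsNormalFor (κ : Cardinal.{u}) (M F : ZFSet.{u}) : Prop where
  isFilterOn : IsFilterOn κ F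
  measures : ∀ A ∈ M, A ⊆ cardSet κ → A ∈ F ∨ cardSet κ \ A ∈ F
  diagInter_mem : ∀ X ∈ M, ZFSet.IsFunc (cardSet κ) F X → diagInter κ X ∈ F

/-- `F ∩ A ∈ M` for every `A ∈ M` that has size at most `κ` in `M`, that is, such that some element
of `M` is an injection from `A` to `κ`. (For `M ≺ H(θ)` with `θ` uncountable and regular, `M` is
correct about which of its elements are such injections.) -/
def WeaklyAmenable (κ : Cardinal.{u}) (M F : ZFSet.{u}) : Prop :=
  ∀ A ∈ M,
    (∃ f ∈ M, ZFSet.IsFunc A (cardSet κ) f ∧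
      ∀ a b c, ZFSet.pair a c ∈ f → ZFSet.pair b c ∈ f → a = b) →
    F ∩ A ∈ M

/-- The functions with domain `κ` that are elements of `M`. -/
def UltraFun (κ : Cardinal.{u}) (M : ZFSet.{u}) : Type (u + 1) :=
  {f : ZFSet.{u} // f ∈ M ∧ ∃ y, ZFSet.IsFunc (cardSet κ) y f}

/-- `f` and `g` agree on a set in `F`. -/
def UltraEq {κ : Cardinal.{u}} {M : ZFSet.{u}} (F : ZFSet.{u}) (f g : UltraFun κ M) : Prop :=
  ZFSet.sep (fun β => ∃ v, ZFSet.pair β v ∈ f.1 ∧ ZFSet.pair β v ∈ g.1) (cardSet κ) ∈ F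

/-- `f β ∈ g β` on a set of `β` in `F`. -/
def UltraMemRep {κ : Cardinal.{u}} {M : ZFSet.{u}} (F : ZFSet.{u}) (f g : UltraFun κ M) : Prop :=
  ZFSet.sep (fun β => ∃ v w, ZFSet.pair β v ∈ f.1 ∧ ZFSet.pair β w ∈ g.1 ∧ v ∈ w) (cardSet κ) ∈ F

/-- The ultrapower of `M` by `F`: classes of functions on `κ` in `M`. -/
def Ultrapower (κ : Cardinal.{u}) (M F : ZFSet.{u}) : Type (u + 1) :=
  Quot (UltraEq (κ := κ) (M := M) F)

/-- The membership relation of the ultrapower. -/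
def UltraMem {κ : Cardinal.{u}} {M F : ZFSet.{u}} (a b : Ultrapower κ M F) : Prop :=
  ∃ f g : UltraFun κ M, Quot.mk _ f = a ∧ Quot.mk _ g = b ∧ UltraMemRep F f g

/-- `F` is a good `M`-normal filter on `κ`. -/
structure IsGood (κ : Cardinal.{u}) (M F : ZFSet.{u}) : Prop where
  isNormalFor : IsNormalFor κ M F
  weaklyAmenable : WeaklyAmenable κ M F
  wellFounded : WellFounded (UltraMem (κ := κ) (M := M) (F := F))

/-- `A` is an element of a weak `κ`-model `M ≺ H(θ)`, closed under `<α`-sequences, for which there is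
a `κ`-powerset preserving elementary embedding `j : M → N`. -/
def EmbeddingWitness (α κ θ : Cardinal.{u}) (A : ZFSet.{u}) : Prop :=
  ∃ M : ZFSet.{u}, IsWeakModel κ M ∧ IsElementarySubmodel (M : Set ZFSet.{u}) (H θ) ∧
    ClosedUnderSeq α M ∧ A ∈ M ∧ HasPowersetPreservingEmbedding κ M

/-- `A` is an element of a weak `κ`-model `M ≺ H(θ)`, closed under `<α`-sequences, for which there is
a good `M`-normal filter on `κ`. -/
def FilterWitness (α κ θ : Cardinal.{u}) (A : ZFSet.{u}) : Prop :=
  ∃ M : ZFSet.{u}, IsWeakModel κ M ∧ IsElementarySubmodel (M : Set ZFSet.{u}) (H θ) ∧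
    ClosedUnderSeq α M ∧ A ∈ M ∧ ∃ F : ZFSet.{u}, IsGood κ M F

/-- `P θ` holds for arbitrarily large regular cardinals `θ`. -/
def ForArbitrarilyLargeRegular (P : Cardinal.{u} → Prop) : Prop :=
  ∀ μ : Cardinal.{u}, ∃ θ : Cardinal.{u}, μ ≤ θ ∧ θ.IsRegular ∧ P θ

/-- `κ` is `α`-Ramsey (for regular `α ≤ κ`). -/
def IsAlphaRamsey (α κ : Cardinal.{u}) : Prop :=
  ForArbitrarilyLargeRegular fun θ => ∀ A : ZFSet.{u}, A ⊆ cardSet κ → EmbeddingWitness α κ θ A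

end RamseyLike

namespace RamseyLike
open FirstOrder FirstOrder.Language Cardinal

/-! For a fixed `M ≺ H(θ)` embeddings and good filters are interchangeable
(`embeddingWitness_iff_filterWitness`). From `j : M → N` one takes the sets `X ∈ M`, `X ⊆ κ`, with
`κ ∈ j(X)`. The ultrapower is well-founded because the class of `f` can be sent to `j(f)(κ)`, and
amenability holds because the trace of the filter on a family of size `κ` is coded by a subset of
`κ` in `N`, hence in `M`. Conversely, one collapses the ultrapower and applies Łoś's theorem with
truth evaluated in `H(θ)`. Normality fixes the ordinals below `κ` and represents the subsets of `κ`
in `M`; weak amenability excludes new subsets.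

The independence from `θ` and from the parameter rests on one first-order statement, `HasGoodHull S
κ α Y h`: inside the transitive structure `S`, the set `Y` has a subset of size `κ` that carries a
good filter and is closed under the partial operation `h` on sequences of length below `α`.

Hulls give models: let `S = H(θ')`, `Y = H(θ)`, and let `h` collect Skolem functions for `H(θ)`
together with rules that force closure under sequences and the presence of `A`
(`filterWitness_of_hasGoodHull`). It therefore suffices to have hulls in arbitrarily large `H(θ')`.

Models give hulls: if `M` has a good filter `F` and `h ∈ M`, then `M ∩ Y` with `F ∩ M` is a hull,
even when `Y ∉ M` (`IsGood.hasGoodHull`). If `M ≺ H(θ)` and some `h ∈ H(θ)` had no hull,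
elementarity would produce such an `h` in `M`. So a model for the parameter `∅` already yields hulls
for all parameters in `H(θ)` (`FilterWitness.hasGoodHull`).

If only one `θ > 2 ^ κ` is available, a given `h ∈ H(θ')` is put into some `Z ≺ H(θ')` of size at
most `2 ^ κ`, closed under subsets of size at most `κ`. The transitive collapse of `Z` lies in
`H(θ)`, so the image of `h` is an admissible parameter. A model containing it gives a hull in the
collapse, and elementarity moves this statement back to `H(θ')`
(`hasGoodHull_of_forall_filterWitness`). The collapse tests well-foundedness only on its own
elements, but the hull obtained in `H(θ')` is tested on all of its subsets, so its well-foundedness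
is genuine (`GoodCore.isGood`). -/

/-! ### Expressible predicates -/

/-- The membership symbol. -/
def memRel : LSet.Relations 2 := SetRel.mem

/-- The predicate `P` is expressed by one first-order formula in all transitive structures. -/
def Expressible (Γ : Type) (P : Set ZFSet.{u} → (Γ → ZFSet.{u}) → Prop) : Prop :=
  ∃ φ : LSet.Formula Γ, ∀ S : Set ZFSet.{u}, (∀ x ∈ S, ∀ y ∈ x, y ∈ S) →
    ∀ v : Γ → S, φ.Realize v ↔ P S fun i => (v i).1

/-- Satisfaction of a formula at a tuple of sets that lie in the structure. -/
def Sat (S : Set ZFSet.{u}) {Γ : Type} (φ : LSet.Formula Γ) (v : Γ → ZFSet.{u}) : Prop :=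
  ∃ h : ∀ i, v i ∈ S, φ.Realize fun i => (⟨v i, h i⟩ : S)

theorem sat_coe {S : Set ZFSet.{u}} {Γ : Type} {φ : LSet.Formula Γ} (v : Γ → S) :
    Sat S φ (fun i => (v i).1) ↔ φ.Realize v :=
  ⟨fun ⟨_, h⟩ => h, fun h => ⟨fun i => (v i).2, h⟩⟩

namespace Expressible

variable {Γ : Type} {P Q : Set ZFSet.{u} → (Γ → ZFSet.{u}) → Prop}

theorem congr (h : Expressible Γ P)
    (hPQ : ∀ S : Set ZFSet.{u}, (∀ x ∈ S, ∀ y ∈ x, y ∈ S) → ∀ v : Γ → ZFSet.{u}, (∀ i, v i ∈ S) →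
      (P S v ↔ Q S v)) : Expressible Γ Q := by
  obtain ⟨φ, hφ⟩ := h
  exact ⟨φ, fun S hS v => (hφ S hS v).trans (hPQ S hS _ fun i => (v i).2)⟩

/-- Arbitrary formulas enter here, as separation, collection and Łoś's theorem require. -/
theorem sat {Δ : Type} (φ : LSet.Formula Δ) (g : Δ → Γ) :
    Expressible.{u} Γ fun S v => Sat S φ fun d => v (g d) := by
  refine ⟨φ.relabel g, fun S hS v => ?_⟩
  rw [Formula.realize_relabel, ← sat_coe]
  rfl

theorem mem (i j : Γ) : Expressible.{u} Γ fun _ v => v i ∈ v j := by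
  refine ⟨Relations.formula₂ memRel (Term.var i) (Term.var j), fun S hS v => ?_⟩
  rw [Formula.realize_rel₂]
  rfl

theorem eq (i j : Γ) : Expressible.{u} Γ fun _ v => v i = v j := by
  refine ⟨(Term.var i).equal (Term.var j), fun S hS v => ?_⟩
  rw [Formula.realize_equal]
  exact Subtype.ext_iff

theorem imp (hP : Expressible Γ P) (hQ : Expressible Γ Q) :
    Expressible Γ fun S v => P S v → Q S v := by
  obtain ⟨φ, hφ⟩ := hP
  obtain ⟨ψ, hψ⟩ := hQ
  refine ⟨φ.imp ψ, fun S hS v => ?_⟩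
  rw [Formula.realize_imp, hφ S hS, hψ S hS]

theorem false : Expressible.{u} Γ fun _ _ => False :=
  ⟨⊥, fun _ _ _ => Formula.realize_bot⟩

theorem not (hP : Expressible Γ P) : Expressible Γ fun S v => ¬ P S v :=
  hP.imp false

theorem and (hP : Expressible Γ P) (hQ : Expressible Γ Q) :
    Expressible Γ fun S v => P S v ∧ Q S v :=
  (hP.imp hQ.not).not.congr fun S _ v _ => by tauto

theorem or (hP : Expressible Γ P) (hQ : Expressible Γ Q) :
    Expressible Γ fun S v => P S v ∨ Q S v :=
  (hP.not.imp hQ).congr fun S _ v _ => by tauto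

theorem iff (hP : Expressible Γ P) (hQ : Expressible Γ Q) :
    Expressible Γ fun S v => (P S v ↔ Q S v) :=
  ((hP.imp hQ).and (hQ.imp hP)).congr fun S _ v _ => by tauto

theorem relabel {Δ : Type} (g : Γ → Δ) (hP : Expressible Γ P) :
    Expressible Δ fun S v => P S fun i => v (g i) := by
  obtain ⟨φ, hφ⟩ := hP
  refine ⟨φ.relabel g, fun S hS v => ?_⟩
  rw [Formula.realize_relabel, hφ S hS]
  rfl

theorem existsTuple {ι : Type} [Finite ι]
    {R : Set ZFSet.{u} → (Γ → ZFSet.{u}) → (ι → ZFSet.{u}) → Prop}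
    (h : Expressible (Γ ⊕ ι)
      fun S w => R S (fun i => w (Sum.inl i)) (fun i => w (Sum.inr i))) :
    Expressible Γ fun S v => ∃ y : ι → ZFSet.{u}, (∀ i, y i ∈ S) ∧ R S v y := by
  obtain ⟨φ, hφ⟩ := h
  refine ⟨φ.iExs ι, fun S hS v => ?_⟩
  rw [Formula.realize_iExs]
  constructor
  · rintro ⟨y, hy⟩
    exact ⟨fun i => (y i).1, fun i => (y i).2, by simpa using (hφ S hS _).1 hy⟩
  · rintro ⟨y, hyS, hy⟩
    exact ⟨fun i => ⟨y i, hyS i⟩, (hφ S hS _).2 (by simpa using hy)⟩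

theorem forallIndex {ι : Type} [Finite ι] {R : ι → Set ZFSet.{u} → (Γ → ZFSet.{u}) → Prop}
    (h : ∀ i, Expressible Γ (R i)) : Expressible Γ fun S v => ∀ i, R i S v := by
  choose φ hφ using h
  refine ⟨BoundedFormula.iInf φ, fun S hS v => ?_⟩
  rw [Formula.Realize, BoundedFormula.realize_iInf]
  exact forall_congr' fun i => hφ i S hS v

theorem ex {R : Set ZFSet.{u} → (Γ → ZFSet.{u}) → ZFSet.{u} → Prop}
    (h : Expressible (Option Γ) fun S w => R S (fun i => w (some i)) (w none)) :
    Expressible Γ fun S v => ∃ x ∈ S, R S v x := by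
  have h1 : Expressible (Γ ⊕ Fin 1)
      fun S w => R S (fun i => w (Sum.inl i)) (w (Sum.inr 0)) :=
    h.relabel fun o : Option Γ => o.elim (Sum.inr 0) Sum.inl
  refine (existsTuple (R := fun S v y => R S v (y 0)) h1).congr fun S hS v hv => ?_
  constructor
  · rintro ⟨y, hy, h⟩
    exact ⟨y 0, hy 0, h⟩
  · rintro ⟨y, hy, h⟩
    exact ⟨fun _ => y, fun _ => hy, h⟩

theorem all {R : Set ZFSet.{u} → (Γ → ZFSet.{u}) → ZFSet.{u} → Prop}
    (h : Expressible (Option Γ) fun S w => R S (fun i => w (some i)) (w none)) :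
    Expressible Γ fun S v => ∀ x ∈ S, R S v x :=
  (Expressible.not (Expressible.ex (R := fun S v x => ¬ R S v x) h.not)).congr
    fun _ _ _ _ => by push Not; rfl

/-- Transitivity of `S` places the true elements of `v i` in `S`. The absoluteness of the predicates
below comes from this. -/
theorem bex {R : Set ZFSet.{u} → (Γ → ZFSet.{u}) → ZFSet.{u} → Prop} {i : Γ}
    (h : Expressible (Option Γ) fun S w => R S (fun i => w (some i)) (w none)) :
    Expressible Γ fun S v => ∃ x ∈ v i, R S v x :=
  (Expressible.ex (R := fun S v x => x ∈ v i ∧ R S v x) ((mem none (some i)).and h)).congr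
    fun _ hS _ hv => ⟨fun ⟨x, _, hx, h⟩ => ⟨x, hx, h⟩,
      fun ⟨x, hx, h⟩ => ⟨x, hS _ (hv i) _ hx, hx, h⟩⟩

theorem ball {R : Set ZFSet.{u} → (Γ → ZFSet.{u}) → ZFSet.{u} → Prop} {i : Γ}
    (h : Expressible (Option Γ) fun S w => R S (fun i => w (some i)) (w none)) :
    Expressible Γ fun S v => ∀ x ∈ v i, R S v x :=
  (Expressible.not (Expressible.bex (R := fun S v x => ¬ R S v x) h.not)).congr
    fun _ _ _ _ => by push Not; rfl

theorem subset (i j : Γ) : Expressible.{u} Γ fun _ v => v i ⊆ v j :=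
  (ball (mem none (some j)) : Expressible.{u} Γ fun _ v => ∀ x ∈ v i, x ∈ v j).congr
    fun _ _ _ _ => Iff.rfl

theorem eq_singleton (i j : Γ) : Expressible.{u} Γ fun _ v => v i = {v j} :=
  ((mem j i).and (ball (eq none (some j))) :
    Expressible.{u} Γ fun _ v => v j ∈ v i ∧ ∀ x ∈ v i, x = v j).congr fun _ _ v _ => by
      constructor
      · rintro ⟨h1, h2⟩
        ext x
        rw [ZFSet.mem_singleton]
        exact ⟨h2 x, fun h => h ▸ h1⟩
      · intro h
        simp [h]

theorem eq_doubleton (i j k : Γ) : Expressible.{u} Γ fun _ v => v i = {v j, v k} :=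
  (((mem j i).and (mem k i)).and (ball ((eq none (some j)).or (eq none (some k)))) :
    Expressible.{u} Γ fun _ v => (v j ∈ v i ∧ v k ∈ v i) ∧ ∀ x ∈ v i, x = v j ∨ x = v k).congr
      fun _ _ v _ => by
        constructor
        · rintro ⟨⟨h1, h3⟩, h2⟩
          ext x
          rw [ZFSet.mem_pair]
          exact ⟨h2 x, by rintro (rfl | rfl) <;> assumption⟩
        · intro h
          simp [h]

theorem eq_pair (i j k : Γ) : Expressible.{u} Γ fun _ v => v i = ZFSet.pair (v j) (v k) :=
  (((bex (eq_singleton none (some j))).and (bex (eq_doubleton none (some j) (some k)))).and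
    (ball ((eq_singleton none (some j)).or (eq_doubleton none (some j) (some k)))) :
    Expressible.{u} Γ fun _ v => ((∃ x ∈ v i, x = {v j}) ∧ (∃ x ∈ v i, x = {v j, v k})) ∧
      ∀ x ∈ v i, x = {v j} ∨ x = {v j, v k}).congr
      fun _ _ v _ => by
        constructor
        · rintro ⟨⟨⟨_, h1, rfl⟩, ⟨_, h3, rfl⟩⟩, h2⟩
          ext x
          rw [ZFSet.pair, ZFSet.mem_pair]
          exact ⟨h2 x, by rintro (rfl | rfl) <;> assumption⟩
        · intro h
          simp [h, ZFSet.pair]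

theorem pair_mem (i j k : Γ) : Expressible.{u} Γ fun _ v => ZFSet.pair (v i) (v j) ∈ v k :=
  (bex (eq_pair none (some i) (some j)) :
    Expressible.{u} Γ fun _ v => ∃ p ∈ v k, p = ZFSet.pair (v i) (v j)).congr
      fun _ _ v _ => by simp

theorem isFunc (i j k : Γ) : Expressible.{u} Γ fun _ v => ZFSet.IsFunc (v i) (v j) (v k) := by
  have h : Expressible.{u} Γ fun _ v => (∀ p ∈ v k, ∃ a ∈ v i, ∃ b ∈ v j, p = ZFSet.pair a b) ∧
      ∀ a ∈ v i, ∃ b ∈ v j, ZFSet.pair a b ∈ v k ∧ ∀ c ∈ v j, ZFSet.pair a c ∈ v k → c = b :=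
    .and (.ball <| .bex <| .bex <| .eq_pair _ _ _)
      (.ball <| .bex <| .and (.pair_mem _ _ _) <| .ball <| .imp (.pair_mem _ _ _) (.eq _ _))
  refine h.congr fun S _ v _ => ?_
  constructor
  · rintro ⟨h1, h2⟩
    have h3 : v k ⊆ ZFSet.prod (v i) (v j) := fun p hp => ZFSet.mem_prod.2 (h1 p hp)
    refine ⟨h3, fun a ha => ?_⟩
    obtain ⟨b, _, hb, h4⟩ := h2 a ha
    exact ⟨b, hb, fun c hc => h4 c (ZFSet.pair_mem_prod.1 (h3 hc)).2 hc⟩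
  · rintro ⟨h1, h2⟩
    refine ⟨fun p hp => ZFSet.mem_prod.1 (h1 hp), fun a ha => ?_⟩
    obtain ⟨b, hb, h4⟩ := h2 a ha
    exact ⟨b, (ZFSet.pair_mem_prod.1 (h1 hb)).2, hb, fun c _ hc => h4 c hc⟩

end Expressible
/-! ### Elementary submodels -/

section Elementary

variable {M S N : Set ZFSet.{u}}

theorem IsElementarySubmodel.subset (h : IsElementarySubmodel M S) : M ⊆ S := by
  obtain ⟨e, he⟩ := h
  intro x hx
  have := (e ⟨x, hx⟩).2
  rwa [he] at this

theorem IsElementarySubmodel.realize_iff (h : IsElementarySubmodel M S) {Γ : Type}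
    (φ : LSet.Formula Γ) (v : Γ → M) :
    φ.Realize v ↔ φ.Realize fun i => (⟨(v i).1, h.subset (v i).2⟩ : S) := by
  obtain ⟨e, he⟩ := id h
  rw [← e.map_formula φ v]
  have : (e ∘ v) = fun i => (⟨(v i).1, h.subset (v i).2⟩ : S) :=
    funext fun i => Subtype.ext (he _)
  rw [this]

theorem IsElementarySubmodel.sat_iff (h : IsElementarySubmodel M S) {Γ : Type}
    (φ : LSet.Formula Γ) {v : Γ → ZFSet.{u}} (hv : ∀ i, v i ∈ M) : Sat M φ v ↔ Sat S φ v :=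
  (sat_coe (φ := φ) fun i => (⟨v i, hv i⟩ : M)).trans <|
    (h.realize_iff φ _).trans (sat_coe (φ := φ) fun i => (⟨v i, h.subset (hv i)⟩ : S)).symm

/-- An expressible property with parameters in an elementary submodel that has a witness at all
has one in the submodel. -/
theorem IsElementarySubmodel.exists_mem (h : IsElementarySubmodel M S)
    (hS : ∀ x ∈ S, ∀ y ∈ x, y ∈ S) {Γ : Type} (v : Γ → ZFSet.{u}) (hv : ∀ i, v i ∈ M)
    (P : Set ZFSet.{u} → (Γ → ZFSet.{u}) → ZFSet.{u} → Prop)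
    (hP : Expressible (Option Γ) fun S w => P S (fun i => w (some i)) (w none))
    (hx : ∃ x ∈ S, P S v x) : ∃ x ∈ M, P S v x := by
  obtain ⟨φ, hφ⟩ := hP
  obtain ⟨x, hxS, hx⟩ := hx
  have key := h.realize_iff
    ((φ.relabel (fun o : Option Γ => o.elim (Sum.inr (0 : Fin 1)) Sum.inl)).iExs (Fin 1))
    fun i => ⟨v i, hv i⟩
  rw [Formula.realize_iExs, Formula.realize_iExs] at key
  obtain ⟨y, hy⟩ := key.2 ⟨fun _ => ⟨x, hxS⟩, by
    rw [Formula.realize_relabel, hφ S hS]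
    exact hx⟩
  rw [h.realize_iff, Formula.realize_relabel, hφ S hS] at hy
  exact ⟨(y 0).1, (y 0).2, hy⟩

/-- A set definable from parameters in an elementary submodel is an element of it. -/
theorem IsElementarySubmodel.mem_of_unique (h : IsElementarySubmodel M S)
    (hS : ∀ x ∈ S, ∀ y ∈ x, y ∈ S) {Γ : Type} (v : Γ → ZFSet.{u}) (hv : ∀ i, v i ∈ M)
    (P : Set ZFSet.{u} → (Γ → ZFSet.{u}) → ZFSet.{u} → Prop)
    (hP : Expressible (Option Γ) fun S w => P S (fun i => w (some i)) (w none))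
    {x : ZFSet.{u}} (hxS : x ∈ S) (hx : P S v x) (hu : ∀ y ∈ S, P S v y → y = x) : x ∈ M := by
  obtain ⟨y, hyM, hy⟩ := h.exists_mem hS v hv P hP ⟨x, hxS, hx⟩
  exact hu y (h.subset hyM) hy ▸ hyM

/-- `M` need not be transitive, so the predicate is read in `S`: elementarity leads from `S` down to
`M` and then along `j` to `N`. -/
theorem IsElementarySubmodel.expressible_iff (h : IsElementarySubmodel M S)
    (hS : ∀ x ∈ S, ∀ y ∈ x, y ∈ S) (hN : ∀ x ∈ N, ∀ y ∈ x, y ∈ N) (j : M ↪ₑ[LSet] N)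
    {Γ : Type} {P : Set ZFSet.{u} → (Γ → ZFSet.{u}) → Prop} (hP : Expressible Γ P) (v : Γ → M) :
    P S (fun i => (v i).1) ↔ P N (fun i => (j (v i)).1) := by
  obtain ⟨φ, hφ⟩ := hP
  rw [← hφ N hN fun i => j (v i)]
  refine Iff.trans ?_ (j.map_formula φ v).symm
  rw [h.realize_iff φ v, hφ S hS]

end Elementary

/-! ### The sets `H(θ)` -/

section Hereditary

variable {θ : Cardinal.{u}} {x y : ZFSet.{u}}

theorem mem_H_iff : x ∈ H θ ↔ x.card < θ ∧ ∀ y ∈ x, y ∈ H θ :=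
  ZFSet.hereditarily_iff

theorem H_transitive : ∀ x ∈ H θ, ∀ y ∈ x, y ∈ H θ := fun _ hx => (mem_H_iff.1 hx).2

theorem card_lt_of_mem_H (hx : x ∈ H θ) : x.card < θ := (mem_H_iff.1 hx).1

theorem mem_H_of_subset (hx : x ∈ H θ) (hy : y ⊆ x) : y ∈ H θ :=
  mem_H_iff.2 ⟨(ZFSet.card_mono hy).trans_lt (card_lt_of_mem_H hx),
    fun z hz => H_transitive x hx z (hy hz)⟩

theorem H_mono {θ' : Cardinal.{u}} (h : θ ≤ θ') : x ∈ H θ → x ∈ H θ' := by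
  induction x using ZFSet.inductionOn with
  | _ x ih =>
    intro hx
    exact mem_H_iff.2 ⟨(card_lt_of_mem_H hx).trans_le h,
      fun y hy => ih y hy (H_transitive x hx y hy)⟩

theorem empty_mem_H (hθ : ℵ₀ ≤ θ) : ∅ ∈ H θ :=
  mem_H_iff.2 ⟨by simpa using aleph0_pos.trans_le hθ, fun y hy => absurd hy (ZFSet.notMem_empty y)⟩

theorem insert_mem_H (hθ : ℵ₀ ≤ θ) (hx : x ∈ H θ) (hy : y ∈ H θ) : insert x y ∈ H θ := by
  refine mem_H_iff.2 ⟨ZFSet.card_insert_le.trans_lt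
    (add_lt_of_lt hθ (card_lt_of_mem_H hy) (one_lt_aleph0.trans_le hθ)), fun z hz => ?_⟩
  rcases ZFSet.mem_insert_iff.1 hz with rfl | h
  exacts [hx, H_transitive y hy z h]

theorem singleton_mem_H (hθ : ℵ₀ ≤ θ) (hx : x ∈ H θ) : {x} ∈ H θ := by
  rw [← insert_empty_eq x]
  exact insert_mem_H hθ hx (empty_mem_H hθ)

theorem pair_mem_H (hθ : ℵ₀ ≤ θ) (hx : x ∈ H θ) (hy : y ∈ H θ) : ZFSet.pair x y ∈ H θ :=
  insert_mem_H hθ (singleton_mem_H hθ hx) <|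
    singleton_mem_H hθ (insert_mem_H hθ hx (singleton_mem_H hθ hy))

theorem toZFSet_mem_H {o : Ordinal.{u}} (ho : o.card < θ) : o.toZFSet ∈ H θ := by
  induction o using WellFoundedLT.induction with
  | _ o ih =>
    refine mem_H_iff.2 ⟨by rwa [Ordinal.card_toZFSet], fun y hy => ?_⟩
    obtain ⟨a, ha, rfl⟩ := Ordinal.mem_toZFSet_iff.1 hy
    exact ih a ha ((Ordinal.card_le_card ha.le).trans_lt ho)

theorem card_le_of_injOn (f : ZFSet.{u} → ZFSet.{u}) (hf : ∀ a ∈ x, f a ∈ y)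
    (hinj : ∀ a ∈ x, ∀ b ∈ x, f a = f b → a = b) : x.card ≤ y.card := by
  rw [← lift_le.{u + 1}, ← ZFSet.cardinalMk_coe_sort, ← ZFSet.cardinalMk_coe_sort]
  refine mk_le_of_injective (f := fun a : x => (⟨f a.1, hf a.1 a.2⟩ : y)) fun a b h => ?_
  exact Subtype.ext (hinj _ a.2 _ b.2 (congrArg Subtype.val h))

/-- The image of the set `x` under `f`. -/
noncomputable def replacement (f : ZFSet.{u} → ZFSet.{u}) (x : ZFSet.{u}) : ZFSet.{u} :=
  ZFSet.range fun a : x => f a.1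

theorem mem_replacement {f : ZFSet.{u} → ZFSet.{u}} {z : ZFSet.{u}} :
    z ∈ replacement f x ↔ ∃ a ∈ x, f a = z := by
  simp [replacement]

theorem card_replacement_le (f : ZFSet.{u} → ZFSet.{u}) (x : ZFSet.{u}) :
    (replacement f x).card ≤ x.card := by
  have h : ∀ z ∈ replacement f x, ∃ a ∈ x, f a = z := fun z => mem_replacement.1
  choose! g hg using h
  exact card_le_of_injOn g (fun z hz => (hg z hz).1) fun z hz w hw hzw => by
    rw [← (hg z hz).2, ← (hg w hw).2, hzw]

theorem replacement_mem_H {f : ZFSet.{u} → ZFSet.{u}} (hx : x ∈ H θ) (hf : ∀ a ∈ x, f a ∈ H θ) :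
    replacement f x ∈ H θ := by
  refine mem_H_iff.2 ⟨(card_replacement_le f x).trans_lt (card_lt_of_mem_H hx), fun z hz => ?_⟩
  obtain ⟨a, ha, rfl⟩ := mem_replacement.1 hz
  exact hf a ha

/-- The restriction of `f` to the set `x`, as a set of pairs. -/
noncomputable def graph (f : ZFSet.{u} → ZFSet.{u}) (x : ZFSet.{u}) : ZFSet.{u} :=
  replacement (fun a => ZFSet.pair a (f a)) x

theorem pair_mem_graph {f : ZFSet.{u} → ZFSet.{u}} {a b : ZFSet.{u}} :
    ZFSet.pair a b ∈ graph f x ↔ a ∈ x ∧ f a = b := by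
  simp only [graph, mem_replacement, ZFSet.pair_inj]
  exact ⟨fun ⟨_, h, h1, h2⟩ => h1 ▸ ⟨h, h2⟩, fun h => ⟨a, h.1, rfl, h.2⟩⟩

theorem isFunc_graph {f : ZFSet.{u} → ZFSet.{u}} (hf : ∀ a ∈ x, f a ∈ y) :
    ZFSet.IsFunc x y (graph f x) := by
  refine ⟨fun p hp => ?_, fun a ha => ⟨f a, pair_mem_graph.2 ⟨ha, rfl⟩,
    fun b hb => (pair_mem_graph.1 hb).2.symm⟩⟩
  obtain ⟨a, ha, rfl⟩ := mem_replacement.1 hp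
  exact ZFSet.pair_mem_prod.2 ⟨ha, hf a ha⟩

/-- The value of the function `f` at `a`. -/
noncomputable def app (f a : ZFSet.{u}) : ZFSet.{u} :=
  open Classical in if h : ∃ b, ZFSet.pair a b ∈ f then h.choose else ∅

section

variable {f a b : ZFSet.{u}} (h : ZFSet.IsFunc x y f)
include h

theorem pair_app_mem (ha : a ∈ x) : ZFSet.pair a (app f a) ∈ f := by
  have h1 : ∃ b, ZFSet.pair a b ∈ f := (h.2 a ha).exists
  rw [app, dif_pos h1]
  exact h1.choose_spec

theorem app_mem (ha : a ∈ x) : app f a ∈ y :=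
  (ZFSet.pair_mem_prod.1 (h.1 (pair_app_mem h ha))).2

theorem pair_mem_iff : ZFSet.pair a b ∈ f ↔ a ∈ x ∧ b = app f a := by
  constructor
  · intro hab
    have ha := (ZFSet.pair_mem_prod.1 (h.1 hab)).1
    exact ⟨ha, (h.2 a ha).unique hab (pair_app_mem h ha)⟩
  · rintro ⟨ha, rfl⟩
    exact pair_app_mem h ha

theorem eq_graph_app : f = graph (app f) x := by
  ext p
  constructor
  · intro hp
    obtain ⟨a, ha, b, hb, rfl⟩ := ZFSet.mem_prod.1 (h.1 hp)
    exact pair_mem_graph.2 ⟨ha, ((pair_mem_iff h).1 hp).2.symm⟩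
  · intro hp
    obtain ⟨a, ha, rfl⟩ := mem_replacement.1 hp
    exact pair_app_mem h ha

theorem card_le_of_isFunc : f.card ≤ x.card := by
  rw [eq_graph_app h]
  exact card_replacement_le _ _

end

theorem app_graph {f : ZFSet.{u} → ZFSet.{u}} {a : ZFSet.{u}} (ha : a ∈ x) :
    app (graph f x) a = f a := by
  have h : ZFSet.IsFunc x (replacement f x) (graph f x) :=
    isFunc_graph fun a ha => mem_replacement.2 ⟨a, ha, rfl⟩
  exact ((pair_mem_graph.1 (pair_app_mem h ha)).2).symm

theorem isFunc_mem_H (hθ : ℵ₀ ≤ θ) {f : ZFSet.{u}} (h : ZFSet.IsFunc x y f) (hx : x ∈ H θ)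
    (hy : ∀ b ∈ y, b ∈ H θ) : f ∈ H θ := by
  refine mem_H_iff.2 ⟨(card_le_of_isFunc h).trans_lt (card_lt_of_mem_H hx), fun p hp => ?_⟩
  obtain ⟨a, ha, b, hb, rfl⟩ := ZFSet.mem_prod.1 (h.1 hp)
  exact pair_mem_H hθ (H_transitive x hx a ha) (hy b hb)

theorem prod_mem_H (hθ : ℵ₀ ≤ θ) (hx : x ∈ H θ) (hy : y ∈ H θ) : ZFSet.prod x y ∈ H θ := by
  refine mem_H_iff.2 ⟨?_, fun p hp => ?_⟩
  · refine lt_of_le_of_lt ?_ (mul_lt_of_lt hθ (card_lt_of_mem_H hx) (card_lt_of_mem_H hy))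
    rw [← lift_le.{u + 1}, lift_mul, ← ZFSet.cardinalMk_coe_sort, ← ZFSet.cardinalMk_coe_sort,
      ← ZFSet.cardinalMk_coe_sort, mul_def]
    refine mk_le_of_surjective
      (f := fun q : x × y => ⟨ZFSet.pair q.1 q.2, ZFSet.pair_mem_prod.2 ⟨q.1.2, q.2.2⟩⟩) ?_
    rintro ⟨p, hp⟩
    obtain ⟨a, ha, b, hb, rfl⟩ := ZFSet.mem_prod.1 hp
    exact ⟨(⟨a, ha⟩, ⟨b, hb⟩), rfl⟩
  · obtain ⟨a, ha, b, hb, rfl⟩ := ZFSet.mem_prod.1 hp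
    exact pair_mem_H hθ (H_transitive x hx a ha) (H_transitive y hy b hb)

theorem sUnion_mem_H (hθ : θ.IsRegular) (hx : x ∈ H θ) : (ZFSet.sUnion x) ∈ H θ := by
  refine mem_H_iff.2 ⟨?_, fun z hz => ?_⟩
  · have h : ZFSet.sUnion x = ZFSet.iUnion fun y : Shrink.{u} x => ((equivShrink x).symm y).1 := by
      ext z
      rw [ZFSet.mem_sUnion, ZFSet.mem_iUnion]
      constructor
      · rintro ⟨y, hy, hz⟩
        exact ⟨equivShrink x ⟨y, hy⟩, by simpa using hz⟩
      · rintro ⟨y, hz⟩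
        exact ⟨_, ((equivShrink x).symm y).2, hz⟩
    have h1 := ZFSet.lift_card_iUnion_le_sum_card
      (f := fun y : Shrink.{u} x => ((equivShrink x).symm y).1)
    rw [lift_id] at h1
    rw [h]
    exact h1.trans_lt <| sum_lt_of_isRegular hθ (card_lt_of_mem_H hx) fun y =>
      card_lt_of_mem_H (H_transitive x hx _ ((equivShrink x).symm y).2)
  · obtain ⟨y, hy, hz⟩ := ZFSet.mem_sUnion.1 hz
    exact H_transitive y (H_transitive x hx y hy) z hz

/-- By `∈`-induction: a supremum of fewer than `θ` ordinals below `θ` stays below `θ` by regularity.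
-/
theorem rank_lt_of_mem_H (hθ : θ.IsRegular) (hx : x ∈ H θ) : x.rank < θ.ord := by
  induction x using ZFSet.inductionOn with
  | _ x ih =>
    have h1 : ∀ y : Shrink.{u} x, ((equivShrink x).symm y).1.rank + 1 < θ.ord := fun y =>
      (isSuccLimit_ord hθ.aleph0_le).add_one_lt
        (ih _ ((equivShrink x).symm y).2 (H_transitive x hx _ ((equivShrink x).symm y).2))
    refine lt_of_le_of_lt ?_ (Ordinal.iSup_lt_of_lt_cof
      (by rw [hθ.cof_ord]; exact card_lt_of_mem_H hx) h1)
    refine ZFSet.rank_le_iff.2 fun y hy => ?_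
    refine lt_of_lt_of_le ?_ (Ordinal.le_iSup _ (equivShrink x ⟨y, hy⟩))
    simp

/-- `H(θ)` as a set. -/
noncomputable def HSet (θ : Cardinal.{u}) : ZFSet.{u} :=
  ZFSet.sep (fun x => x ∈ H θ) (ZFSet.vonNeumann θ.ord)

theorem mem_HSet (hθ : θ.IsRegular) : x ∈ HSet θ ↔ x ∈ H θ := by
  rw [HSet, ZFSet.mem_sep, ZFSet.mem_vonNeumann]
  exact ⟨fun h => h.2, fun h => ⟨rank_lt_of_mem_H hθ h, h⟩⟩

theorem eventually_mem_H (x : ZFSet.{u}) : ∃ μ : Cardinal.{u}, ∀ θ, μ ≤ θ → x ∈ H θ := by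
  induction x using ZFSet.inductionOn with
  | _ x ih =>
    choose! μ hμ using ih
    refine ⟨max (Order.succ x.card) (⨆ y : Shrink.{u} x, μ ((equivShrink x).symm y).1),
      fun θ hθ => mem_H_iff.2 ⟨Order.succ_le_iff.1 ((le_max_left _ _).trans hθ), fun y hy => ?_⟩⟩
    refine hμ y hy θ (le_trans ?_ ((le_max_right _ _).trans hθ))
    have := le_ciSup (f := fun y : Shrink.{u} x => μ ((equivShrink x).symm y).1)
      (bddAbove_of_small) (equivShrink x ⟨y, hy⟩)
    simpa using this

end Hereditary
/-! ### Elementary submodels of `H(θ)` -/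

section Absolute

variable {M S : Set ZFSet.{u}} (hM : IsElementarySubmodel M S) (hS : ∀ x ∈ S, ∀ y ∈ x, y ∈ S)
include hM hS

/-- Two distinct elements of `M` differ at a point of `S`, and by elementarity at a point of `M`.
This stands in for transitivity of `M`. -/
theorem IsElementarySubmodel.ext {x y : ZFSet.{u}} (hx : x ∈ M) (hy : y ∈ M)
    (h : ∀ z ∈ M, z ∈ x ↔ z ∈ y) : x = y := by
  by_contra hne
  have : ∃ z ∈ S, ¬ (z ∈ x ↔ z ∈ y) := by
    by_contra! hc
    refine hne (ZFSet.ext fun z => ⟨fun hz => (hc z (hS x (hM.subset hx) z hz)).1 hz,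
      fun hz => (hc z (hS y (hM.subset hy) z hz)).2 hz⟩)
  obtain ⟨z, hz, hz'⟩ := hM.exists_mem hS ![x, y] (by simp [Fin.forall_fin_two, hx, hy])
    (fun _ v z => ¬ (z ∈ v 0 ↔ z ∈ v 1)) (.not (.iff (.mem _ _) (.mem _ _))) this
  exact hz' (h z hz)

end Absolute

variable {M : Set ZFSet.{u}} {θ : Cardinal.{u}}

section

variable (hM : IsElementarySubmodel M (H θ)) (hθ : ℵ₀ ≤ θ)
include hM hθ

theorem singleton_mem_of_elementary {a : ZFSet.{u}} (ha : a ∈ M) : {a} ∈ M :=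
  hM.mem_of_unique H_transitive ![a] (by simp [ha]) (fun _ v x => x = {v 0})
    (.eq_singleton _ _) (singleton_mem_H hθ (hM.subset ha)) rfl fun _ _ h => h

theorem doubleton_mem_of_elementary {a b : ZFSet.{u}} (ha : a ∈ M) (hb : b ∈ M) :
    {a, b} ∈ M :=
  hM.mem_of_unique H_transitive ![a, b] (by simp [Fin.forall_fin_two, ha, hb])
    (fun _ v x => x = {v 0, v 1})
    (.eq_doubleton _ _ _)
    (insert_mem_H hθ (hM.subset ha) (singleton_mem_H hθ (hM.subset hb))) rfl fun _ _ h => h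

theorem pair_mem_of_elementary {a b : ZFSet.{u}} (ha : a ∈ M) (hb : b ∈ M) :
    ZFSet.pair a b ∈ M :=
  doubleton_mem_of_elementary hM hθ (singleton_mem_of_elementary hM hθ ha)
    (doubleton_mem_of_elementary hM hθ ha hb)

/-- The true pair belongs to `M`, and extensionality of `M` leaves no other candidate. -/
theorem isPairIn_iff {p a b : M} : IsPairIn M p a b ↔ p.1 = ZFSet.pair a.1 b.1 := by
  have h1 : ∀ w : M, (∀ v : M, v.1 ∈ w.1 ↔ v = a) ↔ w.1 = {a.1} := by
    refine fun w => ⟨fun h => hM.ext H_transitive w.2 (singleton_mem_of_elementary hM hθ a.2)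
      fun z hz => ?_, fun h v => ?_⟩
    · rw [ZFSet.mem_singleton, h ⟨z, hz⟩, Subtype.ext_iff]
    · rw [h, ZFSet.mem_singleton, Subtype.ext_iff]
  have h2 : ∀ w : M, (∀ v : M, v.1 ∈ w.1 ↔ v = a ∨ v = b) ↔ w.1 = {a.1, b.1} := by
    refine fun w => ⟨fun h => hM.ext H_transitive w.2
      (doubleton_mem_of_elementary hM hθ a.2 b.2) fun z hz => ?_, fun h v => ?_⟩
    · rw [ZFSet.mem_pair, h ⟨z, hz⟩, Subtype.ext_iff, Subtype.ext_iff]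
    · rw [h, ZFSet.mem_pair, Subtype.ext_iff, Subtype.ext_iff]
  simp only [IsPairIn, h1, h2]
  constructor
  · intro h
    refine hM.ext H_transitive p.2 (pair_mem_of_elementary hM hθ a.2 b.2) fun z hz => ?_
    rw [h ⟨z, hz⟩, ZFSet.pair, ZFSet.mem_pair]
  · intro h w
    rw [h, ZFSet.pair, ZFSet.mem_pair]

theorem pairMemIn_iff {r a b : M} : PairMemIn M r a b ↔ ZFSet.pair a.1 b.1 ∈ r.1 := by
  simp only [PairMemIn, isPairIn_iff hM hθ]
  exact ⟨fun ⟨p, hp, h⟩ => h ▸ hp, fun h => ⟨⟨_, pair_mem_of_elementary hM hθ a.2 b.2⟩, h, rfl⟩⟩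

end

/-- A well-order of the whole universe is restricted to `x`. Nonemptiness is written `∃ a ∈ y, a =
a` to match the bounded quantifiers of `Expressible`. -/
theorem exists_wellOrder_mem_H (hθ : ℵ₀ ≤ θ) {x : ZFSet.{u}} (hx : x ∈ H θ) :
    ∃ r ∈ H θ, (∀ a ∈ x, ZFSet.pair a a ∉ r) ∧
      (∀ a ∈ x, ∀ b ∈ x, ∀ c ∈ x, ZFSet.pair a b ∈ r → ZFSet.pair b c ∈ r → ZFSet.pair a c ∈ r) ∧
      (∀ a ∈ x, ∀ b ∈ x, ZFSet.pair a b ∈ r ∨ a = b ∨ ZFSet.pair b a ∈ r) ∧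
      ∀ y ∈ H θ, y ⊆ x → (∃ a ∈ y, a = a) → ∃ m ∈ y, ∀ a ∈ y, a = m ∨ ZFSet.pair m a ∈ r := by
  let R : ZFSet.{u} → ZFSet.{u} → Prop := WellOrderingRel
  let r := ZFSet.sep (fun p => ∃ a b, p = ZFSet.pair a b ∧ R a b) (ZFSet.prod x x)
  have hr : ∀ a ∈ x, ∀ b ∈ x, (ZFSet.pair a b ∈ r ↔ R a b) := by
    intro a ha b hb
    simp only [r, ZFSet.mem_sep, ZFSet.pair_mem_prod, ha, hb, true_and, ZFSet.pair_inj]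
    exact ⟨fun ⟨_, _, ⟨h1, h2⟩, h⟩ => h1 ▸ h2 ▸ h, fun h => ⟨a, b, ⟨rfl, rfl⟩, h⟩⟩
  refine ⟨r, mem_H_of_subset (prod_mem_H hθ hx hx) ZFSet.sep_subset, fun a ha h => ?_,
    fun a ha b hb c hc hab hbc => ?_, fun a ha b hb => ?_, fun y _ hyx hy => ?_⟩
  · exact irrefl_of R a ((hr a ha a ha).1 h)
  · rw [hr a ha b hb] at hab
    rw [hr b hb c hc] at hbc
    exact (hr a ha c hc).2 (trans_of R hab hbc)
  · rw [hr a ha b hb, hr b hb a ha]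
    exact trichotomous_of R a b
  · obtain ⟨a, ha, -⟩ := hy
    have hwf : WellFounded R := IsWellFounded.wf
    obtain ⟨m, hm, hmin⟩ := hwf.has_min {a | a ∈ y} ⟨a, ha⟩
    refine ⟨m, hm, fun b hb => ?_⟩
    rw [hr m (hyx hm) b (hyx hb)]
    rcases trichotomous_of R m b with h | h | h
    exacts [.inr h, .inl h.symm, absurd h (hmin b hb)]

/-- An elementary submodel of `H(θ)` that has a limit ordinal as a subset and an element is a
model of `ZFC⁻`. -/
theorem modelsZFCMinus_of_elementary (hM : IsElementarySubmodel M (H θ)) (hθ : θ.IsRegular)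
    {κ : Cardinal.{u}} (hκ : ℵ₀ ≤ κ) (hκM : cardSet κ ∈ M) (hsub : ∀ x ∈ cardSet κ, x ∈ M) :
    ModelsZFCMinus M where
  extensionality x y h :=
    Subtype.ext (hM.ext H_transitive x.2 y.2 fun z hz => h ⟨z, hz⟩)
  foundation := by
    rintro x ⟨y, hy⟩
    obtain ⟨z, hz, hzx⟩ := ZFSet.regularity x.1 (fun h => ZFSet.notMem_empty y.1 (h ▸ hy))
    obtain ⟨m, hm, hmx, h⟩ := hM.exists_mem H_transitive ![x.1] (by simp)
      (fun _ v z => z ∈ v 0 ∧ ∀ w ∈ z, w ∉ v 0) (.and (.mem _ _) (.ball (.not (.mem _ _))))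
      ⟨z, H_transitive _ (hM.subset x.2) z hz, hz, fun w hw hwx =>
        ZFSet.notMem_empty w (hzx ▸ ZFSet.mem_inter.2 ⟨hwx, hw⟩)⟩
    exact ⟨⟨m, hm⟩, hmx, fun w hw => h w.1 hw⟩
  pairing x y := by
    refine ⟨⟨_, doubleton_mem_of_elementary hM hθ.aleph0_le x.2 y.2⟩, fun w => ?_⟩
    rw [ZFSet.mem_pair, Subtype.ext_iff, Subtype.ext_iff]
  union x := by
    have h : ZFSet.sUnion x.1 ∈ M :=
      hM.mem_of_unique H_transitive ![x.1] (by simp)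
        (fun S v z => ∀ w ∈ S, w ∈ z ↔ ∃ y ∈ v 0, w ∈ y)
        (.all (.iff (.mem _ _) (.bex (.mem _ _))))
        (sUnion_mem_H hθ (hM.subset x.2)) (fun w _ => ZFSet.mem_sUnion) fun z hz h => by
          ext w
          refine ⟨fun hw => ?_, fun hw => ?_⟩
          · exact ZFSet.mem_sUnion.2 ((h w (H_transitive z hz w hw)).1 hw)
          · obtain ⟨y, hy, hwy⟩ := ZFSet.mem_sUnion.1 hw
            exact (h w (H_transitive _ (H_transitive _ (hM.subset x.2) y hy) w hwy)).2 ⟨y, hy, hwy⟩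
    refine ⟨⟨_, h⟩, fun w => ?_⟩
    rw [ZFSet.mem_sUnion]
    constructor
    · rintro ⟨y, hy, hw⟩
      obtain ⟨y', hy', h⟩ := hM.exists_mem H_transitive ![x.1, w.1]
        (by simp [Fin.forall_fin_two])
        (fun _ v y => y ∈ v 0 ∧ v 1 ∈ y) (.and (.mem _ _) (.mem _ _))
        ⟨y, H_transitive _ (hM.subset x.2) y hy, hy, hw⟩
      exact ⟨⟨y', hy'⟩, h⟩
    · rintro ⟨y, hy, hw⟩
      exact ⟨y.1, hy, hw⟩
  infinity := by
    -- The inductive set is `κ` itself, all of whose elements lie in `M`.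
    have hlim : Order.IsSuccLimit κ.ord := isSuccLimit_ord hκ
    refine ⟨⟨_, hκM⟩, ?_, fun y hy => ?_⟩
    · have h0 : ∅ ∈ cardSet κ := by
        rw [← Ordinal.toZFSet_zero]
        exact Ordinal.toZFSet_mem_toZFSet_iff.2 (pos_iff_ne_zero.2 hlim.ne_bot)
      exact ⟨⟨∅, hsub _ h0⟩, h0, fun z => ZFSet.notMem_empty _⟩
    · obtain ⟨o, ho, hoy⟩ := Ordinal.mem_toZFSet_iff.1 hy
      have h1 : insert y.1 y.1 ∈ cardSet κ := by
        rw [← hoy, ← Ordinal.toZFSet_add_one, ← Order.succ_eq_add_one]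
        exact Ordinal.toZFSet_mem_toZFSet_iff.2 (hlim.succ_lt ho)
      refine ⟨⟨_, hsub _ h1⟩, h1, fun z => ?_⟩
      rw [ZFSet.mem_insert_iff, or_comm, Subtype.ext_iff]
  separation φ v a := by
    have hv : ∀ x : M, φ.Realize (Sum.elim v ![x]) ↔
        Sat (H θ) φ (Sum.elim (fun i => (v i).1) fun _ => x.1) := by
      intro x
      rw [← hM.sat_iff φ (by rintro (i | i) <;> simp), ← sat_coe]
      refine iff_of_eq (congrArg _ (funext ?_))
      rintro (i | i) <;> simp
    obtain ⟨b, hb, h⟩ := hM.exists_mem H_transitive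
      (fun o : Option ℕ => o.elim a.1 fun i => (v i).1)
      (by rintro (_ | i) <;> simp)
      (fun S v b => ∀ x ∈ S, x ∈ b ↔ x ∈ v none ∧
        Sat S φ fun d => Sum.elim (fun i => v (some i)) (fun _ => x) d)
      (.all <| .iff (.mem _ _) <| .and (.mem _ _) <|
        (Expressible.sat φ (Sum.elim (fun i => some (some (some i))) fun _ => none)).congr
          fun S _ v _ => iff_of_eq (congrArg _ (funext (by rintro (i | i) <;> rfl))))
      ⟨ZFSet.sep (fun x => Sat (H θ) φ (Sum.elim (fun i => (v i).1) fun _ => x)) a.1,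
        mem_H_of_subset (hM.subset a.2) ZFSet.sep_subset, fun x _ => ZFSet.mem_sep⟩
    exact ⟨⟨b, hb⟩, fun x => (h x.1 (hM.subset x.2)).trans (and_congr Iff.rfl (hv x).symm)⟩
  collection φ v a hφ := by
    have hv : ∀ x y : M, φ.Realize (Sum.elim v ![x, y]) ↔
        Sat (H θ) φ (Sum.elim (fun i => (v i).1) ![x.1, y.1]) := by
      intro x y
      rw [← hM.sat_iff φ (by
        rintro (i | i)
        · simp
        · fin_cases i <;> simp), ← sat_coe]
      refine iff_of_eq (congrArg _ (funext ?_))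
      rintro (i | i)
      · simp
      · fin_cases i <;> simp
    let P := fun x y => y ∈ H θ ∧ Sat (H θ) φ (Sum.elim (fun i => (v i).1) ![x, y])
    classical
    -- The image of `a` under a choice of witnesses is a collecting set in `H(θ)`; elementarity then
    -- supplies one in `M`. The default `∅` keeps all values in `H(θ)`.
    let g : ZFSet.{u} → ZFSet.{u} := fun x => if h : ∃ y, P x y then h.choose else ∅
    have hg : ∀ x, g x ∈ H θ := by
      intro x
      by_cases h : ∃ y, P x y
      · simp only [g, dif_pos h]
        exact h.choose_spec.1
      · simp only [g, dif_neg h]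
        exact empty_mem_H hθ.aleph0_le
    have hexp : ∀ {Γ : Type} (k : ℕ → Γ) (x y : Γ), Expressible.{u} Γ fun S v =>
        Sat S φ (Sum.elim (fun i => v (k i)) ![v x, v y]) := fun k x y =>
      (Expressible.sat φ (Sum.elim k ![x, y])).congr fun S _ v _ =>
        iff_of_eq (congrArg _ (funext (by
          rintro (i | i)
          · rfl
          · fin_cases i <;> rfl)))
    obtain ⟨b, hb, h⟩ := hM.exists_mem H_transitive
      (fun o : Option ℕ => o.elim a.1 fun i => (v i).1)
      (by rintro (_ | i) <;> simp)
      (fun S v b => ∀ x ∈ v none,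
        (∃ y ∈ S, Sat S φ (Sum.elim (fun i => v (some i)) ![x, y])) →
        ∃ y ∈ b, Sat S φ (Sum.elim (fun i => v (some i)) ![x, y]))
      (.ball <| .imp (.ex (hexp (fun i => some (some (some (some i)))) _ _))
        (.bex (hexp (fun i => some (some (some (some i)))) _ _)))
      ⟨replacement g a.1, replacement_mem_H (hM.subset a.2) fun x _ => hg x,
        fun x hx ⟨y, hy, hxy⟩ => by
          have h : ∃ y, P x y := ⟨y, hy, hxy⟩
          refine ⟨g x, mem_replacement.2 ⟨x, hx, rfl⟩, ?_⟩
          simp only [g, dif_pos h]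
          exact h.choose_spec.2⟩
    refine ⟨⟨b, hb⟩, fun x hx => ?_⟩
    obtain ⟨y, hy⟩ := hφ x hx
    obtain ⟨z, hzb, hz⟩ := h x.1 hx ⟨y.1, hM.subset y.2, (hv x y).1 hy⟩
    -- The witness `z ∈ b` may lie outside `M`. Elementarity, with `x`, `b` and the parameters
    -- fixed, replaces it by one in `M`.
    obtain ⟨z', hz', hzb', h'⟩ := hM.exists_mem H_transitive
      (fun o : Option (Option ℕ) => o.elim b fun o => o.elim x.1 fun i => (v i).1)
      (by rintro (_ | _ | i) <;> simp [hb])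
      (fun S v z => z ∈ v none ∧
        Sat S φ (Sum.elim (fun i => v (some (some i))) ![v (some none), z]))
      (.and (.mem _ _) (hexp (fun i => some (some (some i))) _ _))
      ⟨z, H_transitive b (hM.subset hb) z hzb, hzb, hz⟩
    exact ⟨⟨z', hz'⟩, hzb', (hv x ⟨z', hz'⟩).2 h'⟩
  wellOrdering x := by
    have hex := exists_wellOrder_mem_H hθ.aleph0_le (hM.subset x.2)
    obtain ⟨r, hr, h1, h2, h3, h4⟩ := hM.exists_mem H_transitive ![x.1] (by simp)
      (fun S v r => (∀ a ∈ v 0, ZFSet.pair a a ∉ r) ∧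
      (∀ a ∈ v 0, ∀ b ∈ v 0, ∀ c ∈ v 0,
        ZFSet.pair a b ∈ r → ZFSet.pair b c ∈ r → ZFSet.pair a c ∈ r) ∧
      (∀ a ∈ v 0, ∀ b ∈ v 0, ZFSet.pair a b ∈ r ∨ a = b ∨ ZFSet.pair b a ∈ r) ∧
      ∀ y ∈ S, y ⊆ v 0 → (∃ a ∈ y, a = a) → ∃ m ∈ y, ∀ a ∈ y, a = m ∨ ZFSet.pair m a ∈ r)
      (.and (.ball <| .not <| .pair_mem _ _ _) <|
        .and (.ball <| .ball <| .ball <| .imp (.pair_mem _ _ _) <| .imp (.pair_mem _ _ _) <|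
          .pair_mem _ _ _) <|
        .and (.ball <| .ball <| .or (.pair_mem _ _ _) <| .or (.eq _ _) (.pair_mem _ _ _)) <|
        .all <| .imp (.subset _ _) <| .imp (.bex (.eq _ _)) <|
          .bex <| .ball <| .or (.eq _ _) (.pair_mem _ _ _)) hex
    refine ⟨⟨r, hr⟩, ?_⟩
    simp only [pairMemIn_iff hM hθ.aleph0_le]
    refine ⟨fun a ha => h1 a.1 ha, fun a b c ha hb hc => h2 a.1 ha b.1 hb c.1 hc,
      fun a b ha hb => by simpa [Subtype.ext_iff] using h3 a.1 ha b.1 hb, fun y hy hne => ?_⟩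
    obtain ⟨a, ha⟩ := hne
    -- The hypothesis compares only elements of `M`; an element of `y` outside `x` would have a
    -- counterpart in `M`.
    have hyx : y.1 ⊆ x.1 := by
      by_contra hc
      rw [ZFSet.subset_def] at hc
      push Not at hc
      obtain ⟨z, hz, hzx⟩ := hc
      obtain ⟨z', hz', h, h'⟩ := hM.exists_mem H_transitive ![x.1, y.1]
        (by simp [Fin.forall_fin_two]) (fun _ v z => z ∈ v 1 ∧ z ∉ v 0)
        (.and (.mem _ _) (.not (.mem _ _))) ⟨z, H_transitive _ (hM.subset y.2) z hz, hz, hzx⟩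
      exact h' (hy ⟨z', hz'⟩ h)
    obtain ⟨m, hm, hmin⟩ := h4 y.1 (hM.subset y.2) hyx ⟨a.1, ha, rfl⟩
    obtain ⟨m', hm', h, h'⟩ := hM.exists_mem H_transitive ![r, y.1]
      (by simp [Fin.forall_fin_two, hr])
      (fun _ v m => m ∈ v 1 ∧ ∀ a ∈ v 1, a = m ∨ ZFSet.pair m a ∈ v 0)
      (.and (.mem _ _) (.ball (.or (.eq _ _) (.pair_mem _ _ _))))
      ⟨m, H_transitive _ (hM.subset y.2) m hm, hm, hmin⟩
    exact ⟨⟨m', hm'⟩, h, fun a ha => by simpa [Subtype.ext_iff] using h' a.1 ha⟩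

/-! ### Subsets of a regular cardinal -/

section CardSet

variable {κ : Cardinal.{u}}

theorem mem_cardSet {x : ZFSet.{u}} : x ∈ cardSet κ ↔ ∃ o < κ.ord, o.toZFSet = x :=
  Ordinal.mem_toZFSet_iff

theorem isOrdinal_cardSet : (cardSet κ).IsOrdinal := ZFSet.isOrdinal_toZFSet _

theorem card_cardSet : (cardSet κ).card = κ := by
  rw [cardSet, Ordinal.card_toZFSet, card_ord]

theorem mem_cardSet_of_mem {x y : ZFSet.{u}} (hx : x ∈ cardSet κ) (hy : y ∈ x) : y ∈ cardSet κ :=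
  isOrdinal_cardSet.mem_trans hy hx

theorem isOrdinal_of_mem_cardSet {x : ZFSet.{u}} (hx : x ∈ cardSet κ) : x.IsOrdinal :=
  isOrdinal_cardSet.mem hx

theorem insert_self_mem_cardSet (hκ : ℵ₀ ≤ κ) {x : ZFSet.{u}} (hx : x ∈ cardSet κ) :
    insert x x ∈ cardSet κ := by
  obtain ⟨o, ho, rfl⟩ := mem_cardSet.1 hx
  rw [← Ordinal.toZFSet_add_one]
  exact Ordinal.toZFSet_mem_toZFSet_iff.2 ((isSuccLimit_ord hκ).add_one_lt ho)

theorem card_lt_of_mem_cardSet {x : ZFSet.{u}} (hx : x ∈ cardSet κ) : x.card < κ := by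
  obtain ⟨o, ho, rfl⟩ := mem_cardSet.1 hx
  rw [Ordinal.card_toZFSet]
  exact lt_ord.1 ho

/-- A set bounded by `γ` is contained in `γ + 1`, which has fewer than `κ` elements. -/
theorem exists_mem_of_card_eq (hκ : ℵ₀ ≤ κ) {A : ZFSet.{u}} (hA : A ⊆ cardSet κ)
    (hcard : A.card = κ) : ∀ γ ∈ cardSet κ, ∃ β ∈ A, γ ∈ β := by
  intro γ hγ
  by_contra! h
  have h1 : A ⊆ insert γ γ := by
    intro β hβ
    have h2 := ((isOrdinal_of_mem_cardSet hγ).notMem_iff_subset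
      (isOrdinal_of_mem_cardSet (hA hβ))).1 (h β hβ)
    rw [ZFSet.mem_insert_iff]
    exact ((isOrdinal_of_mem_cardSet (hA hβ)).subset_iff_eq_or_mem
      (isOrdinal_of_mem_cardSet hγ)).1 h2
  have h2 := card_lt_of_mem_cardSet (insert_self_mem_cardSet hκ hγ)
  exact absurd (ZFSet.card_mono h1) (hcard ▸ h2.not_ge)

theorem mem_H_of_mem_cardSet {x : ZFSet.{u}} (hx : x ∈ cardSet κ) : x ∈ H κ := by
  obtain ⟨o, ho, rfl⟩ := mem_cardSet.1 hx
  exact toZFSet_mem_H (lt_ord.1 ho)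

/-- If `A` had fewer than `κ` elements, it would lie in `H(κ)` and its rank would be an ordinal
below `κ`. Some element of `A` would then contain that ordinal, and so have rank above that of `A`.
-/
theorem card_eq_of_unbounded (hκ : κ.IsRegular) {A : ZFSet.{u}} (hA : A ⊆ cardSet κ)
    (h : ∀ γ ∈ cardSet κ, ∃ β ∈ A, γ ∈ β) : A.card = κ := by
  refine le_antisymm ((ZFSet.card_mono hA).trans_eq card_cardSet) (le_of_not_gt fun hlt => ?_)
  have h1 : A ∈ H κ := mem_H_iff.2 ⟨hlt, fun x hx => mem_H_of_mem_cardSet (hA hx)⟩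
  obtain ⟨β, hβ, hγ⟩ := h A.rank.toZFSet (mem_cardSet.2 ⟨_, rank_lt_of_mem_H hκ h1, rfl⟩)
  have h2 := ZFSet.rank_lt_of_mem hγ
  rw [Ordinal.rank_toZFSet] at h2
  exact lt_asymm h2 (ZFSet.rank_lt_of_mem hβ)

theorem exists_mem_subset_of_finite {F : ZFSet.{u}} (hne : ∃ A, A ∈ F)
    (hinter : ∀ A ∈ F, ∀ B ∈ F, ∃ C ∈ F, C ⊆ A ∧ C ⊆ B) (n : ℕ) (A : Fin n → ZFSet.{u})
    (hA : ∀ i, A i ∈ F) : ∃ C ∈ F, ∀ i, C ⊆ A i := by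
  induction n with
  | zero =>
    obtain ⟨C, hC⟩ := hne
    exact ⟨C, hC, fun i => i.elim0⟩
  | succ n ih =>
    obtain ⟨C, hC, h⟩ := ih (fun i => A i.castSucc) fun i => hA _
    obtain ⟨D, hD, h1, h2⟩ := hinter C hC (A (Fin.last n)) (hA _)
    refine ⟨D, hD, fun i => ?_⟩
    refine Fin.lastCases h2 (fun i => ?_) i
    exact fun x hx => h i (h1 hx)

/-- Replaces the size of finite intersections by directedness and unboundedness, which bounded
quantifiers can express; `GoodCore` uses this form. -/
theorem isFilterOn_of_directed (hκ : κ.IsRegular) {F : ZFSet.{u}} (hsub : ∀ A ∈ F, A ⊆ cardSet κ)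
    (hne : ∃ A, A ∈ F) (hinter : ∀ A ∈ F, ∀ B ∈ F, ∃ C ∈ F, C ⊆ A ∧ C ⊆ B)
    (hunb : ∀ A ∈ F, ∀ γ ∈ cardSet κ, ∃ β ∈ A, γ ∈ β) : IsFilterOn κ F := by
  refine ⟨fun A hA => ZFSet.mem_powerset.2 (hsub A hA), fun n A hA => ?_⟩
  obtain ⟨C, hC, h⟩ := exists_mem_subset_of_finite hne hinter n A hA
  refine card_eq_of_unbounded hκ ZFSet.sep_subset fun γ hγ => ?_
  obtain ⟨β, hβ, hγβ⟩ := hunb C hC γ hγ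
  exact ⟨β, ZFSet.mem_sep.2 ⟨hsub C hC hβ, fun i => h i hβ⟩, hγβ⟩

end CardSet

/-! ### Closure of elementary submodels under definable sets and functions -/

theorem mem_of_pair_mem_of_transitive {S : Set ZFSet.{u}} (hS : ∀ x ∈ S, ∀ y ∈ x, y ∈ S)
    {a b f : ZFSet.{u}} (hf : f ∈ S) (h : ZFSet.pair a b ∈ f) : a ∈ S ∧ b ∈ S := by
  have h2 : ({a, b} : ZFSet) ∈ S := hS _ (hS _ hf _ h) _ (by simp [ZFSet.pair])
  exact ⟨hS _ h2 _ (by simp), hS _ h2 _ (by simp)⟩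

theorem app_eq_of_pair_mem {f a b : ZFSet.{u}} (hf : ∀ c, ZFSet.pair a c ∈ f → c = b)
    (h : ZFSet.pair a b ∈ f) : app f a = b := by
  have h1 : ∃ b, ZFSet.pair a b ∈ f := ⟨b, h⟩
  rw [app, dif_pos h1]
  exact hf _ h1.choose_spec

section

variable {M : Set ZFSet.{u}} {θ : Cardinal.{u}} (hM : IsElementarySubmodel M (H θ))
include hM

/-- Since `P` is evaluated in `H(θ)`, the separated set is definable there from parameters in `M`.
-/
theorem sep_mem_of_elementary {a : ZFSet.{u}} (ha : a ∈ M) {Γ : Type} (v : Γ → ZFSet.{u})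
    (hv : ∀ i, v i ∈ M) (P : Set ZFSet.{u} → (Γ → ZFSet.{u}) → ZFSet.{u} → Prop)
    (hP : Expressible (Option Γ) fun S w => P S (fun i => w (some i)) (w none)) :
    ZFSet.sep (fun x => P (H θ) v x) a ∈ M :=
  hM.mem_of_unique H_transitive (fun o : Option Γ => o.elim a v)
    (by rintro (_ | i) <;> simp [ha, hv])
    (fun S v b => ∀ x ∈ S, x ∈ b ↔ x ∈ v none ∧ P S (fun i => v (some i)) x)
    (.all <| .iff (.mem _ _) <| .and (.mem _ _) <|
      hP.relabel fun o : Option Γ => o.elim none fun i => some (some (some i)))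
    (mem_H_of_subset (hM.subset ha) ZFSet.sep_subset) (fun _ _ => ZFSet.mem_sep) fun b hb h => by
      ext x
      rw [ZFSet.mem_sep]
      exact ⟨fun hx => (h x (H_transitive b hb x hx)).1 hx,
        fun hx => (h x (H_transitive a (hM.subset ha) x hx.1)).2 hx⟩

theorem inter_mem_of_elementary {a b : ZFSet.{u}} (ha : a ∈ M) (hb : b ∈ M) : a ∩ b ∈ M :=
  sep_mem_of_elementary hM ha ![b] (by simp [hb]) (fun _ v x => x ∈ v 0) (.mem _ _)

theorem sdiff_mem_of_elementary {a b : ZFSet.{u}} (ha : a ∈ M) (hb : b ∈ M) : a \ b ∈ M :=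
  sep_mem_of_elementary hM ha ![b] (by simp [hb]) (fun _ v x => x ∉ v 0) (.not (.mem _ _))

theorem graph_mem_of_elementary (hθ : ℵ₀ ≤ θ) {k : ZFSet.{u}} (hk : k ∈ M) {Γ : Type}
    (v : Γ → ZFSet.{u}) (hv : ∀ i, v i ∈ M)
    (P : Set ZFSet.{u} → (Γ → ZFSet.{u}) → ZFSet.{u} → ZFSet.{u} → Prop)
    (hP : Expressible (Option (Option Γ)) fun S w =>
      P S (fun i => w (some (some i))) (w (some none)) (w none))
    {G : ZFSet.{u} → ZFSet.{u}} (hG : ∀ a ∈ k, G a ∈ H θ)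
    (h : ∀ a ∈ k, ∀ z ∈ H θ, P (H θ) v a z ↔ G a = z) : graph G k ∈ M := by
  have hgr : ZFSet.IsFunc k (replacement G k) (graph G k) :=
    isFunc_graph fun a ha => mem_replacement.2 ⟨a, ha, rfl⟩
  have hmem : ∀ p, p ∈ graph G k ↔ ∃ a ∈ k, ∃ z ∈ H θ, p = ZFSet.pair a z ∧ P (H θ) v a z := by
    intro p
    constructor
    · intro hp
      obtain ⟨a, ha, rfl⟩ := mem_replacement.1 hp
      exact ⟨a, ha, _, hG a ha, rfl, (h a ha _ (hG a ha)).2 rfl⟩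
    · rintro ⟨a, ha, z, hz, rfl, hz'⟩
      exact pair_mem_graph.2 ⟨ha, (h a ha z hz).1 hz'⟩
  have hgrH : graph G k ∈ H θ := isFunc_mem_H hθ hgr (hM.subset hk)
    (H_transitive _ (replacement_mem_H (hM.subset hk) hG))
  refine hM.mem_of_unique H_transitive (fun o : Option Γ => o.elim k v)
    (by rintro (_ | i) <;> simp [hk, hv])
    (fun S v X => ∀ p ∈ S, p ∈ X ↔ ∃ a ∈ v none, ∃ z ∈ S, p = ZFSet.pair a z ∧
      P S (fun i => v (some i)) a z)
    (.all <| .iff (.mem _ _) <| .bex <| .ex <| .and (.eq_pair _ _ _) <|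
      hP.relabel fun o : Option (Option Γ) => o.elim none fun o => o.elim (some none) fun i =>
        some (some (some (some (some i)))))
    hgrH (fun p _ => hmem p) fun X hX hXp => ?_
  ext p
  exact ⟨fun hp => (hmem p).2 ((hXp p (H_transitive _ hX p hp)).1 hp),
    fun hp => (hXp p (H_transitive _ hgrH p hp)).2 ((hmem p).1 hp)⟩

theorem graph_sep_mem_of_elementary (hθ : ℵ₀ ≤ θ) {k b : ZFSet.{u}} (hk : k ∈ M) (hb : b ∈ M)
    {Γ : Type} (v : Γ → ZFSet.{u}) (hv : ∀ i, v i ∈ M)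
    (P : Set ZFSet.{u} → (Γ → ZFSet.{u}) → ZFSet.{u} → ZFSet.{u} → Prop)
    (hP : Expressible (Option (Option Γ)) fun S w =>
      P S (fun i => w (some (some i))) (w (some none)) (w none)) :
    graph (fun a => ZFSet.sep (fun x => P (H θ) v a x) b) k ∈ M := by
  have hbH := hM.subset hb
  refine graph_mem_of_elementary hM hθ hk (fun o : Option Γ => o.elim b v)
    (by rintro (_ | i) <;> simp [hb, hv])
    (fun S v a z => ∀ x ∈ S, x ∈ z ↔ x ∈ v none ∧ P S (fun i => v (some i)) a x)
    (.all <| .iff (.mem _ _) <| .and (.mem _ _) <| hP.relabel fun o : Option (Option Γ) =>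
      o.elim none fun o => o.elim (some (some none)) fun i => some (some (some (some i))))
    (fun a _ => mem_H_of_subset hbH ZFSet.sep_subset) fun a _ z hz => ?_
  constructor
  · intro h
    ext x
    rw [ZFSet.mem_sep]
    exact ⟨fun hx => (h x (H_transitive b hbH x hx.1)).2 hx,
      fun hx => (h x (H_transitive z hz x hx)).1 hx⟩
  · rintro rfl x _
    exact ZFSet.mem_sep

theorem diagInter_mem_of_elementary {κ : Cardinal.{u}} (hκM : cardSet κ ∈ M) {X : ZFSet.{u}}
    (hX : X ∈ M) : diagInter κ X ∈ M := by
  have h := sep_mem_of_elementary hM hκM ![X] (by simpa using hX)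
    (fun S v β => ∀ γ ∈ β, ∀ Y ∈ S, ZFSet.pair γ Y ∈ v 0 → β ∈ Y)
    (.ball <| .all <| .imp (.pair_mem _ _ _) (.mem _ _))
  have h1 : diagInter κ X =
      ZFSet.sep (fun β => ∀ γ ∈ β, ∀ Y ∈ H θ, ZFSet.pair γ Y ∈ X → β ∈ Y) (cardSet κ) := by
    refine congrArg (ZFSet.sep · _) (funext fun β => propext ?_)
    exact ⟨fun h γ hγ Y _ => h γ hγ Y, fun h γ hγ Y hY => h γ hγ Y
      (mem_of_pair_mem_of_transitive H_transitive (hM.subset hX) hY).2 hY⟩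
  rw [h1]
  exact h

theorem mem_of_pair_mem_right {f a b : ZFSet.{u}} (hf : f ∈ M) (ha : a ∈ M)
    (hu : ∀ c, ZFSet.pair a c ∈ f → c = b) (h : ZFSet.pair a b ∈ f) : b ∈ M := by
  refine hM.mem_of_unique H_transitive ![f, a] (by simp [Fin.forall_fin_two, ha, hf])
    (fun _ v x => ZFSet.pair (v 1) x ∈ v 0) (.pair_mem _ _ _) ?_ h fun y _ hy => hu y hy
  have h1 := H_transitive _ (hM.subset hf) _ h
  have h2 : ({a, b} : ZFSet) ∈ H θ := H_transitive _ h1 _ (by simp [ZFSet.pair])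
  exact H_transitive _ h2 _ (by simp)

theorem mem_of_pair_mem_left {f a b : ZFSet.{u}} (hf : f ∈ M) (hb : b ∈ M)
    (hu : ∀ c, ZFSet.pair c b ∈ f → c = a) (h : ZFSet.pair a b ∈ f) : a ∈ M := by
  refine hM.mem_of_unique H_transitive ![f, b] (by simp [Fin.forall_fin_two, hb, hf])
    (fun _ v x => ZFSet.pair x (v 1) ∈ v 0) (.pair_mem _ _ _) ?_ h fun y _ hy => hu y hy
  have h1 := H_transitive _ (hM.subset hf) _ h
  have h2 : ({a, b} : ZFSet) ∈ H θ := H_transitive _ h1 _ (by simp [ZFSet.pair])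
  exact H_transitive _ h2 _ (by simp)

end

section WeakModel

variable {κ : Cardinal.{u}} {M : ZFSet.{u}} (hw : IsWeakModel κ M)
include hw

theorem IsWeakModel.cardSet_mem : cardSet κ ∈ M := hw.succ_subset (by simp)

theorem IsWeakModel.mem_of_mem_cardSet {x : ZFSet.{u}} (hx : x ∈ cardSet κ) : x ∈ M :=
  hw.succ_subset (ZFSet.mem_insert_of_mem _ hx)

end WeakModel

/-! ### From embeddings to filters -/

section Embedding

variable {κ θ : Cardinal.{u}} {M : ZFSet.{u}}

/-- The filter is the measure derived from `j` with seed `κ`; each property of it is a fact about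
`H(θ)` transferred to `N` and read at the point `κ ∈ j(κ)`. -/
theorem exists_isGood_of_embedding (hκ : κ.IsRegular) (hw : IsWeakModel κ M)
    (hM : IsElementarySubmodel (M : Set ZFSet.{u}) (H θ))
    (h : HasPowersetPreservingEmbedding κ M) : ∃ F : ZFSet.{u}, IsGood κ M F := by
  obtain ⟨N, hN, j, hj1, hj2, hpow⟩ := h
  classical
  -- `J` is `j` extended by the junk value `∅` outside `M`. The second property carries expressible
  -- facts from `H(θ)` to `N`.
  obtain ⟨J, hJN, hJ, hJeq⟩ : ∃ J : ZFSet.{u} → ZFSet.{u}, (∀ x ∈ M, J x ∈ N) ∧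
      (∀ {Γ : Type} {P : Set ZFSet.{u} → (Γ → ZFSet.{u}) → Prop}, Expressible Γ P →
        ∀ v : Γ → ZFSet.{u}, (∀ i, v i ∈ M) → P (H θ) v → P (N : Set ZFSet.{u}) fun i => J (v i)) ∧
      ∀ x : (M : Set ZFSet.{u}), J x.1 = (j x).1 := by
    refine ⟨fun x => if hx : x ∈ M then (j ⟨x, hx⟩).1 else ∅, fun x hx => ?_,
      fun {Γ P} hP v hv h => ?_, fun x => ?_⟩
    · simp only [hx, dif_pos]
      exact (j _).2
    · simp only [hv, dif_pos]
      exact (hM.expressible_iff H_transitive (fun x hx y hy => hN x hx hy) j hP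
        fun i => ⟨v i, hv i⟩).1 h
    · have hx : x.1 ∈ M := x.2
      simp only [hx, dif_pos]
  have hκM := hw.cardSet_mem
  have hN' : ∀ x ∈ (N : Set ZFSet.{u}), ∀ y ∈ x, y ∈ (N : Set ZFSet.{u}) :=
    fun x hx y hy => hN x hx hy
  have hJγ : ∀ γ ∈ cardSet κ, J γ = γ := fun γ hγ =>
    (hJeq ⟨γ, hw.mem_of_mem_cardSet hγ⟩).trans (hj1 _ hγ)
  have hmem : ∀ {x y}, x ∈ M → y ∈ M → x ∈ y → J x ∈ J y := fun {x y} hx hy h =>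
    hJ (P := fun _ v => v 0 ∈ v 1) (.mem _ _) ![x, y] (by simp [Fin.forall_fin_two, hx, hy]) h
  have hpmem : ∀ {x y z}, x ∈ M → y ∈ M → z ∈ M → ZFSet.pair x y ∈ z →
      ZFSet.pair (J x) (J y) ∈ J z :=
    fun {x y z} hx hy hz h => hJ (P := fun _ v => ZFSet.pair (v 0) (v 1) ∈ v 2) (.pair_mem _ _ _)
      ![x, y, z] (by simp [Fin.forall_fin_succ, hx, hy, hz]) h
  -- `J κ` is an ordinal, contains every `γ = J γ` below `κ`, and differs from `κ`.
  have hκJ : cardSet κ ∈ J (cardSet κ) := by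
    have hord : (J (cardSet κ)).IsOrdinal := by
      rw [ZFSet.isOrdinal_iff_forall_mem_isTransitive]
      have h1 := ZFSet.isOrdinal_iff_forall_mem_isTransitive.1 (isOrdinal_cardSet (κ := κ))
      exact hJ (P := fun _ v => (∀ y ∈ v 0, y ⊆ v 0) ∧ ∀ x ∈ v 0, ∀ y ∈ x, y ⊆ x)
        (.and (.ball (.subset _ _)) (.ball (.ball (.subset _ _)))) ![cardSet κ] (by simp [hκM])
        ⟨fun y hy => h1.1 y hy, fun x hx y hy => h1.2 x hx y hy⟩
    have hsub : cardSet κ ⊆ J (cardSet κ) := fun γ hγ => by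
      have := hmem (hw.mem_of_mem_cardSet hγ) hκM hγ
      rwa [hJγ γ hγ] at this
    rcases (isOrdinal_cardSet.subset_iff_eq_or_mem hord).1 hsub with h | h
    · exact absurd ((hJeq ⟨_, hκM⟩).symm.trans h.symm) (hj2 ⟨_, hκM⟩ rfl)
    · exact h
  have hκN : cardSet κ ∈ N := hN' _ (hJN _ hκM) _ hκJ
  let F := ZFSet.sep (fun X => X ⊆ cardSet κ ∧ cardSet κ ∈ J X) M
  have hF : ∀ {X}, X ∈ F ↔ X ∈ M ∧ X ⊆ cardSet κ ∧ cardSet κ ∈ J X := ZFSet.mem_sep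
  have hup : ∀ {A B}, A ∈ F → B ∈ M → B ⊆ cardSet κ → A ⊆ B → B ∈ F := by
    intro A B hA hB hBκ hAB
    obtain ⟨h1, h2, h3⟩ := hF.1 hA
    refine hF.2 ⟨hB, hBκ, ?_⟩
    exact hJ (P := fun _ v => v 0 ⊆ v 1) (.subset _ _) ![A, B]
      (by simp [Fin.forall_fin_two, h1, hB]) hAB h3
  have hfilter : IsFilterOn κ F := by
    refine isFilterOn_of_directed hκ (fun A hA => (hF.1 hA).2.1)
      ⟨cardSet κ, hF.2 ⟨hκM, fun _ h => h, hκJ⟩⟩ (fun A hA B hB => ?_) fun A hA γ hγ => ?_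
    · obtain ⟨h1, h2, h3⟩ := hF.1 hA
      obtain ⟨h4, h5, h6⟩ := hF.1 hB
      have h7 := inter_mem_of_elementary hM h1 h4
      refine ⟨A ∩ B, hF.2 ⟨h7, fun x hx => h2 (ZFSet.mem_inter.1 hx).1, ?_⟩,
        fun x hx => (ZFSet.mem_inter.1 hx).1, fun x hx => (ZFSet.mem_inter.1 hx).2⟩
      exact hJ (P := fun _ v => ∀ x ∈ v 0, x ∈ v 1 → x ∈ v 2)
        (.ball (.imp (.mem _ _) (.mem _ _))) ![A, B, A ∩ B]
        (by simpa [Fin.forall_fin_succ] using ⟨h1, h4, h7⟩)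
        (fun x hx hx' => ZFSet.mem_inter.2 ⟨hx, hx'⟩) _ h3 h6
    · by_contra! hc
      obtain ⟨h1, h2, h3⟩ := hF.1 hA
      have := hJ (P := fun _ v => ∀ x ∈ v 0, v 1 ∉ x) (.ball (.not (.mem _ _))) ![A, γ]
        (by simpa [Fin.forall_fin_succ] using ⟨h1, hw.mem_of_mem_cardSet hγ⟩) hc _ h3
      exact this (by simpa [hJγ γ hγ] using hγ)
  have hmeas : ∀ A ∈ M, A ⊆ cardSet κ → A ∈ F ∨ cardSet κ \ A ∈ F := by
    intro A hA hAκ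
    have h1 := sdiff_mem_of_elementary hM hκM hA
    rcases hJ (P := fun _ v => ∀ x ∈ v 0, x ∈ v 1 ∨ x ∈ v 2)
      (.ball (.or (.mem _ _) (.mem _ _))) ![cardSet κ, A, cardSet κ \ A]
      (by simpa [Fin.forall_fin_succ] using ⟨hκM, hA, h1⟩)
      (fun x hx => by
        by_cases hxA : x ∈ A
        · exact .inl hxA
        · exact .inr (ZFSet.mem_sdiff.2 ⟨hx, hxA⟩)) _ hκJ with h | h
    · exact .inl (hF.2 ⟨hA, hAκ, h⟩)
    · exact .inr (hF.2 ⟨h1, fun x hx => (ZFSet.mem_sdiff.1 hx).1, h⟩)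
  have hfunct : ∀ {f a v w}, f ∈ M → (∀ a v w, ZFSet.pair a v ∈ f → ZFSet.pair a w ∈ f → v = w) →
      ZFSet.pair a v ∈ J f → ZFSet.pair a w ∈ J f → v = w := by
    intro f a v w hf hfun hv hw'
    have hp := mem_of_pair_mem_of_transitive hN' (hJN f hf) hv
    have hq := mem_of_pair_mem_of_transitive hN' (hJN f hf) hw'
    exact hJ (P := fun S u => ∀ a ∈ S, ∀ v ∈ S, ∀ w ∈ S, ZFSet.pair a v ∈ u 0 →
        ZFSet.pair a w ∈ u 0 → v = w)
      (.all <| .all <| .all <| .imp (.pair_mem _ _ _) <| .imp (.pair_mem _ _ _) (.eq _ _)) ![f]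
      (by simpa using hf) (fun a _ v _ w _ => hfun a v w) a hp.1 v hp.2 w hq.2 hv hw'
  refine ⟨F, ⟨hfilter, hmeas, fun X hX hXf => ?_⟩, ?_, ?_⟩
  -- For `γ < κ` the entry of `J X` at `γ = J γ` is the image of the entry of `X` at `γ`, which
  -- contains `κ` because that entry is in `F`. So `κ` meets the definition of the diagonal
  -- intersection of `J X`.
  · have hDM : diagInter κ X ∈ M := diagInter_mem_of_elementary hM hκM hX
    refine hF.2 ⟨hDM, ZFSet.sep_subset, ?_⟩
    refine hJ (P := fun S v => ∀ β ∈ v 0, (∀ γ ∈ β, ∀ Y ∈ S, ZFSet.pair γ Y ∈ v 1 → β ∈ Y) →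
        β ∈ v 2)
      (.ball <| .imp (.ball <| .all <| .imp (.pair_mem _ _ _) (.mem _ _)) (.mem _ _))
      ![cardSet κ, X, diagInter κ X] (by simpa [Fin.forall_fin_succ] using ⟨hκM, hX, hDM⟩)
      (fun β (hβ : β ∈ cardSet κ) h => (ZFSet.mem_sep.2 ⟨hβ, fun γ hγ Y hY => h γ hγ Y
        (mem_of_pair_mem_of_transitive H_transitive (hM.subset hX) hY).2 hY⟩ :
          β ∈ diagInter κ X)) _ hκJ
      fun γ hγ Y _ hY => ?_
    obtain ⟨h1, h2, h3⟩ := hF.1 (app_mem hXf hγ)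
    have h4 := hpmem (hw.mem_of_mem_cardSet hγ) h1 hX (pair_app_mem hXf hγ)
    rw [hJγ γ hγ] at h4
    rwa [hfunct hX (fun a v w hv hw' => by
      rw [((pair_mem_iff hXf).1 hv).2, ((pair_mem_iff hXf).1 hw').2]) hY h4]
  · rintro A hA ⟨f, hf, hfun, hinj⟩
    -- All parameters of this instance of separation are quantified, so that in `N` it can be
    -- applied to `κ`, which need not be in the range of `j`.
    have hsep : ∀ A ∈ N, ∀ f ∈ N, ∀ k ∈ N, ∀ q ∈ N, ∃ B ∈ N, ∀ γ ∈ N,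
        γ ∈ B ↔ γ ∈ k ∧ ∃ a ∈ A, ZFSet.pair a γ ∈ f ∧ q ∈ a :=
      hJ (Γ := Empty) (P := fun S _ => ∀ A ∈ S, ∀ f ∈ S, ∀ k ∈ S, ∀ q ∈ S, ∃ B ∈ S, ∀ γ ∈ S,
        γ ∈ B ↔ γ ∈ k ∧ ∃ a ∈ A, ZFSet.pair a γ ∈ f ∧ q ∈ a)
        (.all <| .all <| .all <| .all <| .ex <| .all <| .iff (.mem _ _) <| .and (.mem _ _) <|
          .bex <| .and (.pair_mem _ _ _) (.mem _ _)) Empty.elim (by simp)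
        fun A hA f hf k hk q hq => ⟨ZFSet.sep (fun γ => ∃ a ∈ A, ZFSet.pair a γ ∈ f ∧ q ∈ a) k,
          mem_H_of_subset hk ZFSet.sep_subset, fun γ _ => ZFSet.mem_sep⟩
    -- `B` collects the `J f`-indices below `κ` of those members of `J A` that contain `κ`. It is a
    -- subset of `κ` in `N`, hence in `M`, and `f` decodes `F ∩ A` from it.
    obtain ⟨B, hBN, hB⟩ := hsep (J A) (hJN A hA) (J f) (hJN f hf) _ hκN _ hκN
    have hBκ : B ⊆ cardSet κ := fun γ hγ => ((hB γ (hN' B hBN γ hγ)).1 hγ).1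
    have hBM : B ∈ M := (hpow B hBκ).2 hBN
    have hkey : F ∩ A =
        ZFSet.sep (fun a => a ⊆ cardSet κ ∧ ∃ γ ∈ B, ZFSet.pair a γ ∈ f) A := by
      ext a
      rw [ZFSet.mem_inter, and_comm]
      refine Iff.trans (and_congr_right fun haA => ?_) ZFSet.mem_sep.symm
      have hγ := app_mem hfun haA
      have hpair := pair_app_mem hfun haA
      have haM : a ∈ M := mem_of_pair_mem_left hM hf (hw.mem_of_mem_cardSet hγ)
        (fun c hc => hinj _ _ _ hc hpair) hpair
      have h4 := hpmem haM (hw.mem_of_mem_cardSet hγ) hf hpair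
      rw [hJγ _ hγ] at h4
      rw [hF]
      constructor
      · rintro ⟨_, h1, h2⟩
        exact ⟨h1, _, (hB _ (hN' _ hκN _ hγ)).2 ⟨hγ, _, hmem haM hA haA, h4, h2⟩, hpair⟩
      · rintro ⟨h1, γ, hγB, hγf⟩
        refine ⟨haM, h1, ?_⟩
        obtain rfl := ((pair_mem_iff hfun).1 hγf).2
        obtain ⟨-, a', ha', h5, h6⟩ := (hB _ (hN' _ hκN _ hγ)).1 hγB
        have h7 : a' = J a := by
          refine hJ (P := fun S v => ∀ a ∈ S, ∀ b ∈ S, ∀ c ∈ S,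
            ZFSet.pair a c ∈ v 0 → ZFSet.pair b c ∈ v 0 → a = b)
            (.all <| .all <| .all <| .imp (.pair_mem _ _ _) <| .imp (.pair_mem _ _ _) (.eq _ _))
            ![f] (by simpa using hf) (fun a _ b _ c _ => hinj a b c) a' ?_ (J a) (hJN a haM)
            (app f a) (hN' _ hκN _ hγ) h5 h4
          exact (mem_of_pair_mem_of_transitive hN' (hJN f hf) h5).1
        exact h7 ▸ h6
    have := sep_mem_of_elementary hM hA ![B, f, cardSet κ]
      (by simpa [Fin.forall_fin_succ] using ⟨hBM, hf, hκM⟩)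
      (fun _ v a => a ⊆ v 2 ∧ ∃ γ ∈ v 0, ZFSet.pair a γ ∈ v 1)
      (.and (.subset _ _) (.bex (.pair_mem _ _ _)))
    rw [hkey]
    exact this
  · have hfn : ∀ f : UltraFun κ M, ∀ a v w, ZFSet.pair a v ∈ f.1 →
        ZFSet.pair a w ∈ f.1 → v = w := by
      rintro ⟨f, hf, y, hy⟩ a v w hv hw'
      rw [((pair_mem_iff hy).1 hv).2, ((pair_mem_iff hy).1 hw').2]
    have happ : ∀ (f : UltraFun κ M) v, ZFSet.pair (cardSet κ) v ∈ J f.1 →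
        app (J f.1) (cardSet κ) = v := fun f v hv =>
      app_eq_of_pair_mem (fun c hc => hfunct f.2.1 (hfn f) hc hv) hv
    have hEq : ∀ f g : UltraFun κ M, UltraEq F f g →
        app (J f.1) (cardSet κ) = app (J g.1) (cardSet κ) := by
      intro f g h
      obtain ⟨h1, h2, h3⟩ := hF.1 h
      have hE : ∀ β ∈ ZFSet.sep (fun β => ∃ v,
          ZFSet.pair β v ∈ f.1 ∧ ZFSet.pair β v ∈ g.1) (cardSet κ),
          ∃ v, ZFSet.pair β v ∈ f.1 ∧ ZFSet.pair β v ∈ g.1 := fun β hβ => (ZFSet.mem_sep.1 hβ).2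
      revert h1 h3 hE
      generalize ZFSet.sep _ _ = E
      intro h1 h3 hE
      obtain ⟨v, _, hv, hv'⟩ := hJ
        (P := fun S v => ∀ β ∈ v 0, ∃ x ∈ S, ZFSet.pair β x ∈ v 1 ∧ ZFSet.pair β x ∈ v 2)
        (.ball <| .ex <| .and (.pair_mem _ _ _) (.pair_mem _ _ _)) ![E, f.1, g.1]
        (by simpa [Fin.forall_fin_succ] using ⟨h1, f.2.1, g.2.1⟩)
        (fun β hβ => by
          obtain ⟨v, hv, hv'⟩ := hE β hβ
          exact ⟨v, (mem_of_pair_mem_of_transitive H_transitive (hM.subset f.2.1) hv).2,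
              hv, hv'⟩) _ h3
      rw [happ f v hv, happ g v hv']
    have hMem : ∀ f g : UltraFun κ M, UltraMemRep F f g →
        app (J f.1) (cardSet κ) ∈ app (J g.1) (cardSet κ) := by
      intro f g h
      obtain ⟨h1, h2, h3⟩ := hF.1 h
      have hE : ∀ β ∈ ZFSet.sep (fun β => ∃ v w,
          ZFSet.pair β v ∈ f.1 ∧ ZFSet.pair β w ∈ g.1 ∧ v ∈ w) (cardSet κ),
          ∃ v w, ZFSet.pair β v ∈ f.1 ∧ ZFSet.pair β w ∈ g.1 ∧ v ∈ w :=
          fun β hβ => (ZFSet.mem_sep.1 hβ).2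
      revert h1 h3 hE
      generalize ZFSet.sep _ _ = E
      intro h1 h3 hE
      obtain ⟨v, _, w, _, hv, hv', hvw⟩ := hJ (P := fun S v => ∀ β ∈ v 0, ∃ x ∈ S, ∃ y ∈ S,
          ZFSet.pair β x ∈ v 1 ∧ ZFSet.pair β y ∈ v 2 ∧ x ∈ y)
        (.ball <| .ex <| .ex <| .and (.pair_mem _ _ _) <| .and (.pair_mem _ _ _) (.mem _ _))
        ![E, f.1, g.1]
        (by simpa [Fin.forall_fin_succ] using ⟨h1, f.2.1, g.2.1⟩)
        (fun β hβ => by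
          obtain ⟨v, w, hv, hv', hvw⟩ := hE β hβ
          exact ⟨v, (mem_of_pair_mem_of_transitive H_transitive (hM.subset f.2.1) hv).2, w,
            (mem_of_pair_mem_of_transitive H_transitive (hM.subset g.2.1) hv').2,
              hv, hv', hvw⟩) _ h3
      rw [happ f v hv, happ g w hv']
      exact hvw
    -- Sending the class of `f` to the value of `J f` at `κ` turns membership in the ultrapower into
    -- true membership.
    refine Subrelation.wf (r := InvImage (· ∈ ·)
      (Quot.lift (fun f : UltraFun κ M => app (J f.1) (cardSet κ)) hEq)) ?_
      (InvImage.wf _ ZFSet.mem_wf)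
    rintro _ _ ⟨f, g, rfl, rfl, h⟩
    exact hMem f g h

end Embedding
/-! ### The Mostowski collapse -/

/-- The Mostowski collapse of a well-founded relation on a small type. -/
noncomputable def collapse {α : Type*} [Small.{u} α] {r : α → α → Prop} (hr : WellFounded r) :
    α → ZFSet.{u} :=
  hr.fix fun a ih => ZFSet.range fun b : {b // r b a} => ih b.1 b.2

theorem mem_collapse {α : Type*} [Small.{u} α] {r : α → α → Prop} (hr : WellFounded r) {a : α}
    {z : ZFSet.{u}} : z ∈ collapse hr a ↔ ∃ b, r b a ∧ collapse hr b = z := by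
  rw [collapse, hr.fix_eq, ZFSet.mem_range]
  simp only [Subtype.exists, exists_prop]

/-! ### From filters to embeddings -/

section Filter

variable {κ θ : Cardinal.{u}} {M F : ZFSet.{u}}

instance : Small.{u} (UltraFun κ M) :=
  small_of_injective (β := M) (f := fun f : UltraFun κ M => ⟨f.1, f.2.1⟩) fun _ _ h =>
    Subtype.ext (by simpa using h)

section Large

variable (hκ : κ.IsRegular) (hF : IsFilterOn κ F)
include hκ hF

theorem IsFilterOn.exists_mem_and {p q r : ZFSet.{u} → Prop}
    (hp : ZFSet.sep p (cardSet κ) ∈ F) (hq : ZFSet.sep q (cardSet κ) ∈ F)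
    (hr : ZFSet.sep r (cardSet κ) ∈ F) : ∃ β ∈ cardSet κ, p β ∧ q β ∧ r β := by
  have h := hF.2 3 ![_, _, _] (by simpa [Fin.forall_fin_succ] using ⟨hp, hq, hr⟩)
  by_contra! hc
  refine hκ.pos.ne (h.symm.trans ?_).symm
  rw [← ZFSet.card_empty]
  refine congrArg _ ((ZFSet.eq_empty _).2 fun β hβ => ?_)
  obtain ⟨hβκ, hβ⟩ := ZFSet.mem_sep.1 hβ
  exact hc β hβκ (ZFSet.mem_sep.1 (show β ∈ ZFSet.sep p (cardSet κ) from hβ 0)).2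
    (ZFSet.mem_sep.1 (show β ∈ ZFSet.sep q (cardSet κ) from hβ 1)).2
    (ZFSet.mem_sep.1 (show β ∈ ZFSet.sep r (cardSet κ) from hβ 2)).2

end Large

theorem sep_cardSet_eq {A : ZFSet.{u}} (hA : A ⊆ cardSet κ) :
    ZFSet.sep (· ∈ A) (cardSet κ) = A := by
  ext x
  simpa using @hA x

section Normal

theorem IsNormalFor.compl (hF : IsNormalFor κ M F) {p : ZFSet.{u} → Prop}
    (hp : ZFSet.sep p (cardSet κ) ∈ M)
    (h : ZFSet.sep p (cardSet κ) ∉ F) : ZFSet.sep (fun β => ¬ p β) (cardSet κ) ∈ F := by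
  rcases hF.measures _ hp ZFSet.sep_subset with h1 | h1
  · exact absurd h1 h
  · convert h1 using 1
    ext β
    simp only [ZFSet.mem_sdiff, ZFSet.mem_sep]
    tauto

variable (hκ : κ.IsRegular) (hF : IsNormalFor κ M F)
  (hM : IsElementarySubmodel (M : Set ZFSet.{u}) (H θ))

include hκ hF

/-- `F` is not assumed closed under intersections or supersets. It is so for results in `M`:
otherwise the complement of the set given by `r` would be in `F` and miss the intersection of the
other two. -/
theorem IsNormalFor.and {p q r : ZFSet.{u} → Prop} (hr : ZFSet.sep r (cardSet κ) ∈ M)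
    (hp : ZFSet.sep p (cardSet κ) ∈ F) (hq : ZFSet.sep q (cardSet κ) ∈ F)
    (h : ∀ β ∈ cardSet κ, p β → q β → r β) : ZFSet.sep r (cardSet κ) ∈ F := by
  rcases hF.measures _ hr ZFSet.sep_subset with h1 | h1
  · exact h1
  · have h2 : cardSet κ \ ZFSet.sep r (cardSet κ) = ZFSet.sep (fun β => ¬ r β) (cardSet κ) := by
      ext β
      simp only [ZFSet.mem_sdiff, ZFSet.mem_sep]
      tauto
    rw [h2] at h1
    obtain ⟨β, hβ, h3, h4, h5⟩ := hF.isFilterOn.exists_mem_and hκ hp hq h1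
    exact absurd (h β hβ h3 h4) h5

theorem IsNormalFor.mono {p r : ZFSet.{u} → Prop} (hr : ZFSet.sep r (cardSet κ) ∈ M)
    (hp : ZFSet.sep p (cardSet κ) ∈ F) (h : ∀ β ∈ cardSet κ, p β → r β) :
    ZFSet.sep r (cardSet κ) ∈ F :=
  hF.and hκ hr hp hp fun β hβ h1 _ => h β hβ h1

theorem IsNormalFor.exists_and {p q : ZFSet.{u} → Prop}
    (hp : ZFSet.sep p (cardSet κ) ∈ F) (hq : ZFSet.sep q (cardSet κ) ∈ F) :
    ∃ β ∈ cardSet κ, p β ∧ q β := by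
  obtain ⟨β, hβ, h1, h2, -⟩ := hF.isFilterOn.exists_mem_and hκ hp hq hq
  exact ⟨β, hβ, h1, h2⟩

theorem IsNormalFor.of_forall {p : ZFSet.{u} → Prop} (hp : ZFSet.sep p (cardSet κ) ∈ M)
    (h : ∀ β ∈ cardSet κ, p β) : ZFSet.sep p (cardSet κ) ∈ F := by
  by_contra hc
  have h1 := hF.compl hp hc
  obtain ⟨β, hβ, h2, -⟩ := hF.exists_and hκ h1 h1
  exact h2 (h β hβ)

include hM

/-- Otherwise the complement, which is bounded in `κ`, would be in `F` and have size `κ`. -/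
theorem IsNormalFor.tail (hκM : cardSet κ ∈ M) {γ : ZFSet.{u}} (hγ : γ ∈ cardSet κ) (hγM : γ ∈ M) :
    ZFSet.sep (fun β => γ ∈ β) (cardSet κ) ∈ F := by
  by_contra hc
  have h1 := hF.compl (sep_mem_of_elementary hM hκM ![γ] (by simpa using hγM)
    (fun _ v β => v 0 ∈ β) (.mem _ _)) hc
  have h2 := hF.isFilterOn.2 1 (fun _ => ZFSet.sep (fun β => ¬ γ ∈ β) (cardSet κ)) fun _ => h1
  obtain ⟨β, hβ, h3⟩ := exists_mem_of_card_eq hκ.aleph0_le ZFSet.sep_subset h2 γ hγ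
  exact (ZFSet.mem_sep.1 ((ZFSet.mem_sep.1 hβ).2 0)).2 h3

end Normal

section UltraFun

theorem UltraFun.pair_mem_iff (f : UltraFun κ M) {β v : ZFSet.{u}} :
    ZFSet.pair β v ∈ f.1 ↔ β ∈ cardSet κ ∧ v = app f.1 β := by
  obtain ⟨_, _, y, hy⟩ := f
  exact RamseyLike.pair_mem_iff hy

theorem ultraEq_iff {f g : UltraFun κ M} :
    UltraEq F f g ↔ ZFSet.sep (fun β => app f.1 β = app g.1 β) (cardSet κ) ∈ F := by
  rw [UltraEq]
  refine iff_of_eq (congrArg (· ∈ F) ?_)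
  ext β
  simp only [ZFSet.mem_sep, f.pair_mem_iff, g.pair_mem_iff]
  exact and_congr_right fun hβ => ⟨fun ⟨v, h1, h2⟩ => h1.2.symm.trans h2.2,
    fun h => ⟨_, ⟨hβ, rfl⟩, ⟨hβ, h⟩⟩⟩

theorem ultraMemRep_iff {f g : UltraFun κ M} :
    UltraMemRep F f g ↔ ZFSet.sep (fun β => app f.1 β ∈ app g.1 β) (cardSet κ) ∈ F := by
  rw [UltraMemRep]
  refine iff_of_eq (congrArg (· ∈ F) ?_)
  ext β
  simp only [ZFSet.mem_sep, f.pair_mem_iff, g.pair_mem_iff]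
  exact and_congr_right fun hβ => ⟨fun ⟨v, w, h1, h2, h⟩ => h1.2 ▸ h2.2 ▸ h,
    fun h => ⟨_, _, ⟨hβ, rfl⟩, ⟨hβ, rfl⟩, h⟩⟩

variable (hw : IsWeakModel κ M) (hM : IsElementarySubmodel (M : Set ZFSet.{u}) (H θ))
include hM

theorem UltraFun.app_mem_H (hθ : ℵ₀ ≤ θ) (f : UltraFun κ M) (β : ZFSet.{u}) :
    app f.1 β ∈ H θ := by
  rw [app]
  split_ifs with h
  · exact (mem_of_pair_mem_of_transitive H_transitive (hM.subset f.2.1) h.choose_spec).2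
  · exact empty_mem_H hθ

include hw

/-- The language has no terms for function values, so they are introduced by quantifying over tuples
`y` with `(β, y i) ∈ f i`. -/
theorem sep_app_mem (hθ : ℵ₀ ≤ θ) {Γ : Type} [Finite Γ]
    {R : Set ZFSet.{u} → (Γ → ZFSet.{u}) → Prop}
    (hR : Expressible Γ R) (f : Γ → UltraFun κ M) :
    ZFSet.sep (fun β => R (H θ) fun i => app (f i).1 β) (cardSet κ) ∈ M := by
  have h := sep_mem_of_elementary hM hw.cardSet_mem (fun i => (f i).1) (fun i => (f i).2.1)
    (fun S v β => ∃ y : Γ → ZFSet.{u}, (∀ i, y i ∈ S) ∧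
        ((∀ i, ZFSet.pair β (y i) ∈ v i) ∧ R S y))
    (.existsTuple <| .and (.forallIndex fun i => .pair_mem _ _ _) (hR.relabel Sum.inr))
  refine (iff_of_eq (congrArg (· ∈ M) ?_)).2 h
  ext β
  simp only [ZFSet.mem_sep, UltraFun.pair_mem_iff]
  refine and_congr_right fun hβ => ⟨fun h => ⟨_, fun i => (f i).app_mem_H hM hθ β,
    fun i => ⟨hβ, rfl⟩, h⟩, ?_⟩
  rintro ⟨y, _, h1, h2⟩
  rwa [show y = fun i => app (f i).1 β from funext fun i => (h1 i).2] at h2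

/-- A choice function exists in `H(θ)`, and its defining property is expressible from `κ` and the `f
i`, so one exists in `M`. It provides the witnesses in extensionality and in Łoś's theorem. -/
theorem exists_ultraFun_choice (hθ : ℵ₀ ≤ θ) {Γ : Type} [Finite Γ]
    {R : Set ZFSet.{u} → (Γ → ZFSet.{u}) → ZFSet.{u} → Prop}
    (hR : Expressible (Option Γ) fun S w => R S (fun i => w (some i)) (w none))
    (f : Γ → UltraFun κ M) :
    ∃ g : UltraFun κ M, ∀ β ∈ cardSet κ, (∃ x ∈ H θ, R (H θ) (fun i => app (f i).1 β) x) →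
      R (H θ) (fun i => app (f i).1 β) (app g.1 β) := by
  classical
  have hκM := hw.cardSet_mem
  let G : ZFSet.{u} → ZFSet.{u} := fun β =>
    if h : ∃ x ∈ H θ, R (H θ) (fun i => app (f i).1 β) x then h.choose else ∅
  have hG : ∀ β, G β ∈ H θ := by
    intro β
    simp only [G]
    split_ifs with h
    exacts [h.choose_spec.1, empty_mem_H hθ]
  have hgr : ZFSet.IsFunc (cardSet κ) (replacement G (cardSet κ)) (graph G (cardSet κ)) :=
    isFunc_graph fun a ha => mem_replacement.2 ⟨a, ha, rfl⟩
  have hY : replacement G (cardSet κ) ∈ H θ :=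
    replacement_mem_H (hM.subset hκM) fun a _ => hG a
  have hQ : ∀ {Δ : Type} (k : Γ → Δ) (a b : Δ), Expressible.{u} Δ fun S v =>
      ∃ y : Γ → ZFSet.{u}, (∀ i, y i ∈ S) ∧
        ((∀ i, ZFSet.pair (v a) (y i) ∈ v (k i)) ∧ R S y (v b)) :=
    fun k a b => .existsTuple <| .and (.forallIndex fun i => .pair_mem _ _ _)
      (hR.relabel fun o : Option Γ => o.elim (Sum.inl b) Sum.inr)
  have hQ' : ∀ β ∈ cardSet κ, ∀ x, (∃ y : Γ → ZFSet.{u}, (∀ i, y i ∈ H θ) ∧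
      ((∀ i, ZFSet.pair β (y i) ∈ (f i).1) ∧ R (H θ) y x)) ↔
      R (H θ) (fun i => app (f i).1 β) x := by
    intro β hβ x
    refine ⟨?_, fun h => ⟨_, fun i => (f i).app_mem_H hM hθ β,
      fun i => (f i).pair_mem_iff.2 ⟨hβ, rfl⟩, h⟩⟩
    rintro ⟨y, _, h1, h2⟩
    rwa [show y = fun i => app (f i).1 β from
      funext fun i => ((f i).pair_mem_iff.1 (h1 i)).2] at h2
  obtain ⟨g, hg, ⟨Y, _, hgY⟩, h⟩ := hM.exists_mem H_transitive
    (fun o : Option Γ => o.elim (cardSet κ) fun i => (f i).1)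
    (by rintro (_ | i) <;> simp [hκM, (f _).2.1])
    (fun S v g => (∃ Y ∈ S, ZFSet.IsFunc (v none) Y g) ∧ ∀ β ∈ v none,
      (∃ x ∈ S, ∃ y : Γ → ZFSet.{u}, (∀ i, y i ∈ S) ∧
        ((∀ i, ZFSet.pair β (y i) ∈ v (some i)) ∧ R S y x)) →
      ∃ x ∈ S, ZFSet.pair β x ∈ g ∧ ∃ y : Γ → ZFSet.{u}, (∀ i, y i ∈ S) ∧
        ((∀ i, ZFSet.pair β (y i) ∈ v (some i)) ∧ R S y x))
    (.and (.ex (.isFunc _ _ _)) <| .ball <| .imp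
      (.ex (hQ (fun i => some (some (some (some i)))) _ _))
      (.ex <| .and (.pair_mem _ _ _) (hQ (fun i => some (some (some (some i)))) _ _)))
    ⟨graph G (cardSet κ), isFunc_mem_H hθ hgr (hM.subset hκM) (H_transitive _ hY),
      ⟨_, hY, hgr⟩, fun β hβ => by
        rintro ⟨x, hx, h⟩
        have h1 : ∃ x ∈ H θ, R (H θ) (fun i => app (f i).1 β) x := ⟨x, hx, (hQ' β hβ x).1 h⟩
        refine ⟨G β, hG β, pair_mem_graph.2 ⟨hβ, rfl⟩, (hQ' β hβ _).2 ?_⟩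
        simp only [G, dif_pos h1]
        exact h1.choose_spec.2⟩
  refine ⟨⟨g, hg, Y, hgY⟩, fun β hβ => ?_⟩
  rintro ⟨x, hx, hxR⟩
  obtain ⟨z, hz, hzg, h1⟩ := h β hβ ⟨x, hx, (hQ' β hβ x).2 hxR⟩
  rw [← ((pair_mem_iff hgY).1 hzg).2]
  exact (hQ' β hβ z).1 h1

theorem graph_const_mem (hθ : ℵ₀ ≤ θ) {x : ZFSet.{u}} (hx : x ∈ M) :
    graph (fun _ => x) (cardSet κ) ∈ M := by
  have hκM := hw.cardSet_mem
  exact graph_mem_of_elementary hM hθ hκM ![x] (by simpa using hx) (fun _ v _ z => v 0 = z)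
    (.eq _ _) (fun _ _ => hM.subset hx) fun _ _ _ _ => Iff.rfl

/-- The constant function on `κ` with value `x`. -/
noncomputable def constFun (hθ : ℵ₀ ≤ θ) (x : ZFSet.{u}) (hx : x ∈ M) : UltraFun κ M :=
  ⟨graph (fun _ => x) (cardSet κ), graph_const_mem hw hM hθ hx, {x},
    isFunc_graph fun a _ => by simp⟩

theorem app_constFun (hθ : ℵ₀ ≤ θ) {x : ZFSet.{u}} (hx : x ∈ M) {β : ZFSet.{u}}
    (hβ : β ∈ cardSet κ) : app (constFun hw hM hθ x hx).1 β = x := by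
  rw [constFun]
  exact app_graph (f := fun _ => x) hβ

/-- A regressive function is constant on a set in a normal filter. -/
theorem IsNormalFor.exists_eq_const (hκ : κ.IsRegular) (hθ : ℵ₀ ≤ θ) (hF : IsNormalFor κ M F)
    (f : UltraFun κ M) (hf : ZFSet.sep (fun β => app f.1 β ∈ β) (cardSet κ) ∈ F) :
    ∃ δ ∈ cardSet κ, ZFSet.sep (fun β => app f.1 β = δ) (cardSet κ) ∈ F := by
  have hκM := hw.cardSet_mem
  by_contra! hc
  have hpair : ∀ δ, ZFSet.sep (fun β => app f.1 β = δ) (cardSet κ) =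
      ZFSet.sep (fun β => ZFSet.pair β δ ∈ f.1) (cardSet κ) := by
    intro δ
    ext β
    simp only [ZFSet.mem_sep, f.pair_mem_iff]
    tauto
  -- If `f` is constant on no set in `F`, then for every `δ < κ` the set where `f` avoids `δ` is in
  -- `F`. A `β` in the diagonal intersection of these sets cannot have `f β ∈ β`.
  have hGF : ∀ δ ∈ cardSet κ,
      ZFSet.sep (fun β => ZFSet.pair β δ ∉ f.1) (cardSet κ) ∈ F := fun δ hδ => by
    refine hF.compl ?_ (hpair δ ▸ hc δ hδ)
    exact sep_mem_of_elementary hM hκM ![f.1, δ]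
      (by simpa [Fin.forall_fin_two] using ⟨f.2.1, hw.mem_of_mem_cardSet hδ⟩)
      (fun _ v β => ZFSet.pair β (v 1) ∈ v 0) (.pair_mem _ _ _)
  have hGM := graph_sep_mem_of_elementary hM hθ hκM hκM ![f.1] (by simpa using f.2.1)
    (fun _ v δ β => ZFSet.pair β δ ∉ v 0) (.not (.pair_mem _ _ _))
  have hD := hF.diagInter_mem _ hGM (isFunc_graph hGF)
  rw [diagInter] at hD
  obtain ⟨β, hβ, h1, h2⟩ := hF.exists_and hκ hf hD
  have h3 := h2 _ h1 _ (pair_mem_graph.2 ⟨mem_cardSet_of_mem hβ h1, rfl⟩)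
  exact (ZFSet.mem_sep.1 h3).2 (f.pair_mem_iff.2 ⟨hβ, rfl⟩)

end UltraFun

end Filter
-- Extensionality of the ultrapower and Łoś's theorem
section Los

variable {κ θ : Cardinal.{u}} {M F : ZFSet.{u}}

theorem IsGood.wellFounded_rep (hG : IsGood κ M F) :
    WellFounded (UltraMemRep (κ := κ) (M := M) F) :=
  Subrelation.wf (r := InvImage UltraMem (Quot.mk (UltraEq F))) (fun {f g} h => ⟨f, g, rfl, rfl, h⟩)
    (InvImage.wf _ hG.wellFounded)

theorem ultraEq_symm {f g : UltraFun κ M} (h : UltraEq F f g) : UltraEq F g f := by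
  rw [ultraEq_iff] at h ⊢
  simpa only [eq_comm] using h

variable (hκ : κ.IsRegular) (hθ : ℵ₀ ≤ θ) (hw : IsWeakModel κ M)
  (hM : IsElementarySubmodel (M : Set ZFSet.{u}) (H θ)) (hF : IsNormalFor κ M F)
include hκ hθ hw hM hF

theorem ultraMemRep_congr {f f' g g' : UltraFun κ M} (h1 : UltraEq F f f') (h2 : UltraEq F g g')
    (h : UltraMemRep F f g) : UltraMemRep F f' g' := by
  rw [ultraEq_iff] at h1 h2
  rw [ultraMemRep_iff] at h ⊢
  have hM1 := sep_app_mem hw hM hθ (Γ := Fin 2) (R := fun _ y => y 0 ∈ y 1) (.mem _ _) ![f, g']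
  have hM2 := sep_app_mem hw hM hθ (Γ := Fin 2) (R := fun _ y => y 0 ∈ y 1) (.mem _ _) ![f', g']
  have h3 := hF.and hκ hM1 h h2 fun β _ h3 h4 => by
    change app f.1 β ∈ app g'.1 β
    exact h4 ▸ h3
  exact hF.and hκ hM2 h3 h1 fun β _ h3 h4 => h4 ▸ h3

variable (hr : WellFounded (UltraMemRep (κ := κ) (M := M) F))

/-- The collapse is injective modulo `F` because the ultrapower is extensional: if `f` and `g`
differ on a set in `F`, a function in `M` selects, on a set in `F`, elements of one value that lie
outside the other. In both cases the induction hypothesis is applied to a member of `f`. -/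
theorem collapse_eq_iff {f g : UltraFun κ M} :
    collapse hr f = collapse hr g ↔ UltraEq F f g := by
  constructor
  · intro h
    induction f using hr.induction generalizing g with
    | _ f ih =>
      by_contra hne
      rw [ultraEq_iff] at hne
      have hM0 := sep_app_mem hw hM hθ (Γ := Fin 2) (R := fun _ y => y 0 = y 1) (.eq _ _) ![f, g]
      have hne' := hF.compl hM0 hne
      obtain ⟨d, hd⟩ := exists_ultraFun_choice hw hM hθ (Γ := Fin 2)
        (R := fun _ y x => x ∈ y 0 ∧ x ∉ y 1) (.and (.mem _ _) (.not (.mem _ _))) ![f, g]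
      obtain ⟨e, he⟩ := exists_ultraFun_choice hw hM hθ (Γ := Fin 2)
        (R := fun _ y x => x ∈ y 0 ∧ x ∉ y 1) (.and (.mem _ _) (.not (.mem _ _))) ![g, f]
      have hM1 := sep_app_mem hw hM hθ (Γ := Fin 3) (R := fun _ y => y 2 ∈ y 0 ∧ y 2 ∉ y 1)
        (.and (.mem _ _) (.not (.mem _ _))) ![f, g, d]
      have hM2 := sep_app_mem hw hM hθ (Γ := Fin 3) (R := fun _ y => y 2 ∈ y 0 ∧ y 2 ∉ y 1)
        (.and (.mem _ _) (.not (.mem _ _))) ![g, f, e]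
      have hMfd := sep_app_mem hw hM hθ (Γ := Fin 2) (R := fun _ y => y 0 ∈ y 1) (.mem _ _) ![d, f]
      have hMge := sep_app_mem hw hM hθ (Γ := Fin 2) (R := fun _ y => y 0 ∈ y 1) (.mem _ _) ![e, g]
      -- Where `f β ≠ g β` and the choice `d` fails, `f β ⊆ g β`, so `e` succeeds. Hence one of the
      -- two succeeds on a set in `F`.
      by_cases h1 : ZFSet.sep (fun β => app d.1 β ∈ app f.1 β ∧ app d.1 β ∉ app g.1 β)
          (cardSet κ) ∈ F
      · have h2 : UltraMemRep F d f := ultraMemRep_iff.2 (hF.mono hκ hMfd h1 fun _ _ h => h.1)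
        have h3 := (mem_collapse hr).2 ⟨d, h2, rfl⟩
        rw [h] at h3
        obtain ⟨d', hd', h4⟩ := (mem_collapse hr).1 h3
        have h5 := ultraMemRep_iff.1 (ultraMemRep_congr hκ hθ hw hM hF
          (ultraEq_symm (ih d h2 h4.symm))
          (ultraEq_iff.2 (hF.of_forall hκ (sep_app_mem hw hM hθ (Γ := Fin 1)
            (R := fun _ y => y 0 = y 0) (.eq _ _) ![g]) fun _ _ => rfl)) hd')
        obtain ⟨β, _, h6, h7⟩ := hF.exists_and hκ h1 h5
        exact h6.2 h7
      · have h1' := hF.compl hM1 h1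
        have h1'' : ZFSet.sep (fun β => app e.1 β ∈ app g.1 β ∧ app e.1 β ∉ app f.1 β)
            (cardSet κ) ∈ F := by
          refine hF.and hκ hM2 hne' h1' fun β hβ h2 h3 => he β hβ ?_
          by_contra! hc
          refine h2 (ZFSet.ext fun x => ⟨fun hx => ?_, fun hx => ?_⟩)
          · by_contra hxg
            exact h3 (hd β hβ ⟨x, H_transitive _ (f.app_mem_H hM hθ β) x hx, hx, hxg⟩)
          · exact hc x (H_transitive _ (g.app_mem_H hM hθ β) x hx) hx
        have h2 : UltraMemRep F e g := ultraMemRep_iff.2 (hF.mono hκ hMge h1'' fun _ _ h => h.1)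
        have h3 := (mem_collapse hr).2 ⟨e, h2, rfl⟩
        rw [← h] at h3
        obtain ⟨e', he', h4⟩ := (mem_collapse hr).1 h3
        have h5 := ultraMemRep_iff.1 (ultraMemRep_congr hκ hθ hw hM hF
          (ih e' he' h4)
          (ultraEq_iff.2 (hF.of_forall hκ (sep_app_mem hw hM hθ (Γ := Fin 1)
            (R := fun _ y => y 0 = y 0) (.eq _ _) ![f]) fun _ _ => rfl)) he')
        obtain ⟨β, _, h6, h7⟩ := hF.exists_and hκ h1'' h5
        exact h6.2 h7
  · intro h
    have hrefl : ∀ h : UltraFun κ M, UltraEq F h h := fun h =>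
      ultraEq_iff.2 (hF.of_forall hκ (sep_app_mem hw hM hθ (Γ := Fin 1)
        (R := fun _ y => y 0 = y 0) (.eq _ _) ![h]) fun _ _ => rfl)
    ext z
    rw [mem_collapse, mem_collapse]
    refine exists_congr fun d => and_congr_left fun _ => ?_
    exact ⟨ultraMemRep_congr hκ hθ hw hM hF (hrefl d) h,
      ultraMemRep_congr hκ hθ hw hM hF (hrefl d) (ultraEq_symm h)⟩

theorem collapse_mem_iff {f g : UltraFun κ M} :
    collapse hr f ∈ collapse hr g ↔ UltraMemRep F f g := by
  rw [mem_collapse]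
  constructor
  · rintro ⟨d, hd, h⟩
    have hrefl : UltraEq F g g :=
      ultraEq_iff.2 (hF.of_forall hκ (sep_app_mem hw hM hθ (Γ := Fin 1)
        (R := fun _ y => y 0 = y 0) (.eq _ _) ![g]) fun _ _ => rfl)
    exact ultraMemRep_congr hκ hθ hw hM hF ((collapse_eq_iff hκ hθ hw hM hF hr).1 h) hrefl hd
  · exact fun h => ⟨f, h, rfl⟩

omit hκ hθ hw hM hF in
theorem mem_range_collapse (f : UltraFun κ M) :
    collapse hr f ∈ (ZFSet.range (collapse hr) : Set ZFSet.{u}) :=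
  ZFSet.mem_range_self f

/-- Łoś's theorem for the collapsed ultrapower. -/
theorem realize_collapse_iff {m n : ℕ} (φ : LSet.BoundedFormula (Fin m) n)
    (v : Fin m → UltraFun κ M) (xs : Fin n → UltraFun κ M) :
    φ.Realize (M := (ZFSet.range (collapse hr) : Set ZFSet.{u}))
      (fun i => ⟨collapse hr (v i), mem_range_collapse hr _⟩)
      (fun i => ⟨collapse hr (xs i), mem_range_collapse hr _⟩) ↔
    ZFSet.sep (fun β => φ.Realize (M := H θ)
      (fun i => ⟨app (v i).1 β, (v i).app_mem_H hM hθ β⟩)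
      (fun i => ⟨app (xs i).1 β, (xs i).app_mem_H hM hθ β⟩)) (cardSet κ) ∈ F := by
  -- Truth in `H(θ)` makes the set of good coordinates definable from functions in `M`, so `F`
  -- measures it.
  have hdef : ∀ {n : ℕ} (φ : LSet.BoundedFormula (Fin m) n) (xs : Fin n → UltraFun κ M),
      ZFSet.sep (fun β => φ.Realize (M := H θ)
      (fun i => ⟨app (v i).1 β, (v i).app_mem_H hM hθ β⟩)
      (fun i => ⟨app (xs i).1 β, (xs i).app_mem_H hM hθ β⟩)) (cardSet κ) ∈ M := by
    intro n φ xs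
    have h := sep_app_mem hw hM hθ (Expressible.sat φ.toFormula id) (Sum.elim v xs)
    have heq : ∀ β, Sat (H θ) φ.toFormula (fun d => app (Sum.elim v xs (id d)).1 β) ↔
        φ.Realize (M := H θ) (fun i => ⟨app (v i).1 β, (v i).app_mem_H hM hθ β⟩)
          (fun i => ⟨app (xs i).1 β, (xs i).app_mem_H hM hθ β⟩) := fun β => by
      refine (sat_coe (S := H θ)
        fun d => ⟨app (Sum.elim v xs d).1 β, UltraFun.app_mem_H hM hθ _ β⟩).trans ?_
      exact BoundedFormula.realize_toFormula _ _
    simpa only [heq] using h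
  have hterm : ∀ {n : ℕ} (t : LSet.Term (Fin m ⊕ Fin n)), ∃ i, t = Term.var i := by
    rintro n (i | ⟨f, _⟩)
    exacts [⟨i, rfl⟩, f.elim]
  have hvar : ∀ {n : ℕ} (xs : Fin n → UltraFun κ M) (i : Fin m ⊕ Fin n),
      (Sum.elim (fun i => (⟨collapse hr (v i), mem_range_collapse hr _⟩ :
          (ZFSet.range (collapse hr) : Set ZFSet.{u})))
        (fun i => ⟨collapse hr (xs i), mem_range_collapse hr _⟩) i).1 =
        collapse hr (Sum.elim v xs i) := by
    rintro n xs (i | i) <;> rfl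
  have hvar' : ∀ {n : ℕ} (xs : Fin n → UltraFun κ M) (β : ZFSet.{u}) (i : Fin m ⊕ Fin n),
      (Sum.elim (fun i => (⟨app (v i).1 β, (v i).app_mem_H hM hθ β⟩ : H θ))
        (fun i => ⟨app (xs i).1 β, (xs i).app_mem_H hM hθ β⟩) i).1 =
        app (Sum.elim v xs i).1 β := by
    rintro n xs β (i | i) <;> rfl
  induction φ with
  | falsum =>
    refine iff_of_false id fun h => ?_
    obtain ⟨_, _, h1, -⟩ := hF.exists_and hκ h h
    exact h1
  | @equal n t₁ t₂ =>
    obtain ⟨i, rfl⟩ := hterm t₁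
    obtain ⟨j, rfl⟩ := hterm t₂
    simp only [BoundedFormula.Realize, Term.realize_var, Subtype.ext_iff, hvar, hvar']
    rw [collapse_eq_iff hκ hθ hw hM hF hr, ultraEq_iff]
  | @rel n k R ts =>
    cases R with
    | mem =>
      obtain ⟨i, hi⟩ := hterm (ts 0)
      obtain ⟨j, hj⟩ := hterm (ts 1)
      simp only [BoundedFormula.Realize, Structure.RelMap, hi, hj, Term.realize_var, hvar, hvar']
      rw [collapse_mem_iff hκ hθ hw hM hF hr, ultraMemRep_iff]
  | @imp n φ ψ ihφ ihψ =>
    simp only [BoundedFormula.realize_imp]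
    refine (imp_congr (ihφ xs) (ihψ xs)).trans ?_
    have h1 := hdef (φ.imp ψ) xs
    simp only [BoundedFormula.realize_imp] at h1
    constructor
    · intro h
      by_contra hc
      have h2 := hF.compl h1 hc
      have h3 := h (hF.mono hκ (hdef φ xs) h2 fun β _ h => by tauto)
      obtain ⟨β, _, h4, h5⟩ := hF.exists_and hκ h2 h3
      exact h4 fun _ => h5
    · intro h h2
      exact hF.and hκ (hdef ψ xs) h h2 fun β _ h3 h4 => h3 h4
  | @all n φ ih =>
    have hsnoc : ∀ (g : UltraFun κ M) (β : ZFSet.{u}),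
        (fun i : Fin (n + 1) => (⟨app ((Fin.snoc xs g : Fin (n + 1) → UltraFun κ M) i).1 β,
          UltraFun.app_mem_H hM hθ _ β⟩ : H θ)) =
        Fin.snoc (fun i => ⟨app (xs i).1 β, (xs i).app_mem_H hM hθ β⟩)
          ⟨app g.1 β, g.app_mem_H hM hθ β⟩ := by
      intro g β
      funext i
      refine Fin.lastCases ?_ (fun i => ?_) i <;> simp
    have hsnoc' : ∀ (g : UltraFun κ M),
        (fun i : Fin (n + 1) => (⟨collapse hr ((Fin.snoc xs g : Fin (n + 1) → UltraFun κ M) i),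
          mem_range_collapse hr _⟩ : (ZFSet.range (collapse hr) : Set ZFSet.{u}))) =
        Fin.snoc (fun i => ⟨collapse hr (xs i), mem_range_collapse hr _⟩)
          ⟨collapse hr g, mem_range_collapse hr _⟩ := by
      intro g
      funext i
      refine Fin.lastCases ?_ (fun i => ?_) i <;> simp
    have ih' := fun g => ih (Fin.snoc xs g)
    have hd' := fun g => hdef φ (Fin.snoc xs g)
    simp only [hsnoc, hsnoc'] at ih' hd'
    have h1 := hdef φ.all xs
    simp only [BoundedFormula.realize_all] at h1 ⊢
    constructor
    · intro h
      by_contra hc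
      have h2 := hF.compl h1 hc
      -- `d` sends the variable bound last to `none`, the slot of the counterexample that `g` will
      -- choose wherever one exists.
      let d : Fin m ⊕ Fin (n + 1) → Option (Fin m ⊕ Fin n) :=
        Sum.elim (fun i => some (.inl i)) (Fin.snoc (fun i => some (.inr i)) none)
      obtain ⟨g, hg⟩ := exists_ultraFun_choice hw hM hθ (Γ := Fin m ⊕ Fin n)
        (R := fun S y x => ¬ Sat S φ.toFormula fun i => (d i).elim x y)
        (.not <| (Expressible.sat φ.toFormula d).congr fun S _ w _ =>
          iff_of_eq (congrArg _ (funext fun i => by cases d i <;> simp))) (Sum.elim v xs)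
      have hsat : ∀ β (x : H θ), Sat (H θ) φ.toFormula
          (fun i => (d i).elim x.1 fun i => app (Sum.elim v xs i).1 β) ↔
          φ.Realize (M := H θ) (fun i => ⟨app (v i).1 β, (v i).app_mem_H hM hθ β⟩)
            (Fin.snoc (fun i => ⟨app (xs i).1 β, (xs i).app_mem_H hM hθ β⟩) x) := by
        intro β x
        have h3 : (fun i => (d i).elim x.1 fun i => app (Sum.elim v xs i).1 β) =
            fun i => ((Sum.elim (fun i => ⟨app (v i).1 β, (v i).app_mem_H hM hθ β⟩)
            (Fin.snoc (fun i => ⟨app (xs i).1 β, (xs i).app_mem_H hM hθ β⟩) x) :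
              Fin m ⊕ Fin (n + 1) → H θ) i).1 := by
          funext i
          rcases i with i | i
          · rfl
          · refine Fin.lastCases ?_ (fun i => ?_) i <;> simp [d]
        rw [h3, sat_coe, BoundedFormula.realize_toFormula]
        rfl
      have h3 := (ih' g).1 (h _)
      obtain ⟨β, hβ, h4, h5⟩ := hF.exists_and hκ h2 h3
      push Not at h4
      obtain ⟨x, hx⟩ := h4
      refine hg β hβ ⟨x.1, x.2, fun h => hx ((hsat β x).1 h)⟩ ?_
      exact (hsat β ⟨app g.1 β, g.app_mem_H hM hθ β⟩).2 h5
    · rintro h ⟨a, ha⟩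
      obtain ⟨g, rfl⟩ := ZFSet.mem_range.1 ha
      exact (ih' g).2 (hF.mono hκ (hd' g) h fun β _ h => h _)

end Los
-- The embedding into the collapsed ultrapower
section Ultrapower

variable {κ θ : Cardinal.{u}} {M F : ZFSet.{u}}

variable (hκ : κ.IsRegular) (hθ : ℵ₀ ≤ θ) (hw : IsWeakModel κ M)
  (hM : IsElementarySubmodel (M : Set ZFSet.{u}) (H θ)) (hF : IsNormalFor κ M F)
  (hr : WellFounded (UltraMemRep (κ := κ) (M := M) F))
section
include hθ hw hM

theorem constFun_memRep_iff {x : ZFSet.{u}} (hx : x ∈ M) {f : UltraFun κ M} :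
    UltraMemRep F (constFun hw hM hθ x hx) f ↔
      ZFSet.sep (fun β => x ∈ app f.1 β) (cardSet κ) ∈ F := by
  rw [ultraMemRep_iff]
  have : ZFSet.sep (fun β => app (constFun hw hM hθ x hx).1 β ∈ app f.1 β) (cardSet κ) =
      ZFSet.sep (fun β => x ∈ app f.1 β) (cardSet κ) := by
    ext β
    simp only [ZFSet.mem_sep]
    exact and_congr_right fun hβ => by rw [app_constFun hw hM hθ hx hβ]
  rw [this]

theorem sep_mem_app_mem {x : ZFSet.{u}} (hx : x ∈ M) (f : UltraFun κ M) :
    ZFSet.sep (fun β => x ∈ app f.1 β) (cardSet κ) ∈ M := by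
  have hM1 := sep_app_mem hw hM hθ (Γ := Fin 2) (R := fun _ y => y 0 ∈ y 1) (.mem _ _)
    ![constFun hw hM hθ x hx, f]
  have : ZFSet.sep (fun β => app (constFun hw hM hθ x hx).1 β ∈ app f.1 β) (cardSet κ) =
      ZFSet.sep (fun β => x ∈ app f.1 β) (cardSet κ) := by
    ext β
    simp only [ZFSet.mem_sep]
    exact and_congr_right fun hβ => by rw [app_constFun hw hM hθ hx hβ]
  rw [← this]
  exact hM1

theorem sep_app_mem_self_mem (f : UltraFun κ M) :
    ZFSet.sep (fun β => app f.1 β ∈ β) (cardSet κ) ∈ M := by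
  have := sep_mem_of_elementary hM hw.cardSet_mem ![f.1] (by simpa using f.2.1)
    (fun S v β => ∃ y ∈ S, ZFSet.pair β y ∈ v 0 ∧ y ∈ β)
    (.ex <| .and (.pair_mem _ _ _) (.mem _ _))
  have h1 : ZFSet.sep (fun β => app f.1 β ∈ β) (cardSet κ) =
      ZFSet.sep (fun β => ∃ y ∈ H θ, ZFSet.pair β y ∈ f.1 ∧ y ∈ β) (cardSet κ) := by
    ext β
    simp only [ZFSet.mem_sep, f.pair_mem_iff]
    refine and_congr_right fun hβ => ⟨fun h => ⟨_, f.app_mem_H hM hθ β, ⟨hβ, rfl⟩, h⟩, ?_⟩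
    rintro ⟨y, _, ⟨_, rfl⟩, h⟩
    exact h
  rw [h1]
  exact this

end

include hκ hθ hw hM hF

theorem exists_ultraEq_constFun {f : UltraFun κ M}
    (hf : ZFSet.sep (fun β => app f.1 β ∈ β) (cardSet κ) ∈ F) :
    ∃ δ, ∃ hδ : δ ∈ cardSet κ, ZFSet.sep (fun β => app f.1 β = δ) (cardSet κ) ∈ F ∧
      UltraEq F f (constFun hw hM hθ δ (hw.mem_of_mem_cardSet hδ)) := by
  obtain ⟨δ, hδ, h⟩ := hF.exists_eq_const hw hM hκ hθ f hf
  refine ⟨δ, hδ, h, ultraEq_iff.2 ?_⟩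
  have hM1 := sep_app_mem hw hM hθ (Γ := Fin 2) (R := fun _ y => y 0 = y 1) (.eq _ _)
    ![f, constFun hw hM hθ δ (hw.mem_of_mem_cardSet hδ)]
  exact hF.mono hκ hM1 h fun β hβ h1 => h1.trans (app_constFun hw hM hθ _ hβ).symm

/-- A function with values in `γ` on a set in `F` is regressive on a tail of it, hence by normality
constant modulo `F` with value some `δ ∈ γ`; then induct on `γ`. -/
theorem collapse_constFun {γ : ZFSet.{u}} (hγ : γ ∈ cardSet κ) :
    collapse hr (constFun hw hM hθ γ (hw.mem_of_mem_cardSet hγ)) = γ := by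
  induction γ using ZFSet.inductionOn with
  | _ γ ih =>
    have hκM := hw.cardSet_mem
    have hγM := hw.mem_of_mem_cardSet hγ
    ext z
    rw [mem_collapse]
    constructor
    · rintro ⟨f, hf, rfl⟩
      rw [ultraMemRep_iff] at hf
      have htail := hF.tail hκ hM hκM hγ hγM
      have hreg := hF.and hκ (sep_app_mem_self_mem hθ hw hM f) hf htail fun β hβ h1 h2 => by
        rw [app_constFun hw hM hθ hγM hβ] at h1
        exact (isOrdinal_of_mem_cardSet hβ).mem_trans h1 h2
      obtain ⟨δ, hδ, h1, h2⟩ := exists_ultraEq_constFun hκ hθ hw hM hF hreg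
      rw [(collapse_eq_iff hκ hθ hw hM hF hr).2 h2]
      obtain ⟨β, hβ, h3, h4⟩ := hF.exists_and hκ hf h1
      rw [app_constFun hw hM hθ hγM hβ] at h3
      have h5 : δ ∈ γ := h4 ▸ h3
      rwa [ih δ h5 hδ]
    · intro hz
      have hzκ := mem_cardSet_of_mem hγ hz
      refine ⟨_, ?_, ih z hz hzκ⟩
      rw [constFun_memRep_iff hθ hw hM]
      refine hF.of_forall hκ (sep_mem_app_mem hθ hw hM (hw.mem_of_mem_cardSet hzκ) _)
        fun β hβ => ?_
      rwa [app_constFun hw hM hθ hγM hβ]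

/-- `A` is represented by `β ↦ A ∩ β`: a function below it is regressive, hence constant modulo `F`,
and its value is in `A`. -/
theorem mem_range_collapse_of_subset {A : ZFSet.{u}} (hA : A ⊆ cardSet κ) (hAM : A ∈ M) :
    A ∈ ZFSet.range (collapse hr) := by
  have hκM := hw.cardSet_mem
  have hgM : graph (fun β => ZFSet.sep (fun x => x ∈ A ∧ x ∈ β) (cardSet κ)) (cardSet κ) ∈ M :=
    graph_sep_mem_of_elementary hM hθ hκM hκM ![A] (by simpa using hAM)
      (fun _ v β x => x ∈ v 0 ∧ x ∈ β) (.and (.mem _ _) (.mem _ _))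
  let g : UltraFun κ M := ⟨_, hgM, (cardSet κ).powerset,
    isFunc_graph (f := fun β => ZFSet.sep (fun x => x ∈ A ∧ x ∈ β) (cardSet κ))
      fun _ _ => ZFSet.mem_powerset.2 ZFSet.sep_subset⟩
  have hg : ∀ β ∈ cardSet κ, ∀ x, x ∈ app g.1 β ↔ x ∈ cardSet κ ∧ x ∈ A ∧ x ∈ β := by
    intro β hβ x
    have h1 : app g.1 β = ZFSet.sep (fun x => x ∈ A ∧ x ∈ β) (cardSet κ) :=
      app_graph (f := fun β => ZFSet.sep (fun x => x ∈ A ∧ x ∈ β) (cardSet κ)) hβ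
    rw [h1, ZFSet.mem_sep]
  refine ZFSet.mem_range.2 ⟨g, ?_⟩
  ext z
  rw [mem_collapse]
  constructor
  · rintro ⟨f, hf, rfl⟩
    rw [ultraMemRep_iff] at hf
    have hreg := hF.mono hκ (sep_app_mem_self_mem hθ hw hM f) hf
      fun β hβ h1 => ((hg β hβ _).1 h1).2.2
    obtain ⟨δ, hδ, h1, h2⟩ := exists_ultraEq_constFun hκ hθ hw hM hF hreg
    rw [(collapse_eq_iff hκ hθ hw hM hF hr).2 h2, collapse_constFun hκ hθ hw hM hF hr hδ]
    obtain ⟨β, hβ, h3, h4⟩ := hF.exists_and hκ hf h1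
    exact h4 ▸ ((hg β hβ _).1 h3).2.1
  · intro hz
    have hzM := hw.mem_of_mem_cardSet (hA hz)
    refine ⟨_, ?_, collapse_constFun hκ hθ hw hM hF hr (hA hz)⟩
    rw [constFun_memRep_iff hθ hw hM]
    exact hF.mono hκ (sep_mem_app_mem hθ hw hM hzM _) (hF.tail hκ hM hκM (hA hz) hzM)
      fun β hβ h => (hg β hβ z).2 ⟨hA hz, hz, h⟩

/-- If `f` represents `A`, then `γ ∈ A` iff `S γ = {β | γ ∈ f β}` is in `F`. The family of all `S γ`
has size at most `κ` in `M`, so weak amenability puts its trace on `F`, and with it `A`, into `M`.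
-/
theorem mem_of_mem_range_collapse (hwa : WeaklyAmenable κ M F) {A : ZFSet.{u}}
    (hA : A ⊆ cardSet κ) (hAN : A ∈ ZFSet.range (collapse hr)) : A ∈ M := by
  have hκM := hw.cardSet_mem
  obtain ⟨f, rfl⟩ := ZFSet.mem_range.1 hAN
  let S : ZFSet.{u} → ZFSet.{u} := fun γ =>
    ZFSet.sep (fun β => ∃ y ∈ H θ, ZFSet.pair β y ∈ f.1 ∧ γ ∈ y) (cardSet κ)
  have hS : ∀ γ, S γ = ZFSet.sep (fun β => γ ∈ app f.1 β) (cardSet κ) := by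
    intro γ
    ext β
    simp only [S, ZFSet.mem_sep, f.pair_mem_iff]
    refine and_congr_right fun hβ => ⟨?_, fun h => ⟨_, f.app_mem_H hM hθ β, ⟨hβ, rfl⟩, h⟩⟩
    rintro ⟨y, _, ⟨_, rfl⟩, h⟩
    exact h
  have hSH : ∀ γ, S γ ∈ H θ := fun γ => mem_H_of_subset (hM.subset hκM) ZFSet.sep_subset
  have hX : graph S (cardSet κ) ∈ M := graph_sep_mem_of_elementary hM hθ hκM hκM ![f.1]
    (by simpa using f.2.1) (fun S v γ β => ∃ y ∈ S, ZFSet.pair β y ∈ v 0 ∧ γ ∈ y)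
    (.ex <| .and (.pair_mem _ _ _) (.mem _ _))
  have hRH : replacement S (cardSet κ) ∈ H θ :=
    replacement_mem_H (hM.subset hκM) fun a _ => hSH a
  have hR : replacement S (cardSet κ) ∈ M := by
    refine hM.mem_of_unique H_transitive ![cardSet κ, graph S (cardSet κ)]
      (by simpa [Fin.forall_fin_two] using ⟨hκM, hX⟩)
      (fun T v R => ∀ Z ∈ T, Z ∈ R ↔ ∃ γ ∈ v 0, ZFSet.pair γ Z ∈ v 1)
      (.all <| .iff (.mem _ _) <| .bex (.pair_mem _ _ _)) hRH ?_ ?_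
    · intro Z _
      change _ ↔ ∃ γ ∈ cardSet κ, ZFSet.pair γ Z ∈ graph S (cardSet κ)
      rw [mem_replacement]
      exact exists_congr fun γ => and_congr_right fun hγ => by
        rw [pair_mem_graph]
        simp [hγ]
    · intro R hRH' h
      have h' : ∀ Z ∈ H θ, Z ∈ R ↔ Z ∈ replacement S (cardSet κ) := by
        intro Z hZ
        refine (h Z hZ).trans ?_
        change (∃ γ ∈ cardSet κ, ZFSet.pair γ Z ∈ graph S (cardSet κ)) ↔ _
        rw [mem_replacement]
        exact exists_congr fun γ => and_congr_right fun hγ => by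
          rw [pair_mem_graph]
          simp [hγ]
      ext Z
      exact ⟨fun hZ => (h' Z (H_transitive _ hRH' Z hZ)).1 hZ,
        fun hZ => (h' Z (H_transitive _ hRH Z hZ)).2 hZ⟩
  -- Choosing an index for each set in the family gives an injection in `H(θ)`; elementarity finds
  -- one in `M`.
  have hinj : ∃ h ∈ M, ZFSet.IsFunc (replacement S (cardSet κ)) (cardSet κ) h ∧
      ∀ a ∈ H θ, ∀ b ∈ H θ, ∀ c ∈ H θ, ZFSet.pair a c ∈ h → ZFSet.pair b c ∈ h → a = b := by
    refine hM.exists_mem H_transitive ![replacement S (cardSet κ), cardSet κ]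
      (by simpa [Fin.forall_fin_two] using ⟨hR, hκM⟩)
      (fun T v h => ZFSet.IsFunc (v 0) (v 1) h ∧ ∀ a ∈ T, ∀ b ∈ T, ∀ c ∈ T,
        ZFSet.pair a c ∈ h → ZFSet.pair b c ∈ h → a = b)
      (.and (.isFunc _ _ _) <| .all <| .all <| .all <| .imp (.pair_mem _ _ _) <|
        .imp (.pair_mem _ _ _) (.eq _ _)) ?_
    have hex : ∀ Z ∈ replacement S (cardSet κ), ∃ γ ∈ cardSet κ, S γ = Z :=
      fun Z hZ => mem_replacement.1 hZ
    choose! h hh using hex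
    refine ⟨graph h (replacement S (cardSet κ)),
      isFunc_mem_H hθ (isFunc_graph fun Z hZ => (hh Z hZ).1)
      hRH (H_transitive _ (hM.subset hκM)), isFunc_graph fun Z hZ => (hh Z hZ).1, ?_⟩
    intro a _ b _ c _ ha hb
    obtain ⟨ha', rfl⟩ := pair_mem_graph.1 ha
    obtain ⟨hb', h1⟩ := pair_mem_graph.1 hb
    rw [← (hh a ha').2, ← (hh b hb').2, h1]
  obtain ⟨h, hh, hfun, hinj⟩ := hinj
  have hFR := hwa _ hR ⟨h, hh, hfun, fun a b c ha hb => by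
    have h1 := mem_of_pair_mem_of_transitive H_transitive (hM.subset hh) ha
    have h2 := mem_of_pair_mem_of_transitive H_transitive (hM.subset hh) hb
    exact hinj a h1.1 b h2.1 c h1.2 ha hb⟩
  have hfin := sep_mem_of_elementary hM hκM ![F ∩ replacement S (cardSet κ), graph S (cardSet κ)]
    (by simpa [Fin.forall_fin_two] using ⟨hFR, hX⟩)
    (fun _ v γ => ∃ Z ∈ v 0, ZFSet.pair γ Z ∈ v 1) (.bex (.pair_mem _ _ _))
  have heq : collapse hr f = ZFSet.sep (fun γ => ∃ Z ∈ F ∩ replacement S (cardSet κ),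
      ZFSet.pair γ Z ∈ graph S (cardSet κ)) (cardSet κ) := by
    ext γ
    rw [ZFSet.mem_sep]
    have key : ∀ hγ : γ ∈ cardSet κ, γ ∈ collapse hr f ↔ S γ ∈ F := fun hγ => by
      conv_lhs => rw [← collapse_constFun hκ hθ hw hM hF hr hγ]
      rw [collapse_mem_iff hκ hθ hw hM hF hr, constFun_memRep_iff hθ hw hM, hS]
    constructor
    · intro h1
      exact ⟨hA h1, S γ, ZFSet.mem_inter.2 ⟨(key (hA h1)).1 h1, mem_replacement.2 ⟨γ, hA h1, rfl⟩⟩,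
        pair_mem_graph.2 ⟨hA h1, rfl⟩⟩
    · rintro ⟨hγ, Z, hZ, h1⟩
      obtain ⟨-, rfl⟩ := pair_mem_graph.1 h1
      exact (key hγ).2 (ZFSet.mem_inter.1 hZ).1
  rw [heq]
  exact hfin

omit hF in
theorem hasPowersetPreservingEmbedding_of_isGood (hG : IsGood κ M F) :
    HasPowersetPreservingEmbedding κ M := by
  have hr := hG.wellFounded_rep
  have hF := hG.isNormalFor
  have hκM := hw.cardSet_mem
  have hN : (ZFSet.range (collapse hr)).IsTransitive := by
    intro y hy z hz
    obtain ⟨f, rfl⟩ := ZFSet.mem_range.1 hy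
    obtain ⟨g, _, rfl⟩ := (mem_collapse hr).1 hz
    exact ZFSet.mem_range_self g
  let J : ↥(M : Set ZFSet.{u}) → ↥(ZFSet.range (collapse hr) : Set ZFSet.{u}) := fun x =>
    ⟨collapse hr (constFun hw hM hθ x.1 x.2), mem_range_collapse hr _⟩
  have hJ : ∀ ⦃n : ℕ⦄ (φ : LSet.Formula (Fin n)) (x : Fin n → (M : Set ZFSet.{u})),
      φ.Realize (J ∘ x) ↔ φ.Realize x := by
    intro n φ x
    have h := realize_collapse_iff hκ hθ hw hM hF hr φ
      (fun i => constFun hw hM hθ (x i).1 (x i).2) (fun i : Fin 0 => i.elim0)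
    rw [hM.realize_iff φ x]
    have h1 : ∀ β ∈ cardSet κ, (BoundedFormula.Realize (M := H θ) φ
        (fun i => ⟨app (constFun hw hM hθ (x i).1 (x i).2).1 β, UltraFun.app_mem_H hM hθ _ β⟩)
        (fun i : Fin 0 => i.elim0) ↔
        φ.Realize fun i => (⟨(x i).1, hM.subset (x i).2⟩ : H θ)) := by
      intro β hβ
      rw [Formula.Realize]
      refine iff_of_eq (congrArg₂ _ (funext fun i => Subtype.ext ?_) (funext fun i => i.elim0))
      exact app_constFun hw hM hθ (x i).2 hβ
    have h2 : φ.Realize (J ∘ x) ↔ BoundedFormula.Realize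
        (M := (ZFSet.range (collapse hr) : Set ZFSet.{u})) φ
        (fun i => ⟨collapse hr (constFun hw hM hθ (x i).1 (x i).2), mem_range_collapse hr _⟩)
        (fun i : Fin 0 => ⟨collapse hr (i.elim0 : UltraFun κ M), mem_range_collapse hr _⟩) := by
      rw [Formula.Realize]
      exact iff_of_eq (congrArg₂ _ rfl (funext fun i => i.elim0))
    refine h2.trans (Iff.trans ?_ (Iff.trans h ?_))
    · exact iff_of_eq (congrArg₂ _ rfl (funext fun i => i.elim0))
    constructor
    · intro h3
      obtain ⟨β, hβ, h4, -⟩ := hF.exists_and hκ h3 h3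
      refine (h1 β hβ).1 ?_
      convert h4 using 2
    · intro h3
      have h4 : ZFSet.sep (fun _ => True) (cardSet κ) = cardSet κ := by
        ext
        simp
      have h5 : ZFSet.sep (fun _ => True) (cardSet κ) ∈ F :=
        hF.of_forall hκ (by rwa [h4]) fun _ _ => trivial
      convert h5 using 1
      ext β
      simp only [ZFSet.mem_sep, and_true]
      refine ⟨fun h => h.1, fun hβ => ⟨hβ, ?_⟩⟩
      convert (h1 β hβ).2 h3 using 2
  refine ⟨_, hN, ⟨J, hJ⟩, fun x hx => collapse_constFun hκ hθ hw hM hF hr hx, ?_, fun A hA =>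
    ⟨mem_range_collapse_of_subset hκ hθ hw hM hF hr hA,
      mem_of_mem_range_collapse hκ hθ hw hM hF hr hG.weaklyAmenable hA⟩⟩
  rintro ⟨x, hx⟩ rfl h
  change collapse hr (constFun hw hM hθ (cardSet κ) hx) = cardSet κ at h
  -- The identity function lies below the constant function `κ`. Were `κ` fixed, the identity would
  -- collapse to an ordinal below `κ` and be constant on a set in `F`, against `IsNormalFor.tail`.
  have hidM : graph (fun β => β) (cardSet κ) ∈ M :=
    graph_mem_of_elementary hM hθ hκM ![] (by simp) (fun _ _ a z => a = z) (.eq _ _)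
      (fun a ha => H_transitive _ (hM.subset hκM) a ha) fun _ _ _ _ => Iff.rfl
  let d : UltraFun κ M := ⟨_, hidM, cardSet κ, isFunc_graph fun _ ha => ha⟩
  have hd : ∀ β ∈ cardSet κ, app d.1 β = β := fun β hβ => app_graph (f := fun β => β) hβ
  have h1 : UltraMemRep F d (constFun hw hM hθ (cardSet κ) hx) := by
    rw [ultraMemRep_iff]
    refine hF.of_forall hκ (sep_app_mem hw hM hθ (Γ := Fin 2) (R := fun _ y => y 0 ∈ y 1)
      (.mem _ _) ![d, constFun hw hM hθ (cardSet κ) hx]) fun β hβ => ?_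
    rwa [hd β hβ, app_constFun hw hM hθ hx hβ]
  have h2 := (collapse_mem_iff hκ hθ hw hM hF hr).2 h1
  rw [h] at h2
  have h3 := collapse_constFun hκ hθ hw hM hF hr h2
  rw [collapse_eq_iff hκ hθ hw hM hF hr, ultraEq_iff] at h3
  obtain ⟨β, hβ, h4, h5⟩ := hF.exists_and hκ h3
    (hF.tail hκ hM hκM h2 (hw.mem_of_mem_cardSet h2))
  rw [hd β hβ, app_constFun hw hM hθ _ hβ] at h4
  rw [h4] at h5
  exact ZFSet.mem_irrefl _ h5

end Ultrapower

/-- For elementary submodels of `H(θ)`, powerset preserving embeddings and good filters are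
equivalent. -/
theorem embeddingWitness_iff_filterWitness {α κ θ : Cardinal.{u}} (hκ : κ.IsRegular) (hθ : ℵ₀ ≤ θ)
    (A : ZFSet.{u}) : EmbeddingWitness α κ θ A ↔ FilterWitness α κ θ A := by
  refine exists_congr fun M => and_congr_right fun hw => and_congr_right fun hM =>
    and_congr_right fun _ => and_congr_right fun _ =>
      ⟨exists_isGood_of_embedding hκ hw hM, ?_⟩
  rintro ⟨F, hF⟩
  exact hasPowersetPreservingEmbedding_of_isGood hκ hθ hw hM hF

/-! ### Good filters inside a transitive structure -/

/-- A first-order description, in the transitive structure `S`, of a good filter `F` that is a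
subset of the set `M`, on the cardinal `K`. -/
def GoodCore (S : Set ZFSet.{u}) (K M F : ZFSet.{u}) : Prop :=
  F ⊆ M ∧ (∀ A ∈ F, A ⊆ K) ∧
  (∀ A ∈ F, ∀ B ∈ F, ∃ C ∈ F, C ⊆ A ∧ C ⊆ B) ∧
  (∀ A ∈ F, ∀ γ ∈ K, ∃ β ∈ A, γ ∈ β) ∧
  (∀ A ∈ M, A ⊆ K → A ∈ F ∨ ∃ B ∈ F, ∀ β ∈ K, β ∈ B ↔ ¬ β ∈ A) ∧
  (∀ X ∈ M, ZFSet.IsFunc K F X →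
    ∃ D ∈ F, ∀ β ∈ K, β ∈ D ↔ ∀ γ ∈ β, ∀ Y ∈ F, ZFSet.pair γ Y ∈ X → β ∈ Y) ∧
  (∀ A ∈ M, ∀ f ∈ M, ZFSet.IsFunc A K f →
    (∀ a ∈ A, ∀ b ∈ A, ∀ c ∈ K, ZFSet.pair a c ∈ f → ZFSet.pair b c ∈ f → a = b) →
    ∃ B ∈ M, (∀ x ∈ B, x ∈ F ∧ x ∈ A) ∧ ∀ x ∈ A, x ∈ F → x ∈ B) ∧
  ∀ B ∈ S, B ⊆ M → (∀ f ∈ B, ∃ y ∈ S, ZFSet.IsFunc K y f) → (∃ f ∈ B, f = f) →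
    ∃ g ∈ B, ∀ f ∈ B, ¬ ∃ D ∈ F, ∀ β ∈ D, ∃ v ∈ S, ∃ w ∈ S,
      ZFSet.pair β v ∈ f ∧ ZFSet.pair β w ∈ g ∧ v ∈ w

theorem Expressible.goodCore {Γ : Type} (k m f : Γ) :
    Expressible.{u} Γ fun S v => GoodCore S (v k) (v m) (v f) :=
  .and (.subset _ _) <| .and (.ball <| .subset _ _) <|
  .and (.ball <| .ball <| .bex <| .and (.subset _ _) (.subset _ _)) <|
  .and (.ball <| .ball <| .bex <| .mem _ _) <|
  .and (.ball <| .imp (.subset _ _) <| .or (.mem _ _) <| .bex <| .ball <|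
    .iff (.mem _ _) (.not (.mem _ _))) <|
  .and (.ball <| .imp (.isFunc _ _ _) <| .bex <| .ball <| .iff (.mem _ _) <| .ball <| .ball <|
    .imp (.pair_mem _ _ _) (.mem _ _)) <|
  .and (.ball <| .ball <| .imp (.isFunc _ _ _) <| .imp (.ball <| .ball <| .ball <|
    .imp (.pair_mem _ _ _) <| .imp (.pair_mem _ _ _) <| .eq _ _) <| .bex <|
      .and (.ball <| .and (.mem _ _) (.mem _ _)) <| .ball <| .imp (.mem _ _) (.mem _ _)) <|
  .all <| .imp (.subset _ _) <| .imp (.ball <| .ex <| .isFunc _ _ _) <|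
    .imp (.bex <| .eq _ _) <| .bex <| .ball <| .not <| .bex <| .ball <| .ex <| .ex <|
    .and (.pair_mem _ _ _) <| .and (.pair_mem _ _ _) (.mem _ _)

/-- `S` contains all of its subsets of cardinality at most `κ`. -/
def ClosedUnderSubsets (κ : Cardinal.{u}) (S : Set ZFSet.{u}) : Prop :=
  ∀ x : ZFSet.{u}, (∀ y ∈ x, y ∈ S) → x.card ≤ κ → x ∈ S

theorem closedUnderSubsets_H {κ θ : Cardinal.{u}} (h : κ < θ) : ClosedUnderSubsets κ (H θ) :=
  fun _ hx hc => mem_H_iff.2 ⟨hc.trans_lt h, hx⟩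

theorem ClosedUnderSubsets.pair_mem {κ : Cardinal.{u}} (hκ : ℵ₀ ≤ κ) {S : Set ZFSet.{u}}
    (hS : ClosedUnderSubsets κ S) {a b : ZFSet.{u}} (ha : a ∈ S) (hb : b ∈ S) :
    ZFSet.pair a b ∈ S := by
  have h2 : ∀ {a b : ZFSet.{u}}, a ∈ S → b ∈ S → ({a, b} : ZFSet.{u}) ∈ S := fun {a b} ha hb => by
    refine hS _ (fun y hy => ?_) ?_
    · rcases ZFSet.mem_pair.1 hy with rfl | rfl <;> assumption
    · refine le_trans (ZFSet.card_insert_le.trans ?_) ((natCast_lt_aleph0 (n := 2)).le.trans hκ)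
      rw [ZFSet.card_singleton]
      norm_num
  rw [ZFSet.pair]
  refine h2 ?_ (h2 ha hb)
  have := h2 ha ha
  rwa [show ({a, a} : ZFSet.{u}) = {a} by ext; simp] at this

section

variable {κ θ : Cardinal.{u}} {M F : ZFSet.{u}}

variable (hκ : κ.IsRegular) (hθ : ℵ₀ ≤ θ) (hw : IsWeakModel κ M)
  (hM : IsElementarySubmodel (M : Set ZFSet.{u}) (H θ))
include hκ hθ hw hM

/-- The trace of a good filter on a set closed under subsets. -/
theorem IsGood.goodCore_inter (hG : IsGood κ M F) {S : Set ZFSet.{u}}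
    (hS : ∀ x ∈ S, ∀ y ∈ x, y ∈ S) (hc : ClosedUnderSubsets κ S) {Y : ZFSet.{u}}
    (hYS : Y ∈ S) (hY : ∀ A ∈ Y, ∀ B ∈ S, B ⊆ A → B ∈ Y) (hκY : cardSet κ ∈ Y) :
    GoodCore S (cardSet κ) (M ∩ Y) (F ∩ M) := by
  have hF := hG.isNormalFor
  have hκM := hw.cardSet_mem
  have hκS : cardSet κ ∈ S := hS Y hYS _ hκY
  -- Every subset of `κ` has size at most `κ`, so it lies in `S` and then in `Y`. Hence passing from
  -- `M` to `M ∩ Y` loses no set of the filter.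
  have hsubY : ∀ A, A ⊆ cardSet κ → A ∈ Y := fun A hA =>
    hY _ hκY A (hc A (fun y hy => hS _ hκS y (hA hy))
      ((ZFSet.card_mono hA).trans_eq card_cardSet)) hA
  have hsub : ∀ A ∈ F, A ⊆ cardSet κ := fun A hA =>
    ZFSet.mem_powerset.1 (hF.isFilterOn.1 hA)
  refine ⟨fun A hA => ?_, fun A hA => hsub A (ZFSet.mem_inter.1 hA).1, fun A hA B hB => ?_,
    fun A hA γ hγ => ?_, fun A hA hAκ => ?_, fun X hX hfX => ?_, fun A hA f hf hfA hinj => ?_,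
    fun B hB hBM hfun hne => ?_⟩
  · rw [ZFSet.mem_inter] at hA ⊢
    exact ⟨hA.2, hsubY A (hsub A hA.1)⟩
  · rw [ZFSet.mem_inter] at hA hB
    have hAB := inter_mem_of_elementary hM hA.2 hB.2
    have hABκ : A ∩ B ⊆ cardSet κ := fun x hx => hsub A hA.1 (ZFSet.mem_inter.1 hx).1
    have h := hF.and hκ (p := (· ∈ A)) (q := (· ∈ B)) (r := (· ∈ A ∩ B))
      (by rwa [sep_cardSet_eq hABκ]) (by rw [sep_cardSet_eq (hsub A hA.1)]; exact hA.1)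
      (by rw [sep_cardSet_eq (hsub B hB.1)]; exact hB.1)
      fun β _ h1 h2 => ZFSet.mem_inter.2 ⟨h1, h2⟩
    rw [sep_cardSet_eq hABκ] at h
    exact ⟨A ∩ B, ZFSet.mem_inter.2 ⟨h, hAB⟩, fun x hx => (ZFSet.mem_inter.1 hx).1,
      fun x hx => (ZFSet.mem_inter.1 hx).2⟩
  · rw [ZFSet.mem_inter] at hA
    obtain ⟨β, -, h1, h2⟩ := hF.exists_and hκ (p := (· ∈ A)) (q := fun β => γ ∈ β)
      (by rw [sep_cardSet_eq (hsub A hA.1)]; exact hA.1)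
      (hF.tail hκ hM hκM hγ (hw.mem_of_mem_cardSet hγ))
    exact ⟨β, h1, h2⟩
  · have hAM := (ZFSet.mem_inter.1 hA).1
    rcases hF.measures A hAM hAκ with h | h
    · exact .inl (ZFSet.mem_inter.2 ⟨h, hAM⟩)
    · refine .inr ⟨_, ZFSet.mem_inter.2 ⟨h, sdiff_mem_of_elementary hM hκM hAM⟩, fun β hβ => ?_⟩
      rw [ZFSet.mem_sdiff, and_iff_right hβ]
  · have hXM := (ZFSet.mem_inter.1 hX).1
    have h1 : ZFSet.IsFunc (cardSet κ) F X := ⟨fun p hp => by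
      obtain ⟨a, ha, b, hb, rfl⟩ := ZFSet.mem_prod.1 (hfX.1 hp)
      exact ZFSet.pair_mem_prod.2 ⟨ha, (ZFSet.mem_inter.1 hb).1⟩, hfX.2⟩
    refine ⟨_, ZFSet.mem_inter.2 ⟨hF.diagInter_mem X hXM h1,
      diagInter_mem_of_elementary hM hκM hXM⟩, fun β hβ => ?_⟩
    rw [diagInter, ZFSet.mem_sep, and_iff_right hβ]
    exact forall₂_congr fun γ _ => ⟨fun h Z _ hZ => h Z hZ, fun h Z hZ =>
      h Z (ZFSet.pair_mem_prod.1 (hfX.1 hZ)).2 hZ⟩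
  · rw [ZFSet.mem_inter] at hA hf
    have hB := hG.weaklyAmenable A hA.1 ⟨f, hf.1, hfA, fun a b c ha hb => by
      have h1 := ZFSet.pair_mem_prod.1 (hfA.1 ha)
      have h2 := ZFSet.pair_mem_prod.1 (hfA.1 hb)
      exact hinj a h1.1 b h2.1 c h1.2 ha hb⟩
    have hAκ : A.card ≤ κ := by
      rw [← card_cardSet (κ := κ)]
      refine card_le_of_injOn (app f) (fun a ha => app_mem hfA ha) fun a ha b hb hab => ?_
      refine hinj a ha b hb _ (app_mem hfA ha) (pair_app_mem hfA ha) ?_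
      rw [hab]
      exact pair_app_mem hfA hb
    have hBA : F ∩ A ⊆ A := fun x hx => (ZFSet.mem_inter.1 hx).2
    refine ⟨F ∩ A, ZFSet.mem_inter.2 ⟨hB, hY A hA.2 _ (hc _ (fun y hy =>
      hS A (hS Y hYS A hA.2) y (hBA hy)) ((ZFSet.card_mono hBA).trans hAκ)) hBA⟩, fun x hx => ?_,
        fun x h1 h2 => ZFSet.mem_inter.2 ⟨(ZFSet.mem_inter.1 h2).1, h1⟩⟩
    obtain ⟨hxF, hxA⟩ := ZFSet.mem_inter.1 hx
    have hxf := pair_app_mem hfA hxA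
    refine ⟨ZFSet.mem_inter.2 ⟨hxF, mem_of_pair_mem_left hM hf.1
      (hw.mem_of_mem_cardSet (app_mem hfA hxA)) (fun c hc => ?_) hxf⟩, hxA⟩
    exact hinj c (ZFSet.pair_mem_prod.1 (hfA.1 hc)).1 x hxA _ (app_mem hfA hxA) hc hxf
  · have hr := hG.wellFounded_rep
    have hf : ∀ f ∈ B, f ∈ M ∧ ∃ y, ZFSet.IsFunc (cardSet κ) y f := fun f hf =>
      ⟨(ZFSet.mem_inter.1 (hBM hf)).1, (hfun f hf).imp fun _ h => h.2⟩
    obtain ⟨f₀, hf₀, -⟩ := hne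
    obtain ⟨g, hgB, hg⟩ := hr.has_min {f : UltraFun κ M | f.1 ∈ B} ⟨⟨f₀, hf f₀ hf₀⟩, hf₀⟩
    refine ⟨g.1, hgB, fun f hfB => ?_⟩
    rintro ⟨D, hD, h⟩
    rw [ZFSet.mem_inter] at hD
    let f' : UltraFun κ M := ⟨f, hf f hfB⟩
    refine hg f' hfB (ultraMemRep_iff.2 ?_)
    have hsep := sep_app_mem hw hM hθ (Γ := Fin 2) (R := fun _ y => y 0 ∈ y 1) (.mem _ _)
      ![f', g]
    refine hF.mono hκ (p := (· ∈ D)) hsep (by rw [sep_cardSet_eq (hsub D hD.1)]; exact hD.1)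
      fun β hβ hβD => ?_
    obtain ⟨v, -, w, -, h1, h2, h3⟩ := h β hβD
    have h4 := (f'.pair_mem_iff.1 h1).2
    have h5 := (g.pair_mem_iff.1 h2).2
    subst h4 h5
    exact h3

/-- `GoodCore` speaks of representatives. The collapse is constant on classes, so a minimal
representative yields a minimal class. -/
theorem wellFounded_ultraMem (hF : IsNormalFor κ M F)
    (hr : WellFounded (UltraMemRep (κ := κ) (M := M) F)) :
    WellFounded (UltraMem (κ := κ) (M := M) (F := F)) := by
  refine WellFounded.wellFounded_iff_has_min.2 fun T ⟨t, ht⟩ => ?_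
  obtain ⟨f₀, rfl⟩ := Quot.exists_rep t
  obtain ⟨g, hg, hmin⟩ := hr.has_min {f : UltraFun κ M | Quot.mk _ f ∈ T} ⟨f₀, ht⟩
  refine ⟨_, hg, fun a ha => ?_⟩
  rintro ⟨f, g', rfl, hgg', h⟩
  refine hmin f ha ((collapse_mem_iff hκ hθ hw hM hF hr).1 ?_)
  have h1 : collapse hr g' = collapse hr g := congrArg (Quot.lift (collapse hr) fun a b hab =>
    (collapse_eq_iff hκ hθ hw hM hF hr).2 hab) hgg'
  rw [← h1]
  exact (collapse_mem_iff hκ hθ hw hM hF hr).2 h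

/-- With `M`, all subsets of `M` lie in `H(θ')`, so well-foundedness tested inside `H(θ')` is true
well-foundedness. -/
theorem GoodCore.isGood {θ' : Cardinal.{u}} (hMθ' : M ∈ H θ')
    (h : GoodCore (H θ') (cardSet κ) M F) :
    IsGood κ M F := by
  obtain ⟨hFM, hsub, hinter, hunb, hmeas, hdiag, hamen, hwf⟩ := h
  have hκM := hw.cardSet_mem
  have hFo : IsFilterOn κ F := by
    refine isFilterOn_of_directed hκ hsub ?_ hinter hunb
    rcases hmeas _ hκM fun _ h => h with h | ⟨B, hB, -⟩
    exacts [⟨_, h⟩, ⟨B, hB⟩]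
  have hF : IsNormalFor κ M F := by
    refine ⟨hFo, fun A hA hAκ => (hmeas A hA hAκ).imp_right ?_, fun X hX hfX => ?_⟩
    · rintro ⟨B, hB, h⟩
      convert hB using 1
      ext β
      rw [ZFSet.mem_sdiff]
      exact ⟨fun hβ => (h β hβ.1).2 hβ.2, fun hβ => ⟨hsub B hB hβ, (h β (hsub B hB hβ)).1 hβ⟩⟩
    · obtain ⟨D, hD, h⟩ := hdiag X hX hfX
      convert hD using 1
      ext β
      rw [diagInter, ZFSet.mem_sep]
      constructor
      · rintro ⟨hβ, h1⟩
        exact (h β hβ).2 fun γ hγ Y _ hY => h1 γ hγ Y hY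
      · intro hβ
        exact ⟨hsub D hD hβ, fun γ hγ Y hY => (h β (hsub D hD hβ)).1 hβ γ hγ Y
          (ZFSet.pair_mem_prod.1 (hfX.1 hY)).2 hY⟩
  have hr : WellFounded (UltraMemRep (κ := κ) (M := M) F) := by
    refine WellFounded.wellFounded_iff_has_min.2 fun T ⟨f₀, hf₀⟩ => ?_
    let B : ZFSet.{u} := ZFSet.sep (fun f => ∃ f' ∈ T, f'.1 = f) M
    have hfH : ∀ f : UltraFun κ M, f.1 ∈ H θ' := fun f => H_transitive M hMθ' _ f.2.1
    obtain ⟨g, hgB, hg⟩ := hwf B (mem_H_of_subset hMθ' ZFSet.sep_subset) ZFSet.sep_subset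
      (fun f hf => by
        obtain ⟨-, f, -, rfl⟩ := ZFSet.mem_sep.1 hf
        obtain ⟨y, hy⟩ := f.2.2
        refine ⟨replacement (app f.1) (cardSet κ), replacement_mem_H
          (H_transitive M hMθ' _ hκM) fun β hβ => ?_, ?_⟩
        · exact (mem_of_pair_mem_of_transitive H_transitive (hfH f) (pair_app_mem hy hβ)).2
        · have h1 := isFunc_graph (f := app f.1) (x := cardSet κ)
            (y := replacement (app f.1) (cardSet κ)) fun β hβ => mem_replacement.2 ⟨β, hβ, rfl⟩
          rwa [← eq_graph_app hy] at h1)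
      ⟨f₀.1, ZFSet.mem_sep.2 ⟨f₀.2.1, f₀, hf₀, rfl⟩, rfl⟩
    obtain ⟨-, g, hgT, rfl⟩ := ZFSet.mem_sep.1 hgB
    refine ⟨g, hgT, fun f hfT hfg => hg f.1 (ZFSet.mem_sep.2 ⟨f.2.1, f, hfT, rfl⟩)
      ⟨_, hfg, fun β hβ => ?_⟩⟩
    obtain ⟨-, v, w, h1, h2, h3⟩ := ZFSet.mem_sep.1 hβ
    exact ⟨v, (mem_of_pair_mem_of_transitive H_transitive (hfH f) h1).2, w,
      (mem_of_pair_mem_of_transitive H_transitive (hfH g) h2).2, h1, h2, h3⟩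
  refine ⟨hF, fun A hA => ?_, wellFounded_ultraMem hκ hθ hw hM hF hr⟩
  rintro ⟨f, hf, hfA, hinj⟩
  obtain ⟨B, hB, h1, h2⟩ := hamen A hA f hf hfA fun a _ b _ c _ => hinj a b c
  convert hB using 1
  ext x
  rw [ZFSet.mem_inter]
  exact ⟨fun h => h2 x h.2 h.1, h1 x⟩

end

/-! ### Reflecting good filters into transitive structures -/

/-- In the transitive structure `S`, the set `Y` has a subset of size `K` that carries a good filter
and is closed under the rules `h`, which take a code and a sequence of length less than `a`. The
statement is void unless `Y` is closed under subsets, contains `K`, and `h` is functional. -/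
def HasGoodHull (S : Set ZFSet.{u}) (K a Y h : ZFSet.{u}) : Prop :=
  (∀ A ∈ Y, ∀ B ∈ S, B ⊆ A → B ∈ Y) → K ∈ Y →
  (∀ p ∈ S, ∀ y ∈ S, ∀ z ∈ S, ZFSet.pair p y ∈ h → ZFSet.pair p z ∈ h → y = z) →
  ∃ M ∈ S, ∃ F ∈ S, M ⊆ Y ∧ K ∈ M ∧ K ⊆ M ∧
    (∃ e ∈ S, ZFSet.IsFunc M K e ∧
      ∀ x ∈ M, ∀ y ∈ M, ∀ c ∈ K, ZFSet.pair x c ∈ e → ZFSet.pair y c ∈ e → x = y) ∧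
    (∀ c ∈ M, ∀ β ∈ a, ∀ s ∈ S, ZFSet.IsFunc β M s → ∀ p ∈ S, p = ZFSet.pair c s →
      ∀ y ∈ Y, ZFSet.pair p y ∈ h → y ∈ M) ∧
    GoodCore S K M F

theorem Expressible.hasGoodHull {Γ : Type} (k a y h : Γ) :
    Expressible.{u} Γ fun S v => HasGoodHull S (v k) (v a) (v y) (v h) :=
  .imp (.ball <| .all <| .imp (.subset _ _) (.mem _ _)) <| .imp (.mem _ _) <|
  .imp (.all <| .all <| .all <| .imp (.pair_mem _ _ _) <| .imp (.pair_mem _ _ _) (.eq _ _)) <|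
  .ex <| .ex <| .and (.subset _ _) <| .and (.mem _ _) <| .and (.subset _ _) <|
  .and (.ex <| .and (.isFunc _ _ _) <| .ball <| .ball <| .ball <| .imp (.pair_mem _ _ _) <|
    .imp (.pair_mem _ _ _) (.eq _ _)) <|
  .and (.ball <| .ball <| .all <| .imp (.isFunc _ _ _) <| .all <| .imp (.eq_pair _ _ _) <| .ball <|
    .imp (.pair_mem _ _ _) (.mem _ _)) <| .goodCore _ _ _

/-- A good filter on an elementary submodel closed under `<α`-sequences is reflected into every
sufficiently closed transitive structure. -/
theorem IsGood.hasGoodHull {α κ θ : Cardinal.{u}} {M F : ZFSet.{u}} (hκ : κ.IsRegular)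
    (hθ : ℵ₀ ≤ θ) (hw : IsWeakModel κ M) (hM : IsElementarySubmodel (M : Set ZFSet.{u}) (H θ))
    (hα : ClosedUnderSeq α M) (hG : IsGood κ M F) {S : Set ZFSet.{u}}
    (hS : ∀ x ∈ S, ∀ y ∈ x, y ∈ S) (hc : ClosedUnderSubsets κ S) {Y h : ZFSet.{u}} (hYS : Y ∈ S)
    (hhM : h ∈ M) (hhS : h ∈ S) : HasGoodHull S (cardSet κ) (cardSet α) Y h := by
  intro hY hκY hh
  have hκM := hw.cardSet_mem
  have hκS : cardSet κ ∈ S := hS Y hYS _ hκY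
  have hMY : ∀ x ∈ M ∩ Y, x ∈ M ∧ x ∈ S := fun x hx =>
    ⟨(ZFSet.mem_inter.1 hx).1, hS Y hYS x (ZFSet.mem_inter.1 hx).2⟩
  have hcard : (M ∩ Y).card ≤ κ := by
    rw [← hw.card_eq]
    exact ZFSet.card_mono fun x hx => (hMY x hx).1
  -- The hull is `M ∩ Y`. Its size is at most `κ`, so it lies in `S` even if `M` does not.
  have hMS : M ∩ Y ∈ S := hc _ (fun x hx => (hMY x hx).2) hcard
  have hcore := hG.goodCore_inter hκ hθ hw hM hS hc hYS hY hκY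
  have hκsub : cardSet κ ⊆ M ∩ Y := fun γ hγ => by
    have hγκ : γ ⊆ cardSet κ := fun x hx => mem_cardSet_of_mem hγ hx
    exact ZFSet.mem_inter.2 ⟨hw.mem_of_mem_cardSet hγ, hY _ hκY γ (hS _ hκS γ hγ) hγκ⟩
  refine ⟨M ∩ Y, hMS, F ∩ M, hc _ (fun A hA => (hMY A (hcore.1 hA)).2)
    ((ZFSet.card_mono hcore.1).trans hcard), fun x hx => (ZFSet.mem_inter.1 hx).2,
    ZFSet.mem_inter.2 ⟨hκM, hκY⟩, hκsub, ?_, ?_, hcore⟩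
  · have h1 : #(M ∩ Y : ZFSet.{u}) ≤ #(cardSet κ) := by
      rw [ZFSet.cardinalMk_coe_sort, ZFSet.cardinalMk_coe_sort, lift_le, card_cardSet]
      exact hcard
    obtain ⟨i⟩ := h1
    classical
    let f : ZFSet.{u} → ZFSet.{u} := fun x => if hx : x ∈ M ∩ Y then (i ⟨x, hx⟩).1 else ∅
    have hf : ∀ x (hx : x ∈ M ∩ Y), f x = (i ⟨x, hx⟩).1 := fun x hx => dif_pos hx
    have hfun : ZFSet.IsFunc (M ∩ Y) (cardSet κ) (graph f (M ∩ Y)) :=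
      isFunc_graph fun x hx => by
        rw [hf x hx]
        exact (i ⟨x, hx⟩).2
    refine ⟨graph f (M ∩ Y), hc _ (fun p hp => ?_) ((card_le_of_isFunc hfun).trans hcard), hfun, ?_⟩
    · obtain ⟨a, ha, b, hb, rfl⟩ := ZFSet.mem_prod.1 (hfun.1 hp)
      exact hc.pair_mem hκ.aleph0_le (hMY a ha).2 (hS _ hκS b hb)
    · intro x hx y hy c _ h1 h2
      have h3 := (pair_mem_graph.1 h1).2.trans (pair_mem_graph.1 h2).2.symm
      rw [hf x hx, hf y hy] at h3
      exact congrArg Subtype.val (i.injective (Subtype.ext h3))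
  · rintro c hcM β hβ s - hs p hp rfl y hyY hy
    obtain ⟨o, ho, rfl⟩ := mem_cardSet.1 hβ
    -- Closure under sequences gives `s ∈ M`; as `h ∈ M` is functional, its value at `(c, s)` is
    -- definable in `M`.
    have hsM : s ∈ M := hα o ho s ⟨fun q hq => by
      obtain ⟨a, ha, b, hb, rfl⟩ := ZFSet.mem_prod.1 (hs.1 hq)
      exact ZFSet.pair_mem_prod.2 ⟨ha, (hMY b hb).1⟩, hs.2⟩
    refine ZFSet.mem_inter.2 ⟨mem_of_pair_mem_right hM hhM
      (pair_mem_of_elementary hM hθ (hMY c hcM).1 hsM) (fun z hz => ?_) hy, hyY⟩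
    exact hh _ hp z (mem_of_pair_mem_of_transitive hS hhS hz).2 y (hS Y hYS y hyY) hz hy

/-! ### Skolem functions -/

/-- `a` witnesses the formula `φ` in `S` at the parameters `x`. -/
def IsWitness (S : Set ZFSet.{u}) {n : ℕ} (φ : LSet.BoundedFormula Empty (n + 1))
    (x : Fin n → ZFSet.{u}) (a : ZFSet.{u}) : Prop :=
  ∃ (hx : ∀ i, x i ∈ S) (ha : a ∈ S),
    φ.Realize default (Fin.snoc (fun i => (⟨x i, hx i⟩ : S)) ⟨a, ha⟩ : Fin (n + 1) → S)

/-- A Skolem function for the formula `φ` in `S`. -/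
noncomputable def skolem (S : Set ZFSet.{u}) {n : ℕ} (φ : LSet.BoundedFormula Empty (n + 1))
    (x : Fin n → ZFSet.{u}) : ZFSet.{u} :=
  Classical.epsilon (IsWitness S φ x)

theorem isWitness_skolem {S : Set ZFSet.{u}} {n : ℕ} {φ : LSet.BoundedFormula Empty (n + 1)}
    {x : Fin n → ZFSet.{u}} (h : ∃ a, IsWitness S φ x a) : IsWitness S φ x (skolem S φ x) :=
  Classical.epsilon_spec h

/-- This is the Tarski–Vaught test. -/
theorem isElementarySubmodel_of_isWitness {M S : Set ZFSet.{u}} (hMS : M ⊆ S)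
    (h : ∀ (n : ℕ) (φ : LSet.BoundedFormula Empty (n + 1)) (x : Fin n → ZFSet.{u}),
      (∀ i, x i ∈ M) → (∃ a, IsWitness S φ x a) → ∃ b ∈ M, IsWitness S φ x b) :
    IsElementarySubmodel M S := by
  let f : M ↪[LSet] S :=
    { toFun := fun x => ⟨x.1, hMS x.2⟩
      inj' := fun x y hxy => Subtype.ext (congrArg (fun z : S => z.1) hxy)
      map_fun' := fun g => Empty.elim g
      map_rel' := fun r _ => by cases r; exact Iff.rfl }
  refine ⟨f.toElementaryEmbedding fun n φ x a ha => ?_, fun _ => rfl⟩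
  obtain ⟨b, hb, hx, hbS, hr⟩ := h n φ (fun i => (x i).1) (fun i => (x i).2)
    ⟨a.1, fun i => hMS (x i).2, a.2, ha⟩
  exact ⟨⟨b, hb⟩, hr⟩

/-- Countability of the language lets natural numbers, which are elements of `κ`, code the Skolem
functions. -/
theorem exists_surjective_formulas :
    ∃ e : ℕ → Σ n, LSet.BoundedFormula Empty (n + 1), Function.Surjective e := by
  have h1 : #(Σ n, LSet.BoundedFormula Empty n) ≤ ℵ₀ := by
    refine BoundedFormula.card_le.trans (max_le le_rfl ?_)
    have h2 : LSet.card ≤ ℵ₀ := by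
      rw [Language.card, mk_sum]
      have h3 : #(Σ l, LSet.Functions l) = 0 := by
        rw [mk_eq_zero_iff]
        exact ⟨fun x => Empty.elim x.2⟩
      have h4 : #(Σ l, LSet.Relations l) ≤ 1 := by
        rw [le_one_iff_subsingleton]
        refine ⟨fun a b => ?_⟩
        obtain ⟨n, r⟩ := a
        obtain ⟨m, r'⟩ := b
        cases r
        cases r'
        rfl
      rw [h3]
      simpa using h4.trans one_le_aleph0
    simpa using h2
  have h3 : Countable (Σ n, LSet.BoundedFormula Empty n) := mk_le_aleph0_iff.1 h1
  have h4 : Function.Injective fun p : Σ n, LSet.BoundedFormula Empty (n + 1) =>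
      (⟨p.1 + 1, p.2⟩ : Σ n, LSet.BoundedFormula Empty n) := by
    rintro ⟨n, φ⟩ ⟨m, ψ⟩ h
    simp only [Sigma.mk.injEq, Nat.add_right_cancel_iff] at h
    obtain ⟨rfl, h⟩ := h
    rw [eq_of_heq h]
  have : Countable (Σ n, LSet.BoundedFormula Empty (n + 1)) := h4.countable
  have : Nonempty (Σ n, LSet.BoundedFormula Empty (n + 1)) := ⟨⟨0, ⊥⟩⟩
  exact exists_surjective_nat _

/-! ### From reflected good filters to elementary submodels -/

/-- The natural number `n` as a von Neumann ordinal. -/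
noncomputable def natSet (n : ℕ) : ZFSet.{u} := (n : Ordinal.{u}).toZFSet

theorem natSet_injective : Function.Injective natSet.{u} :=
  Ordinal.toZFSet_injective.comp Nat.cast_injective

theorem natSet_mem_cardSet {κ : Cardinal.{u}} (hκ : ℵ₀ ≤ κ) (n : ℕ) :
    natSet n ∈ cardSet κ :=
  mem_cardSet.2 ⟨n, (Ordinal.natCast_lt_omega0 n).trans_le (by rwa [omega0_le_ord]), rfl⟩

theorem mem_natSet {n : ℕ} {x : ZFSet.{u}} : x ∈ natSet n ↔ ∃ i : Fin n, natSet i = x := by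
  rw [natSet, Ordinal.mem_toZFSet_iff]
  constructor
  · rintro ⟨a, ha, rfl⟩
    obtain ⟨m, rfl⟩ := Ordinal.lt_omega0.1 (ha.trans (Ordinal.natCast_lt_omega0 n))
    exact ⟨⟨m, Nat.cast_lt.1 ha⟩, rfl⟩
  · rintro ⟨i, rfl⟩
    exact ⟨i, Nat.cast_lt.2 i.2, rfl⟩

/-- A finite tuple as a function on a natural number. -/
noncomputable def tuple {n : ℕ} (x : Fin n → ZFSet.{u}) : ZFSet.{u} :=
  graph (Function.extend (fun i : Fin n => natSet i) x fun _ => ∅) (natSet n)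

theorem natSet_fin_injective (n : ℕ) : Function.Injective fun i : Fin n => natSet.{u} i :=
  natSet_injective.comp Fin.val_injective

theorem app_tuple {n : ℕ} (x : Fin n → ZFSet.{u}) (i : Fin n) : app (tuple x) (natSet i) = x i :=
  (app_graph (f := Function.extend (fun i : Fin n => natSet i) x fun _ => ∅)
    (mem_natSet.2 ⟨i, rfl⟩)).trans ((natSet_fin_injective n).extend_apply x _ i)

theorem isFunc_tuple {n : ℕ} {x : Fin n → ZFSet.{u}} {y : ZFSet.{u}} (hx : ∀ i, x i ∈ y) :
    ZFSet.IsFunc (natSet n) y (tuple x) :=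
  isFunc_graph (f := Function.extend (fun i : Fin n => natSet i) x fun _ => ∅) fun a ha => by
    obtain ⟨i, rfl⟩ := mem_natSet.1 ha
    rw [(natSet_fin_injective n).extend_apply x _ i]
    exact hx i

/-- The rules under which an elementary submodel of `S` that is closed under sequences and contains
`A` is closed. -/
def SkolemRule (S : Set ZFSet.{u}) (A c s y : ZFSet.{u}) : Prop :=
  (c = natSet 0 ∧ y = s) ∨ (c = natSet 1 ∧ y = A) ∨
    ∃ k : ℕ, c = natSet (k + 2) ∧ y = skolem S (exists_surjective_formulas.choose k).2
      fun i => app s (natSet i)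

theorem SkolemRule.unique {S : Set ZFSet.{u}} {A c s y z : ZFSet.{u}} (hy : SkolemRule S A c s y)
    (hz : SkolemRule S A c s z) : y = z := by
  rcases hy with ⟨rfl, rfl⟩ | ⟨rfl, rfl⟩ | ⟨k, rfl, rfl⟩ <;>
    rcases hz with ⟨h, rfl⟩ | ⟨h, rfl⟩ | ⟨l, h, rfl⟩ <;> have h' := natSet_injective h <;>
    first | rfl | omega | skip
  obtain rfl : k = l := by omega
  rfl

/-- The set of instances in `Y` of the closure rules. -/
noncomputable def skolemRules (S : Set ZFSet.{u}) (A Y : ZFSet.{u}) : ZFSet.{u} :=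
  ZFSet.sep (fun p => ∃ c s y, p = ZFSet.pair (ZFSet.pair c s) y ∧ SkolemRule S A c s y)
    (ZFSet.prod (ZFSet.prod Y Y) Y)

theorem pair_mem_skolemRules {S : Set ZFSet.{u}} {A Y c s y : ZFSet.{u}} :
    ZFSet.pair (ZFSet.pair c s) y ∈ skolemRules S A Y ↔
      ((c ∈ Y ∧ s ∈ Y) ∧ y ∈ Y) ∧ SkolemRule S A c s y := by
  rw [skolemRules, ZFSet.mem_sep, ZFSet.pair_mem_prod, ZFSet.pair_mem_prod]
  refine and_congr_right fun _ => ⟨?_, fun h => ⟨c, s, y, rfl, h⟩⟩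
  rintro ⟨c', s', y', h, h'⟩
  obtain ⟨h1, rfl⟩ := ZFSet.pair_inj.1 h
  obtain ⟨rfl, rfl⟩ := ZFSet.pair_inj.1 h1
  exact h'

/-- Rule `0` makes the hull closed under `<α`-sequences, rule `1` puts `A` into it, and rules `k +
2` make it elementary in `H(θ)`. Finite tuples are admissible sequences since `α` is infinite. -/
theorem filterWitness_of_hasGoodHull {α κ θ θ' : Cardinal.{u}} (hα : ℵ₀ ≤ α) (hκ : κ.IsRegular)
    (hακ : α ≤ κ) (hθ : θ.IsRegular) (hκθ : κ < θ) {A : ZFSet.{u}} (hA : A ∈ H θ)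
    (hY : HSet θ ∈ H θ') (h : HasGoodHull (H θ') (cardSet κ) (cardSet α) (HSet θ)
      (skolemRules (H θ) A (HSet θ))) : FilterWitness α κ θ A := by
  have hθ0 := hθ.aleph0_le
  have hHθ' : ∀ {x : ZFSet.{u}}, x ∈ H θ → x ∈ H θ' := fun hx =>
    H_transitive _ hY _ ((mem_HSet hθ).2 hx)
  have hκH : cardSet κ ∈ H θ := toZFSet_mem_H (by rwa [card_ord])
  obtain ⟨M, hMS, F, hFS, hMY, hκM, hκsub, ⟨e, -, he, hinj⟩, hrule, hcore⟩ := h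
    (fun B hB C _ hCB => (mem_HSet hθ).2 (mem_H_of_subset ((mem_HSet hθ).1 hB) hCB))
    ((mem_HSet hθ).2 hκH) (fun p _ y _ z _ hy hz => by
      obtain ⟨-, c, s, y', h1, h2⟩ := ZFSet.mem_sep.1 hy
      obtain ⟨rfl, rfl⟩ := ZFSet.pair_inj.1 h1
      exact h2.unique (pair_mem_skolemRules.1 hz).2)
  have hMH : ∀ x ∈ M, x ∈ H θ := fun x hx => (mem_HSet hθ).1 (hMY hx)
  have hnat : ∀ n, natSet n ∈ M := fun n => hκsub (natSet_mem_cardSet hκ.aleph0_le n)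
  have hseq : ∀ β ∈ cardSet α, ∀ s, ZFSet.IsFunc β M s → s ∈ H θ := fun β hβ s hs =>
    isFunc_mem_H hθ0 hs (H_mono (hακ.trans hκθ.le) (mem_H_of_mem_cardSet hβ)) hMH
  have hclosed : ∀ c ∈ M, ∀ β ∈ cardSet α, ∀ s, ZFSet.IsFunc β M s → ∀ y ∈ H θ,
      SkolemRule (H θ) A c s y → y ∈ M := fun c hc β hβ s hs y hy hr => by
    have hsH := hseq β hβ s hs
    exact hrule c hc β hβ s (hHθ' hsH) hs _ (hHθ' (pair_mem_H hθ0 (hMH c hc) hsH)) rfl y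
      ((mem_HSet hθ).2 hy) (pair_mem_skolemRules.2 ⟨⟨⟨hMY hc, (mem_HSet hθ).2 hsH⟩,
        (mem_HSet hθ).2 hy⟩, hr⟩)
  have hM : IsElementarySubmodel (M : Set ZFSet.{u}) (H θ) := by
    refine isElementarySubmodel_of_isWitness hMH fun n φ x hx hex => ?_
    obtain ⟨k, hk⟩ := exists_surjective_formulas.choose_spec ⟨n, φ⟩
    have hw := isWitness_skolem hex
    refine ⟨_, hclosed (natSet (k + 2)) (hnat _) (natSet n) (natSet_mem_cardSet hα n) (tuple x)
      (isFunc_tuple hx) _ hw.2.1 (.inr (.inr ⟨k, rfl, ?_⟩)), hw⟩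
    rw [hk]
    exact congrArg (skolem (H θ) φ) (funext fun i => (app_tuple x i).symm)
  have hw : IsWeakModel κ M := by
    refine ⟨le_antisymm ?_ ?_, fun x hx => ?_,
      modelsZFCMinus_of_elementary hM hθ hκ.aleph0_le hκM fun x hx => hκsub hx⟩
    · rw [← card_cardSet (κ := κ)]
      refine card_le_of_injOn (app e) (fun a ha => app_mem he ha) fun a ha b hb hab => ?_
      refine hinj a ha b hb _ (app_mem he ha) (pair_app_mem he ha) ?_
      rw [hab]
      exact pair_app_mem he hb
    · rw [← card_cardSet (κ := κ)]
      exact ZFSet.card_mono hκsub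
    · rcases ZFSet.mem_insert_iff.1 hx with rfl | hx
      exacts [hκM, hκsub hx]
  refine ⟨M, hw, hM, fun β hβ s hs => ?_, ?_, F, hcore.isGood hκ hθ0 hw hM hMS⟩
  · have hβα : β.toZFSet ∈ cardSet α := mem_cardSet.2 ⟨β, hβ, rfl⟩
    exact hclosed _ (hnat 0) _ hβα s hs s (hseq _ hβα s hs) (.inl ⟨rfl, rfl⟩)
  · exact hclosed _ (hnat 1) (natSet 0) (natSet_mem_cardSet hα 0) (tuple Fin.elim0)
      (isFunc_tuple fun i => i.elim0) A hA (.inr (.inl ⟨rfl, rfl⟩))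

/-- If good hulls exist in all sufficiently large `H(θ)`, then every set is an element of a model
with a good filter. -/
theorem filterWitness_of_forall_hasGoodHull {α κ θ : Cardinal.{u}} (hα : ℵ₀ ≤ α) (hκ : κ.IsRegular)
    (hακ : α ≤ κ) (hθ : θ.IsRegular) (hκθ : κ < θ) {A : ZFSet.{u}} (hA : A ∈ H θ)
    (h : ∀ μ : Cardinal.{u}, ∃ θ', μ ≤ θ' ∧ ∀ Y ∈ H θ', ∀ r ∈ H θ',
      HasGoodHull (H θ') (cardSet κ) (cardSet α) Y r) : FilterWitness α κ θ A := by
  obtain ⟨μ, hμ⟩ := eventually_mem_H (HSet θ)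
  obtain ⟨ν, hν⟩ := eventually_mem_H (skolemRules (H θ) A (HSet θ))
  obtain ⟨θ', hθ', h'⟩ := h (max μ ν)
  have h1 := hμ θ' ((le_max_left _ _).trans hθ')
  exact filterWitness_of_hasGoodHull hα hκ hακ hθ hκθ hA h1
    (h' _ h1 _ (hν θ' ((le_max_right _ _).trans hθ')))

/-- A single model with a good filter gives good hulls for all parameters, by elementarity. -/
theorem FilterWitness.hasGoodHull {α κ θ : Cardinal.{u}} (hκ : κ.IsRegular) (hακ : α ≤ κ)
    (hθ : ℵ₀ ≤ θ) {A : ZFSet.{u}} (h : FilterWitness α κ θ A) :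
    ∀ Y ∈ H θ, ∀ r ∈ H θ, HasGoodHull (H θ) (cardSet κ) (cardSet α) Y r := by
  obtain ⟨M, hw, hM, hα, -, F, hG⟩ := h
  by_contra! hc
  obtain ⟨Y, hY, r, hr, hn⟩ := hc
  have hκM := hw.cardSet_mem
  have hκθ : κ < θ := by
    have := card_lt_of_mem_H (hM.subset hκM)
    rwa [card_cardSet] at this
  have hαM : cardSet α ∈ M := by
    rcases hακ.eq_or_lt with rfl | hlt
    · exact hκM
    · exact hw.mem_of_mem_cardSet (mem_cardSet.2 ⟨_, ord_lt_ord.2 hlt, rfl⟩)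
  -- Only `r'` has to be in `M`; `Y'` is quantified inside the formula and may be any element of
  -- `H(θ)`.
  obtain ⟨r', hr', Y', hY', hn'⟩ := hM.exists_mem H_transitive ![cardSet κ, cardSet α]
    (by simpa [Fin.forall_fin_two] using ⟨hκM, hαM⟩)
    (fun S v r => ∃ Y ∈ S, ¬ HasGoodHull S (v 0) (v 1) Y r)
    (.ex <| .not <| .hasGoodHull _ _ _ _) ⟨r, hr, Y, hY, hn⟩
  exact hn' (hG.hasGoodHull hκ hθ hw hM hα H_transitive (closedUnderSubsets_H hκθ)
    hY' hr' (hM.subset hr'))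

/-! ### Elementary submodels closed under small subsets -/

section Hull

variable (κ θ : Cardinal.{u}) (X : ZFSet.{u})

/-- The arities of the operations that generate a closed hull of `X`: constants for the elements of
`X`, the range of a `κ`-sequence, and Skolem functions. -/
def HullArity : Shrink.{u} X ⊕ Option ℕ → Type u
  | .inl _ => PEmpty
  | .inr none => κ.out
  | .inr (some k) => ULift (Fin (exists_surjective_formulas.choose k).1)

/-- The operations that generate a closed hull of `X`. -/
noncomputable def hullOp :
    (Σ a : Shrink.{u} X ⊕ Option ℕ, HullArity κ X a → ZFSet.{u}) → ZFSet.{u}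
  | ⟨.inl x, _⟩ => ((equivShrink X).symm x).1
  | ⟨.inr none, f⟩ => ZFSet.range (α := κ.out) f
  | ⟨.inr (some k), f⟩ => skolem (H θ) (exists_surjective_formulas.choose k).2 fun i => f ⟨i⟩

/-- The value of a term in `H(θ)`. -/
noncomputable def hullEval : WType (HullArity κ X) → ZFSet.{u} :=
  WType.elim ZFSet.{u} fun p => open Classical in if hullOp κ θ X p ∈ H θ then hullOp κ θ X p else ∅

variable {κ θ X}

theorem hullEval_mk {a : Shrink.{u} X ⊕ Option ℕ} {f : HullArity κ X a → WType (HullArity κ X)}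
    (h : hullOp κ θ X ⟨a, fun i => hullEval κ θ X (f i)⟩ ∈ H θ) :
    hullEval κ θ X (WType.mk a f) = hullOp κ θ X ⟨a, fun i => hullEval κ θ X (f i)⟩ :=
  if_pos h

theorem hullEval_mem_H (hθ : ℵ₀ ≤ θ) (t : WType (HullArity κ X)) : hullEval κ θ X t ∈ H θ := by
  obtain ⟨a, f⟩ := t
  by_cases h : hullOp κ θ X ⟨a, fun i => hullEval κ θ X (f i)⟩ ∈ H θ
  · rwa [hullEval_mk h]
  · have h1 : hullEval κ θ X (WType.mk a f) = ∅ := if_neg h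
    rw [h1]
    exact empty_mem_H hθ

/-- There are at most `2 ^ κ` operations, of arity at most `κ`, and `(2 ^ κ) ^ κ = 2 ^ κ`, so this
bound is stable under term formation. -/
theorem mk_wType_hullArity_le (hκ : ℵ₀ ≤ κ) (hX : X.card ≤ 2 ^ κ) :
    #(WType (HullArity κ X)) ≤ 2 ^ κ := by
  have hc : ℵ₀ ≤ (2 : Cardinal.{u}) ^ κ := hκ.trans (cantor κ).le
  refine WType.cardinalMk_le_of_le ((sum_le_sum _ (fun _ => 2 ^ κ) ?_).trans ?_)
  · rintro (x | _ | k)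
    · have : #(HullArity κ X (.inl x)) = 0 := mk_eq_zero_iff.2 (inferInstanceAs (IsEmpty PEmpty))
      rw [this, power_zero]
      exact one_le_aleph0.trans hc
    · have : #(HullArity κ X (.inr none)) = κ := mk_out κ
      rw [this, ← power_mul, mul_eq_self hκ]
    · have : #(HullArity κ X (.inr (some k))) < ℵ₀ :=
        lt_aleph0_iff_finite.2 (inferInstanceAs (Finite (ULift (Fin _))))
      obtain ⟨n, hn⟩ := lt_aleph0.1 this
      rw [hn, power_natCast]
      exact power_nat_le hc
  · rw [sum_const']
    refine mul_le_of_le hc ?_ le_rfl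
    rw [mk_sum]
    refine add_le_of_le hc ?_ ?_
    · rw [lift_uzero]
      exact hX
    · simpa using hc

/-- `Z` consists of the values of well-founded terms. Because forming the range of a `κ`-sequence is
itself an operation, every nonempty subset of `Z` of size at most `κ` is again a value. -/
theorem exists_closed_elementarySubmodel (hκ : ℵ₀ ≤ κ) (hκθ : 2 ^ κ < θ)
    (hXθ : ∀ x ∈ X, x ∈ H θ) (hX : X.card ≤ 2 ^ κ) :
    ∃ Z : ZFSet.{u}, X ⊆ Z ∧ IsElementarySubmodel (Z : Set ZFSet.{u}) (H θ) ∧ Z.card ≤ 2 ^ κ ∧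
      ClosedUnderSubsets κ (Z : Set ZFSet.{u}) := by
  have hκθ' : κ < θ := (cantor κ).trans hκθ
  have hθ : ℵ₀ ≤ θ := hκ.trans hκθ'.le
  let Z : ZFSet.{u} := ZFSet.range (hullEval κ θ X)
  have hZ : IsElementarySubmodel (Z : Set ZFSet.{u}) (H θ) := by
    refine isElementarySubmodel_of_isWitness (fun x hx => ?_) fun n φ x hx hex => ?_
    · obtain ⟨t, rfl⟩ := ZFSet.mem_range.1 hx
      exact hullEval_mem_H hθ t
    · obtain ⟨k, hk⟩ := exists_surjective_formulas.choose_spec ⟨n, φ⟩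
      have hw := isWitness_skolem hex
      have hx' : ∀ i, ∃ t, hullEval κ θ X t = x i := fun i => ZFSet.mem_range.1 (hx i)
      choose t ht using hx'
      obtain rfl : x = fun i => hullEval κ θ X (t i) := funext fun i => (ht i).symm
      obtain ⟨t', ht'⟩ : ∃ t', hullEval κ θ X t' =
          skolem (H θ) φ fun i => hullEval κ θ X (t i) := by
        have h1 : ∀ (ψ : Σ n, LSet.BoundedFormula Empty (n + 1)),
            exists_surjective_formulas.choose k = ψ → ∀ t : Fin ψ.1 → WType (HullArity κ X),
            (skolem (H θ) ψ.2 fun i => hullEval κ θ X (t i)) ∈ H θ →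
            ∃ t', hullEval κ θ X t' = skolem (H θ) ψ.2 fun i => hullEval κ θ X (t i) := by
          rintro ψ rfl t h2
          exact ⟨WType.mk (.inr (some k)) fun i => t i.down, hullEval_mk h2⟩
        exact h1 ⟨n, φ⟩ hk t hw.2.1
      exact ⟨_, ZFSet.mem_range.2 ⟨t', ht'⟩, hw⟩
  refine ⟨Z, fun x hx => ?_, hZ, ?_, fun x hx hc => ?_⟩
  · let f : HullArity κ X (.inl (equivShrink X ⟨x, hx⟩)) → WType (HullArity κ X) :=
      fun i => PEmpty.elim i
    have h1 : hullOp κ θ X ⟨.inl (equivShrink X ⟨x, hx⟩), fun i => hullEval κ θ X (f i)⟩ = x := by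
      change ((equivShrink X).symm (equivShrink X ⟨x, hx⟩)).1 = x
      rw [Equiv.symm_apply_apply]
    refine ZFSet.mem_range.2 ⟨WType.mk (.inl (equivShrink X ⟨x, hx⟩)) f, ?_⟩
    rw [hullEval_mk (by rw [h1]; exact hXθ x hx), h1]
  · refine le_trans ?_ (mk_wType_hullArity_le hκ hX)
    rw [← lift_le.{u + 1}, ← ZFSet.cardinalMk_coe_sort]
    have : Function.Surjective fun t => (⟨hullEval κ θ X t, ZFSet.mem_range_self t⟩ : Z) :=
      fun ⟨z, hz⟩ => by
        obtain ⟨t, rfl⟩ := ZFSet.mem_range.1 hz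
        exact ⟨t, rfl⟩
    have h2 := mk_le_of_surjective (this.comp Equiv.ulift.{u + 1}.surjective)
    rwa [mk_uLift] at h2
  · by_cases hne : ∃ y, y ∈ x
    · obtain ⟨y, hy⟩ := hne
      have hle : lift.{u} #x ≤ lift.{u + 1} #κ.out := by
        rw [ZFSet.cardinalMk_coe_sort, mk_out, lift_lift, lift_le]
        simpa using hc
      obtain ⟨e⟩ := lift_mk_le'.1 hle
      have : Nonempty x := ⟨⟨y, hy⟩⟩
      have hsurj := Function.invFun_surjective e.injective
      have hx' : ∀ z : x, ∃ t, hullEval κ θ X t = z.1 := fun z => ZFSet.mem_range.1 (hx z.1 z.2)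
      choose t ht using hx'
      have h1 : hullOp κ θ X ⟨.inr none, fun i => hullEval κ θ X (t (Function.invFun e i))⟩ =
          x := by
        change ZFSet.range (α := κ.out) (fun i => hullEval κ θ X (t (Function.invFun e i))) = x
        ext z
        rw [ZFSet.mem_range]
        constructor
        · rintro ⟨i, rfl⟩
          rw [ht]
          exact (Function.invFun e i).2
        · intro hz
          obtain ⟨i, hi⟩ := hsurj ⟨z, hz⟩
          exact ⟨i, by rw [hi, ht]⟩
      have hxH : x ∈ H θ := closedUnderSubsets_H hκθ' x (fun z hz => hZ.subset (hx z hz)) hc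
      refine ZFSet.mem_range.2 ⟨WType.mk (.inr none) fun i => t (Function.invFun e i), ?_⟩
      rw [hullEval_mk (by rw [h1]; exact hxH), h1]
    -- The empty set is not the range of a `κ`-sequence, but it is definable.
    · push Not at hne
      obtain rfl : x = ∅ := (ZFSet.eq_empty x).2 hne
      exact hZ.mem_of_unique H_transitive (Γ := Empty) Empty.elim (fun i => i.elim)
        (fun S _ x => ∀ y ∈ S, ¬ y ∈ x) (.all <| .not <| .mem _ _) (empty_mem_H hθ)
        (fun y _ => ZFSet.notMem_empty y) fun y hy h =>
          (ZFSet.eq_empty y).2 fun z hz => h z (H_transitive y hy z hz) hz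

end Hull

theorem mem_H_of_isTransitive {θ : Cardinal.{u}} {T : ZFSet.{u}} (hT : T.IsTransitive)
    (hc : T.card < θ) : T ∈ H θ := by
  have h : ∀ x : ZFSet.{u}, x ⊆ T → x ∈ H θ := by
    intro x
    induction x using ZFSet.inductionOn with
    | _ x ih => exact fun hx => mem_H_iff.2 ⟨(ZFSet.card_mono hx).trans_lt hc,
        fun y hy => ih y hy (hT y (hx hy))⟩
  exact h T fun _ h => h

/-! ### The transitive collapse of an elementary submodel -/

section Collapse

variable {θ : Cardinal.{u}} {Z : ZFSet.{u}}

theorem wellFounded_mem_coe (Z : ZFSet.{u}) :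
    WellFounded fun a b : ↥(Z : Set ZFSet.{u}) => a.1 ∈ b.1 :=
  InvImage.wf Subtype.val ZFSet.mem_wf

instance (Z : ZFSet.{u}) : Small.{u} ↥(Z : Set ZFSet.{u}) := inferInstanceAs (Small.{u} Z)

/-- The transitive collapse of a set. -/
noncomputable def transCollapse (Z : ZFSet.{u}) : ↥(Z : Set ZFSet.{u}) → ZFSet.{u} :=
  collapse (wellFounded_mem_coe Z)

theorem mem_transCollapse {a : ↥(Z : Set ZFSet.{u})} {z : ZFSet.{u}} :
    z ∈ transCollapse Z a ↔ ∃ b : ↥(Z : Set ZFSet.{u}), b.1 ∈ a.1 ∧ transCollapse Z b = z :=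
  mem_collapse _

theorem isTransitive_range_transCollapse : (ZFSet.range (transCollapse Z)).IsTransitive := by
  intro y hy z hz
  obtain ⟨a, rfl⟩ := ZFSet.mem_range.1 hy
  obtain ⟨b, -, rfl⟩ := mem_transCollapse.1 hz
  exact ZFSet.mem_range_self b

theorem transCollapse_eq_self {T : ZFSet.{u}} (hT : T.IsTransitive) (hTZ : T ⊆ Z) {a : ZFSet.{u}}
    (ha : a ∈ T) : transCollapse Z ⟨a, hTZ ha⟩ = a := by
  induction a using ZFSet.inductionOn with
  | _ a ih =>
    ext z
    rw [mem_transCollapse]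
    constructor
    · rintro ⟨⟨b, hb⟩, h1, rfl⟩
      rwa [ih b h1 (hT a ha h1)]
    · exact fun hz => ⟨⟨z, hTZ (hT a ha hz)⟩, hz, ih z hz (hT a ha hz)⟩

variable (hZ : IsElementarySubmodel (Z : Set ZFSet.{u}) (H θ))
include hZ

theorem transCollapse_injective : Function.Injective (transCollapse Z) := by
  intro a
  induction a using (wellFounded_mem_coe Z).induction with
  | _ a ih =>
    intro b hab
    refine Subtype.ext (hZ.ext H_transitive a.2 b.2 fun z hz => ⟨fun h => ?_, fun h => ?_⟩)
    · have h1 : transCollapse Z ⟨z, hz⟩ ∈ transCollapse Z b :=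
        hab ▸ mem_transCollapse.2 ⟨⟨z, hz⟩, h, rfl⟩
      obtain ⟨c, hc, h2⟩ := mem_transCollapse.1 h1
      have h3 := ih ⟨z, hz⟩ h h2.symm
      rwa [← h3] at hc
    · have h1 : transCollapse Z ⟨z, hz⟩ ∈ transCollapse Z a :=
        hab ▸ mem_transCollapse.2 ⟨⟨z, hz⟩, h, rfl⟩
      obtain ⟨c, hc, h2⟩ := mem_transCollapse.1 h1
      have h3 := ih c hc h2
      rwa [h3] at hc

theorem exists_elementaryEmbedding_transCollapse :
    ∃ j : (Z : Set ZFSet.{u}) ↪ₑ[LSet] (ZFSet.range (transCollapse Z) : Set ZFSet.{u}),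
      ∀ a, (j a).1 = transCollapse Z a := by
  let f : ↥(Z : Set ZFSet.{u}) → ↥(ZFSet.range (transCollapse Z) : Set ZFSet.{u}) := fun a =>
    ⟨transCollapse Z a, ZFSet.mem_range_self a⟩
  have hf : Function.Bijective f := by
    refine ⟨fun a b h => transCollapse_injective hZ (congrArg Subtype.val h), fun ⟨z, hz⟩ => ?_⟩
    obtain ⟨a, rfl⟩ := ZFSet.mem_range.1 hz
    exact ⟨a, rfl⟩
  have hmem : ∀ a b, transCollapse Z a ∈ transCollapse Z b ↔ a.1 ∈ b.1 := by
    intro a b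
    rw [mem_transCollapse]
    constructor
    · rintro ⟨c, hc, h⟩
      rwa [← transCollapse_injective hZ h]
    · exact fun h => ⟨a, h, rfl⟩
  let i : (Z : Set ZFSet.{u}) ≃[LSet] (ZFSet.range (transCollapse Z) : Set ZFSet.{u}) :=
    { Equiv.ofBijective f hf with
      map_fun' := fun g => Empty.elim g
      map_rel' := fun r x => by cases r; exact hmem (x 0) (x 1) }
  exact ⟨i.toElementaryEmbedding, fun _ => rfl⟩

/-- The preimage of `x` in `Z` has the same size as `x`, so it belongs to `Z`, and it collapses to
`x`. -/
theorem closedUnderSubsets_range_transCollapse {κ : Cardinal.{u}}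
    (hc : ClosedUnderSubsets κ (Z : Set ZFSet.{u})) :
    ClosedUnderSubsets κ (ZFSet.range (transCollapse Z) : Set ZFSet.{u}) := by
  intro x hx hxκ
  let x' : ZFSet.{u} := ZFSet.sep (fun a => ∃ h : a ∈ Z, transCollapse Z ⟨a, h⟩ ∈ x) Z
  have hmem : ∀ a, a ∈ x' ↔ a ∈ Z ∧ ∃ h : a ∈ Z, transCollapse Z ⟨a, h⟩ ∈ x :=
    fun a => ZFSet.mem_sep
  have hx' : x' ∈ Z := by
    refine hc x' (fun a ha => (ZFSet.mem_sep.1 ha).1) (le_trans ?_ hxκ)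
    classical
    refine card_le_of_injOn (fun a => if h : a ∈ Z then transCollapse Z ⟨a, h⟩ else ∅)
      (fun a ha => ?_) fun a ha b hb hab => ?_
    · obtain ⟨-, h, h1⟩ := ZFSet.mem_sep.1 ha
      simpa only [dif_pos h] using h1
    · have ha' := (ZFSet.mem_sep.1 ha).1
      have hb' := (ZFSet.mem_sep.1 hb).1
      simp only [dif_pos ha', dif_pos hb'] at hab
      exact congrArg Subtype.val (transCollapse_injective hZ hab)
  refine ZFSet.mem_range.2 ⟨⟨x', hx'⟩, ?_⟩
  ext z
  rw [mem_transCollapse]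
  constructor
  · rintro ⟨a, ha, rfl⟩
    exact ((hmem _).1 ha).2.2
  · intro hz
    obtain ⟨a, rfl⟩ := ZFSet.mem_range.1 (hx z hz)
    exact ⟨a, (hmem _).2 ⟨a.2, a.2, hz⟩, rfl⟩

end Collapse

/-- If every element of one `H(θ)` with `2 ^ κ < θ` is an element of a model with a good filter,
then good hulls exist in all larger `H(θ')`. -/
theorem hasGoodHull_of_forall_filterWitness {α κ θ θ' : Cardinal.{u}} (hκ : κ.IsRegular)
    (hακ : α ≤ κ) (hθ : 2 ^ κ < θ) (h : ∀ A ∈ H θ, FilterWitness α κ θ A) (hθ' : 2 ^ κ < θ') :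
    ∀ Y ∈ H θ', ∀ r ∈ H θ', HasGoodHull (H θ') (cardSet κ) (cardSet α) Y r := by
  intro Y hY r hr
  have hκ0 := hκ.aleph0_le
  have hc : ℵ₀ ≤ (2 : Cardinal.{u}) ^ κ := hκ0.trans (cantor κ).le
  have hκθ' := (cantor κ).trans hθ'
  -- `κ + 1` is transitive and will be included in `Z`, so that the collapse fixes both `κ` and `α`.
  let T : ZFSet.{u} := insert (cardSet κ) (cardSet κ)
  have hT : T.IsTransitive := by
    intro x hx y hy
    rcases ZFSet.mem_insert_iff.1 hx with rfl | hx
    · exact ZFSet.mem_insert_of_mem _ hy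
    · exact ZFSet.mem_insert_of_mem _ (mem_cardSet_of_mem hx hy)
  have hκT : cardSet κ ∈ T := ZFSet.mem_insert _ _
  have hαT : cardSet α ∈ T := by
    rcases hακ.eq_or_lt with rfl | hlt
    · exact hκT
    · exact ZFSet.mem_insert_of_mem _ (mem_cardSet.2 ⟨_, ord_lt_ord.2 hlt, rfl⟩)
  have hκH : cardSet κ ∈ H θ' := toZFSet_mem_H (by rwa [card_ord])
  have hTH : T ∈ H θ' := insert_mem_H (hκ0.trans hκθ'.le) hκH hκH
  have hcard : ∀ (x y : ZFSet.{u}), y.card ≤ 2 ^ κ → (insert x y).card ≤ 2 ^ κ := fun x y hy =>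
    ZFSet.card_insert_le.trans (add_le_of_le hc hy (one_le_aleph0.trans hc))
  obtain ⟨Z, hXZ, hZ, hZc, hZcl⟩ := exists_closed_elementarySubmodel
    (X := insert Y (insert r T)) hκ0
    hθ' (fun x hx => by
      rcases ZFSet.mem_insert_iff.1 hx with rfl | hx
      · exact hY
      rcases ZFSet.mem_insert_iff.1 hx with rfl | hx
      exacts [hr, H_transitive T hTH x hx])
    (hcard _ _ (hcard _ _ (hcard _ _ (by rw [card_cardSet]; exact (cantor κ).le))))
  have hYZ : Y ∈ Z := hXZ (ZFSet.mem_insert _ _)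
  have hrZ : r ∈ Z := hXZ (ZFSet.mem_insert_of_mem _ (ZFSet.mem_insert _ _))
  have hTZ : T ⊆ Z := fun x hx =>
    hXZ (ZFSet.mem_insert_of_mem _ (ZFSet.mem_insert_of_mem _ hx))
  have hNt := isTransitive_range_transCollapse (Z := Z)
  -- The collapse is transitive of size at most `2 ^ κ < θ`. This is where the bound on `θ` makes
  -- the image of `r` an admissible parameter.
  have hNH : ZFSet.range (transCollapse Z) ∈ H θ := by
    refine mem_H_of_isTransitive hNt (lt_of_le_of_lt ?_ hθ)
    refine le_trans ?_ hZc
    rw [← lift_le.{u + 1}, ← ZFSet.cardinalMk_coe_sort, ← ZFSet.cardinalMk_coe_sort]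
    refine mk_le_of_surjective (f := fun a : Z => (⟨transCollapse Z a, ZFSet.mem_range_self a⟩ :
      (ZFSet.range (transCollapse Z)))) fun ⟨z, hz⟩ => ?_
    obtain ⟨a, rfl⟩ := ZFSet.mem_range.1 hz
    exact ⟨a, rfl⟩
  obtain ⟨j, hj⟩ := exists_elementaryEmbedding_transCollapse hZ
  obtain ⟨M, hw, hM, hα, hrM, F, hG⟩ := h _ (H_transitive _ hNH _ (j ⟨r, hrZ⟩).2)
  have key := hG.hasGoodHull hκ (hc.trans hθ.le) hw hM hα (fun x hx y hy => hNt x hx hy)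
    (closedUnderSubsets_range_transCollapse hZ hZcl) (j ⟨Y, hYZ⟩).2 hrM (j ⟨r, hrZ⟩).2
  have h1 := hZ.expressible_iff H_transitive (fun x hx y hy => hNt x hx hy) j
    (Expressible.hasGoodHull (0 : Fin 4) 1 2 3)
    ![⟨_, hTZ hκT⟩, ⟨_, hTZ hαT⟩, ⟨Y, hYZ⟩, ⟨r, hrZ⟩]
  refine h1.2 ?_
  have h2 := (hj ⟨_, hTZ hκT⟩).trans (transCollapse_eq_self hT hTZ hκT)
  have h3 := (hj ⟨_, hTZ hαT⟩).trans (transCollapse_eq_self hT hTZ hαT)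
  simp only [Matrix.cons_val_zero, Matrix.cons_val_one, Matrix.cons_val]
  rw [h2, h3]
  exact key

/-! ### Witnesses in one structure yield witnesses everywhere -/

section

variable {α κ θ : Cardinal.{u}} {A : ZFSet.{u}}

theorem mem_H_of_subset_cardSet (h : κ < θ) (hA : A ⊆ cardSet κ) : A ∈ H θ :=
  mem_H_of_subset (toZFSet_mem_H (by rwa [card_ord])) hA

theorem ForArbitrarilyLargeRegular.mono {P Q : Cardinal.{u} → Prop}
    (h : ForArbitrarilyLargeRegular P) (ν : Cardinal.{u})
    (hPQ : ∀ θ : Cardinal.{u}, θ.IsRegular → ν ≤ θ → P θ → Q θ) : ForArbitrarilyLargeRegular Q := by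
  intro μ
  obtain ⟨θ, hμ, hθ, hP⟩ := h (max μ ν)
  exact ⟨θ, (le_max_left _ _).trans hμ, hθ, hPQ θ hθ ((le_max_right _ _).trans hμ) hP⟩

theorem forArbitrarilyLargeRegular_of_forall {P : Cardinal.{u} → Prop} (ν : Cardinal.{u})
    (h : ∀ θ : Cardinal.{u}, θ.IsRegular → ν ≤ θ → P θ) : ForArbitrarilyLargeRegular P :=
  fun μ => ⟨Order.succ (max ℵ₀ (max μ ν)), (le_max_left _ _).trans <| (le_max_right _ _).trans <|
    Order.le_succ _, isRegular_succ (le_max_left _ _), h _ (isRegular_succ (le_max_left _ _)) <|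
    (le_max_right _ _).trans <| (le_max_right _ _).trans <| Order.le_succ _⟩

variable (hα : α.IsRegular) (hκ : κ.IsRegular) (hακ : α ≤ κ)
include hα hκ hακ

theorem filterWitness_of_forArbitrarilyLargeRegular
    (h : ForArbitrarilyLargeRegular fun θ => FilterWitness α κ θ ∅) (hθ : θ.IsRegular)
    (hκθ : κ < θ) (hA : A ∈ H θ) : FilterWitness α κ θ A :=
  filterWitness_of_forall_hasGoodHull hα.aleph0_le hκ hακ hθ hκθ hA fun μ => by
    obtain ⟨θ', hμ, hθ', hw⟩ := h μ
    exact ⟨θ', hμ, hw.hasGoodHull hκ hακ hθ'.aleph0_le⟩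

theorem filterWitness_of_forall_filterWitness {ν : Cardinal.{u}} (hν : 2 ^ κ < ν)
    (h : ∀ A ∈ H ν, FilterWitness α κ ν A) (hθ : θ.IsRegular) (hκθ : κ < θ) (hA : A ∈ H θ) :
    FilterWitness α κ θ A :=
  filterWitness_of_forall_hasGoodHull hα.aleph0_le hκ hακ hθ hκθ hA fun μ =>
    ⟨max μ (Order.succ (2 ^ κ)), le_max_left _ _, hasGoodHull_of_forall_filterWitness hκ hακ hν h
      ((Order.lt_succ _).trans_le (le_max_right _ _))⟩

end

end RamseyLike

theorem theorem5p5 (α κ : Cardinal.{u}) (hα : α.IsRegular) (hκ : κ.IsRegular) (hακ : α ≤ κ) :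
    List.TFAE
      [ RamseyLike.IsAlphaRamsey α κ,
        RamseyLike.ForArbitrarilyLargeRegular fun θ =>
          ∀ A : ZFSet.{u}, A ⊆ RamseyLike.cardSet κ → RamseyLike.FilterWitness α κ θ A,
        RamseyLike.ForArbitrarilyLargeRegular fun θ =>
          ∀ A ∈ RamseyLike.H θ, RamseyLike.EmbeddingWitness α κ θ A,
        RamseyLike.ForArbitrarilyLargeRegular fun θ =>
          ∀ A ∈ RamseyLike.H θ, RamseyLike.FilterWitness α κ θ A,
        RamseyLike.ForArbitrarilyLargeRegular fun θ => RamseyLike.EmbeddingWitness α κ θ ∅,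
        RamseyLike.ForArbitrarilyLargeRegular fun θ => RamseyLike.FilterWitness α κ θ ∅ ] ∧
    (Cardinal.aleph0 < α →
      List.TFAE
        [ RamseyLike.IsAlphaRamsey α κ,
          ∃ θ : Cardinal.{u}, θ.IsRegular ∧ Order.succ (2 ^ κ) ≤ θ ∧
            ∀ A ∈ RamseyLike.H θ, RamseyLike.EmbeddingWitness α κ θ A,
          ∃ θ : Cardinal.{u}, θ.IsRegular ∧ Order.succ (2 ^ κ) ≤ θ ∧
            ∀ A ∈ RamseyLike.H θ, RamseyLike.FilterWitness α κ θ A,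
          ∀ θ : Cardinal.{u}, θ.IsRegular → Order.succ (2 ^ κ) ≤ θ →
            ∀ A ∈ RamseyLike.H θ, RamseyLike.EmbeddingWitness α κ θ A,
          ∀ θ : Cardinal.{u}, θ.IsRegular → Order.succ (2 ^ κ) ≤ θ →
            ∀ A ∈ RamseyLike.H θ, RamseyLike.FilterWitness α κ θ A ]) := by
  have hEF : ∀ θ : Cardinal.{u}, θ.IsRegular → ∀ A : ZFSet.{u},
      RamseyLike.EmbeddingWitness α κ θ A ↔ RamseyLike.FilterWitness α κ θ A := fun θ hθ A =>
    RamseyLike.embeddingWitness_iff_filterWitness hκ hθ.aleph0_le A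
  -- The weakest condition gives the strongest: the parameter `∅` at arbitrarily large `θ` yields
  -- every parameter at every regular `θ > κ`.
  have hall : RamseyLike.ForArbitrarilyLargeRegular (fun θ => RamseyLike.FilterWitness α κ θ ∅) →
      ∀ θ : Cardinal.{u}, θ.IsRegular → Order.succ κ ≤ θ →
        ∀ A ∈ RamseyLike.H θ, RamseyLike.FilterWitness α κ θ A := fun h θ hθ hκθ A hA =>
    RamseyLike.filterWitness_of_forArbitrarilyLargeRegular hα hκ hακ h hθ
      (Order.succ_le_iff.1 hκθ) hA
  have hempty : ∀ A : ZFSet.{u}, (∅ : ZFSet.{u}) ⊆ A := fun A => ZFSet.empty_subset A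
  have hae : RamseyLike.IsAlphaRamsey α κ →
      RamseyLike.ForArbitrarilyLargeRegular fun θ => RamseyLike.FilterWitness α κ θ ∅ :=
    fun h => h.mono 0 fun θ hθ _ h => (hEF θ hθ ∅).1 (h ∅ (hempty _))
  have hca : (RamseyLike.ForArbitrarilyLargeRegular fun θ =>
      ∀ A ∈ RamseyLike.H θ, RamseyLike.EmbeddingWitness α κ θ A) →
      RamseyLike.IsAlphaRamsey α κ := fun h => h.mono (Order.succ κ) fun θ _ hκθ h A hA =>
    h A (RamseyLike.mem_H_of_subset_cardSet (Order.succ_le_iff.1 hκθ) hA)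
  constructor
  · tfae_have 1 → 2 := fun h => h.mono 0 fun θ hθ _ h A hA => (hEF θ hθ A).1 (h A hA)
    tfae_have 2 → 6 := fun h => h.mono 0 fun θ _ _ h => h ∅ (hempty _)
    tfae_have 6 → 4 := fun h => RamseyLike.forArbitrarilyLargeRegular_of_forall _ (hall h)
    tfae_have 4 → 3 := fun h => h.mono 0 fun θ hθ _ h A hA => (hEF θ hθ A).2 (h A hA)
    tfae_have 3 → 1 := hca
    tfae_have 5 → 6 := fun h => h.mono 0 fun θ hθ _ => (hEF θ hθ ∅).1
    tfae_have 6 → 5 := fun h => h.mono 0 fun θ hθ _ => (hEF θ hθ ∅).2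
    tfae_finish
  · intro _
    -- Regularity of `(2 ^ κ)⁺` itself provides an instance when passing from "for every" to "for
    -- some".
    have hs : (Order.succ ((2 : Cardinal.{u}) ^ κ)).IsRegular :=
      Cardinal.isRegular_succ (hκ.aleph0_le.trans (Cardinal.cantor κ).le)
    tfae_have 1 → 5 := fun h θ hθ h2 =>
      hall (hae h) θ hθ ((Order.succ_le_succ (Cardinal.cantor κ).le).trans h2)
    tfae_have 5 → 4 := fun h θ hθ h2 A hA => (hEF θ hθ A).2 (h θ hθ h2 A hA)
    tfae_have 4 → 2 := fun h => ⟨_, hs, le_rfl, h _ hs le_rfl⟩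
    tfae_have 2 → 3 := fun ⟨θ, hθ, h2, h⟩ => ⟨θ, hθ, h2, fun A hA => (hEF θ hθ A).1 (h A hA)⟩
    tfae_have 3 → 1 := fun ⟨ν, _, h2, h⟩ => hca <|
      RamseyLike.forArbitrarilyLargeRegular_of_forall (Order.succ κ) fun θ hθ hκθ A hA =>
        (hEF θ hθ A).2 <| RamseyLike.filterWitness_of_forall_filterWitness hα hκ hακ
          (Order.succ_le_iff.1 h2) h hθ (Order.succ_le_iff.1 hκθ) hA
    tfae_finish
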